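/- Let $(A_1(t))_{t\ge 0},(A_2(t))_{t\ge0},\dots$ be independent families of events on a probability space with $\sum_{k}\mathbb P(A_k(t))<\infty$ for each $t\ge0$ (the events need not be monotone in $t$). Put $X(t)=\sum_{k\ge1}\mathbf 1_{A_k(t)}$, $b(t)=\mathbb E X(t)$, $a(t)=\operatorname{Var}X(t)$. A function $g$ is called eventually continuous if it is continuous on $[T,\infty)$ for some $T$. Assume the following. (A1) $\lim_{t\to\infty}a(t)=\infty$. (A2) There are $M\in\mathbb N$ and independent processes $(\Phi_1(t))_{t\ge0},(\Phi_2(t))_{t\ge 0},\dots$ with values in $\{0,1,\dots,M\}$ and a.s. nondecreasing paths such that: (a) for each $k$, almost surely, $|\mathbf 1_{A_k(t)}-\mathbf 1_{A_k(s)}|\le\Phi_k(t)-\Phi_k(s)$ for all $0\le s<t$; (b) $f(t):=\mathbb E\sum_{k\ge1}\Phi_k(t)<\infty$ for each $t\ge 0$; (c) $b(0)\le f(0)$. (A3) $f(t)=O(a(t)^{\mu^*})$ as $t\to\infty$ for some $\mu^*\ge1$. Put $\mu:=\inf\{\mu^*\ge 1: f(t)=O(a(t)^{\mu^*})\}$.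 If $\mu=1$, assume in addition that either $f$ is eventually continuous or $\liminf_{t\to\infty}\log f(t-1)/\log f(t)>0$, and that there are $q\ge0$ and a measurable function $\mathcal L$, slowly varying at $\infty$, such that, with $z_s(x):=(\log x)^s\mathcal L(\log x)$, one has $f(t)/a(t)=O(z_q(a(t)))$ as $t\to\infty$, and $f(t)/a(t)\ne O(z_s(a(t)))$ for every $s\in(0,q)$. For $\kappa,\varrho\in(0,1)$ and $n\in\mathbb N$ let $t_n=t_n(\kappa,\varrho):=\inf\{t>0:f(t)>v_n\}$, where $v_n=\exp\big(n^{(1-\kappa)/(q+\varrho+1)}\big)$ if $\mu=1$ and $v_n=n^{(\mu+\varrho)(1-\kappa)/(\mu+\varrho-1)}$ if $\mu>1$. For every $\varrho\in(0,1)$ and all sufficiently small $\kappa>0$, the following two conditions hold. (A4) There is a function $a_0$ with $a(t)\sim a_0(t)$ as $t\to\infty$ and, for each $n$ large enough, a point $s_n\in[t_n,t_{n+1}]$ with $a_0(t)\ge a_0(s_n)$ for all $t\in[t_n,t_{n+1}]$. (A5) For these $s_n$ there is a constant $A>1$, not depending on $n$, such that for each $n$ large enough there is a partition $t_n=t_{0,n}<t_{1,n}<\dots<t_{j_n,n}=t_{n+1}$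 with $j_n\ge 1$ and $1\le f(t_{k,n})-f(t_{k-1,n})\le A$ for $1\le k\le j_n$; and, for every $\varepsilon>0$, the sequence $j_n\exp(-\varepsilon\,a(s_n)^{1/2})$ is summable. (B1) Either $a$ is eventually continuous, or $\lim_{t\to\infty}\log a(t-1)/\log a(t)=1$ (if $\mu=1$), respectively $\lim_{t\to\infty}a(t-1)/a(t)=1$ (if $\mu>1$). For $\gamma>0$ let $\tau_n(\gamma):=\inf\{t>0:a(t)>w_n\}$, where $w_n=\exp\big(n^{(1+\gamma)/(q+1)}\big)$ if $\mu=1$ and $w_n=n^{(1+\gamma)/(\mu-1)}$ if $\mu>1$. At least one of (B21), (B22) holds. (B21) There is $\varepsilon>0$ and, for $\varsigma\in(0,\varepsilon)$ and large $t$, a set $R_\varsigma(t)$ of positive integers such that, for all $\varsigma,\gamma\in(0,\varepsilon)$, the sets $R_\varsigma(\tau_{n_0}(\gamma)),R_\varsigma(\tau_{n_0+1}(\gamma)),\dots$ are disjoint for some $n_0=n_0(\varsigma,\gamma)$, and, for every $\varsigma\in(0,\varepsilon)$, $\operatorname{Var}\big(\sum_{k\in R_\varsigma(t)}\mathbf 1_{A_k(t)}\big)/\operatorname{Var}X(t)\to1-\varsigma$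 as $t\to\infty$. (B22) For large $t$ there is a set $R_0(t)$ of positive integers such that, for all sufficiently small $\gamma>0$, the sets $R_0(\tau_{n_0}(\gamma)),R_0(\tau_{n_0+1}(\gamma)),\dots$ are disjoint for some $n_0=n_0(\gamma)$, and $\operatorname{Var}\big(\sum_{k\in R_0(t)}\mathbf 1_{A_k(t)}\big)/\operatorname{Var}X(t)\to1$ as $t\to\infty$. Then, if $\mu=1$, almost surely $$\limsup_{t\to\infty}\frac{X(t)-\mathbb EX(t)}{\big(2(q+1)\operatorname{Var}X(t)\,\log\log\operatorname{Var}X(t)\big)^{1/2}}=1,\qquad \liminf_{t\to\infty}\frac{X(t)-\mathbb EX(t)}{\big(2(q+1)\operatorname{Var}X(t)\,\log\log\operatorname{Var}X(t)\big)^{1/2}}=-1,$$ and, if $\mu>1$, almost surely $$\limsup_{t\to\infty}\frac{X(t)-\mathbb EX(t)}{\big(2(\mu-1)\operatorname{Var}X(t)\,\log\operatorname{Var}X(t)\big)^{1/2}}=1,\qquad \liminf_{t\to\infty}\frac{X(t)-\mathbb EX(t)}{\big(2(\mu-1)\operatorname{Var}X(t)\,\log\operatorname{Var}X(t)\big)^{1/2}}=-1.$$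 -/

import Mathlib

open MeasureTheory ProbabilityTheory Filter Topology Asymptotics
open scoped NNReal ENNReal

noncomputable section

namespace IndicatorLIL

variable {Ω : Type*} [MeasurableSpace Ω]

/-- The number `∑_{k ∈ S} 1_{A_k(t)}` of those events with index in `S` that occur at time `t`. -/
def countOn (A : ℕ → ℝ≥0 → Set Ω) (S : Set ℕ) (t : ℝ≥0) (ω : Ω) : ℝ :=
  ∑' k : S, (A k t).indicator (fun _ => (1 : ℝ)) ω

/-- The process `X(t) = ∑_k 1_{A_k(t)}`. -/
def count (A : ℕ → ℝ≥0 → Set Ω) (t : ℝ≥0) (ω : Ω) : ℝ :=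
  ∑' k : ℕ, (A k t).indicator (fun _ => (1 : ℝ)) ω

/-- The mean `b(t) = E X(t)`. -/
def meanCount (P : Measure Ω) (A : ℕ → ℝ≥0 → Set Ω) (t : ℝ≥0) : ℝ :=
  ∫ ω, count A t ω ∂P

/-- The variance `a(t) = Var X(t)`. -/
def varCount (P : Measure Ω) (A : ℕ → ℝ≥0 → Set Ω) (t : ℝ≥0) : ℝ :=
  variance (count A t) P

/-- The mean `E Y(t)`, as an element of `[0,∞]`, of `Y(t) = ∑_k Φ_k(t)`. -/
def lmeanMajorant (P : Measure Ω) (Φ : ℕ → ℝ≥0 → Ω → ℕ) (t : ℝ≥0) : ℝ≥0∞ :=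
  ∫⁻ ω, ∑' k : ℕ, (Φ k t ω : ℝ≥0∞) ∂P

/-- The function `f(t) = E Y(t)` as a real number (the mean is assumed finite in `IsMajorant`). -/
def meanMajorant (P : Measure Ω) (Φ : ℕ → ℝ≥0 → Ω → ℕ) (t : ℝ≥0) : ℝ :=
  (lmeanMajorant P Φ t).toReal

/-- Independent families of events `(A_1(t))_t, (A_2(t))_t, …` on a probability space, with
`∑_k P(A_k(t)) < ∞` for every `t`. -/
structure IsIndepEvents (P : Measure Ω) (A : ℕ → ℝ≥0 → Set Ω) : Prop where
  measurableSet : ∀ k t, MeasurableSet (A k t)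
  indep : iIndep (fun k => MeasurableSpace.generateFrom (Set.range (A k))) P
  summable : ∀ t, Summable fun k => P.real (A k t)

/-- `Φ_1, Φ_2, …` are independent processes with values in `{0, …, M}` and almost surely
nondecreasing paths; the increments of `Φ_k` dominate those of `1_{A_k}` along almost every
path; `f(t) = E ∑_k Φ_k(t)` is finite; and `b(0) ≤ f(0)`. -/
structure IsMajorant (P : Measure Ω) (A : ℕ → ℝ≥0 → Set Ω) (M : ℕ)
    (Φ : ℕ → ℝ≥0 → Ω → ℕ) : Prop where
  measurable : ∀ k t, Measurable (Φ k t)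
  indep : iIndepFun (fun (k : ℕ) (ω : Ω) (t : ℝ≥0) => Φ k t ω) P
  le_bound : ∀ k t ω, Φ k t ω ≤ M
  monotone : ∀ k, ∀ᵐ ω ∂P, Monotone fun t => Φ k t ω
  abs_sub_le : ∀ k, ∀ᵐ ω ∂P, ∀ s t : ℝ≥0, s < t →
    |(A k t).indicator (fun _ => (1 : ℝ)) ω - (A k s).indicator (fun _ => (1 : ℝ)) ω| ≤
      (Φ k t ω : ℝ) - (Φ k s ω : ℝ)
  finite_mean : ∀ t, lmeanMajorant P Φ t ≠ ∞
  mean_zero_le : meanCount P A 0 ≤ meanMajorant P Φ 0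

/-- Continuity on some half-line `[T, ∞)`. -/
def EventuallyContinuous (g : ℝ≥0 → ℝ) : Prop :=
  ∃ T : ℝ≥0, ContinuousOn g (Set.Ici T)

/-- Slow variation at infinity. -/
structure SlowlyVarying (L : ℝ → ℝ) : Prop where
  measurable : Measurable L
  pos : ∀ᶠ x in atTop, 0 < L x
  tendsto : ∀ c : ℝ, 0 < c → Tendsto (fun x => L (c * x) / L x) atTop (𝓝 1)

/-- `μ = inf {m ≥ 1 : f(t) = O(a(t)^m) as t → ∞}`. -/
def growthExponent (f a : ℝ≥0 → ℝ) : ℝ :=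
  sInf {m : ℝ | 1 ≤ m ∧ f =O[atTop] fun t => a t ^ m}

/-- `z_s(x) = (log x)^s L(log x)`. -/
def zFun (L : ℝ → ℝ) (s x : ℝ) : ℝ :=
  Real.log x ^ s * L (Real.log x)

/-- `q ≥ 0` is the exact logarithmic order of `f/a` in terms of `a`: for some slowly varying `L`,
`f/a = O(z_q(a))`, while `f/a` is not `O(z_s(a))` for any `s ∈ (0,q)`. -/
def IsLogIndex (f a : ℝ≥0 → ℝ) (q : ℝ) : Prop :=
  0 ≤ q ∧ ∃ L : ℝ → ℝ, SlowlyVarying L ∧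
    (fun t => f t / a t) =O[atTop] (fun t => zFun L q (a t)) ∧
    ∀ s ∈ Set.Ioo 0 q, ¬ (fun t => f t / a t) =O[atTop] (fun t => zFun L s (a t))

/-- Polynomial growth of `f` relative to `a`, with the additional requirements in the case
`μ = 1`. The number `q` is constrained in that case only. -/
structure GrowthCondition (f a : ℝ≥0 → ℝ) (q : ℝ) : Prop where
  polynomial : ∃ m : ℝ, 1 ≤ m ∧ f =O[atTop] fun t => a t ^ m
  regular : growthExponent f a = 1 → EventuallyContinuous f ∨
    0 < liminf (fun t : ℝ≥0 => Real.log (f (t - 1)) / Real.log (f t)) atTop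
  logIndex : growthExponent f a = 1 → IsLogIndex f a q

/-- The first passage time `inf {t > 0 : g(t) > v}`. -/
def passage (g : ℝ≥0 → ℝ) (v : ℝ) : ℝ≥0 :=
  sInf {t : ℝ≥0 | 0 < t ∧ v < g t}

/-- The levels `v_n`: `exp(n^{(1-κ)/(q+ϱ+1)})` if `μ = 1`, and
`n^{(μ+ϱ)(1-κ)/(μ+ϱ-1)}` otherwise. -/
def vLevel (μ q κ ϱ : ℝ) (n : ℕ) : ℝ :=
  open Classical in
  if μ = 1 then Real.exp ((n : ℝ) ^ ((1 - κ) / (q + ϱ + 1)))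
  else (n : ℝ) ^ ((μ + ϱ) * (1 - κ) / (μ + ϱ - 1))

/-- The levels `w_n`: `exp(n^{(1+γ)/(q+1)})` if `μ = 1`, and `n^{(1+γ)/(μ-1)}` otherwise. -/
def wLevel (μ q γ : ℝ) (n : ℕ) : ℝ :=
  open Classical in
  if μ = 1 then Real.exp ((n : ℝ) ^ ((1 + γ) / (q + 1)))
  else (n : ℝ) ^ ((1 + γ) / (μ - 1))

/-- `t_n(κ, ϱ) = inf {t > 0 : f(t) > v_n}`. -/
def tSeq (f a : ℝ≥0 → ℝ) (q κ ϱ : ℝ) (n : ℕ) : ℝ≥0 :=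
  passage f (vLevel (growthExponent f a) q κ ϱ n)

/-- `τ_n(γ) = inf {t > 0 : a(t) > w_n}`. -/
def tauSeq (f a : ℝ≥0 → ℝ) (q γ : ℝ) (n : ℕ) : ℝ≥0 :=
  passage a (wLevel (growthExponent f a) q γ n)

/-- The points `s_n ∈ [t_n, t_{n+1}]` (for large `n`) are minimum points on `[t_n, t_{n+1}]` of
some function `a₀` that is asymptotically equivalent to `a`. -/
def IsNearMinimizer (a : ℝ≥0 → ℝ) (t s : ℕ → ℝ≥0) : Prop :=
  ∃ a₀ : ℝ≥0 → ℝ, a ~[atTop] a₀ ∧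
    ∀ᶠ n in atTop, s n ∈ Set.Icc (t n) (t (n + 1)) ∧
      ∀ u ∈ Set.Icc (t n) (t (n + 1)), a₀ (s n) ≤ a₀ u

/-- For large `n`, the interval `[t_n, t_{n+1}]` has a partition `p_0 < p_1 < … < p_{j_n}` along
which the increments of `f` lie in `[1, B]`, where `B` does not depend on `n`, and
`∑_n j_n exp(-ε a(s_n)^{1/2}) < ∞` for every `ε > 0`. -/
def HasPartitions (f a : ℝ≥0 → ℝ) (t s : ℕ → ℝ≥0) : Prop :=
  ∃ (B : ℝ) (j : ℕ → ℕ), 1 < B ∧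
    (∀ᶠ n in atTop, 1 ≤ j n ∧ ∃ p : ℕ → ℝ≥0, p 0 = t n ∧ p (j n) = t (n + 1) ∧
      ∀ k < j n, p k < p (k + 1) ∧
        1 ≤ f (p (k + 1)) - f (p k) ∧ f (p (k + 1)) - f (p k) ≤ B) ∧
    ∀ ε : ℝ, 0 < ε → Summable fun n => (j n : ℝ) * Real.exp (-ε * √(a (s n)))

/-- For each `ϱ ∈ (0,1)` and each sufficiently small `κ > 0`, the intervals between consecutive
times `t_n(κ, ϱ)` contain near-minimum points `s_n` of `a` and have the required partitions. -/
def LocalCondition (f a : ℝ≥0 → ℝ) (q : ℝ) : Prop :=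
  ∀ ϱ ∈ Set.Ioo (0 : ℝ) 1, ∃ κ₀ > (0 : ℝ), ∀ κ ∈ Set.Ioo 0 κ₀, ∃ s : ℕ → ℝ≥0,
    IsNearMinimizer a (tSeq f a q κ ϱ) s ∧ HasPartitions f a (tSeq f a q κ ϱ) s

/-- The variance is eventually continuous or does not jump too much. -/
def VarianceRegular (μ : ℝ) (a : ℝ≥0 → ℝ) : Prop :=
  EventuallyContinuous a ∨
    ((μ = 1 → Tendsto (fun t : ℝ≥0 => Real.log (a (t - 1)) / Real.log (a t)) atTop (𝓝 1)) ∧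
      (1 < μ → Tendsto (fun t : ℝ≥0 => a (t - 1) / a t) atTop (𝓝 1)))

/-- `R(τ_{n₀}), R(τ_{n₀+1}), …` are pairwise disjoint for some `n₀`. -/
def EventuallyDisjoint (R : ℝ≥0 → Set ℕ) (τ : ℕ → ℝ≥0) : Prop :=
  ∃ n₀ : ℕ, (Set.Ici n₀).PairwiseDisjoint fun n => R (τ n)

/-- `Var(∑_{k ∈ R(t)} 1_{A_k(t)}) / Var X(t) → c` as `t → ∞`. -/
def VarianceShare (P : Measure Ω) (A : ℕ → ℝ≥0 → Set Ω) (R : ℝ≥0 → Set ℕ) (c : ℝ) : Prop :=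
  Tendsto (fun t => variance (countOn A (R t) t) P / varCount P A t) atTop (𝓝 c)

/-- For all small `ς > 0` there are index sets `R_ς(t)` carrying asymptotically the share `1 - ς`
of the variance, and for all small `ς, γ > 0` they are eventually disjoint along
`τ_n(γ)`. -/
def ApproximateBlocks (P : Measure Ω) (A : ℕ → ℝ≥0 → Set Ω) (f : ℝ≥0 → ℝ) (q : ℝ) : Prop :=
  ∃ R : ℝ → ℝ≥0 → Set ℕ, ∃ ε > (0 : ℝ), ∀ ς ∈ Set.Ioo 0 ε,
    (∀ γ ∈ Set.Ioo 0 ε, EventuallyDisjoint (R ς) (tauSeq f (varCount P A) q γ)) ∧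
      VarianceShare P A (R ς) (1 - ς)

/-- There are index sets `R(t)` carrying asymptotically the whole variance that are, for all
small `γ > 0`, eventually disjoint along `τ_n(γ)`. -/
def ExactBlocks (P : Measure Ω) (A : ℕ → ℝ≥0 → Set Ω) (f : ℝ≥0 → ℝ) (q : ℝ) : Prop :=
  ∃ R : ℝ≥0 → Set ℕ,
    (∃ ε > (0 : ℝ), ∀ γ ∈ Set.Ioo 0 ε,
      EventuallyDisjoint R (tauSeq f (varCount P A) q γ)) ∧
      VarianceShare P A R 1

/-- Almost surely, `(X(t) - E X(t)) / r(t)^{1/2}` has upper limit `1` and lower limit `-1` as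
`t → ∞`. -/
def SatisfiesLIL (P : Measure Ω) (A : ℕ → ℝ≥0 → Set Ω) (r : ℝ≥0 → ℝ) : Prop :=
  (∀ᵐ ω ∂P, limsup (fun t : ℝ≥0 =>
      (((count A t ω - meanCount P A t) / √(r t) : ℝ) : EReal)) atTop = 1) ∧
    ∀ᵐ ω ∂P, liminf (fun t : ℝ≥0 =>
      (((count A t ω - meanCount P A t) / √(r t) : ℝ) : EReal)) atTop = -1

end IndicatorLIL

end

/-!
Write `a = Var X`, `b = E X`, `f = E ∑_k Φ_k`, and `Ψ(x) = (q + 1) log log x` if `μ = 1`,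
`Ψ(x) = (μ - 1) log x` if `μ > 1`; the normalization is `(2 a Ψ(a))^{1/2}` in both cases. The
domination of increments gives `|a(t) - a(s)| ≤ f(t) - f(s)` and `|b(t) - b(s)| ≤ f(t) - f(s)`
for `s ≤ t`, and `a ≤ b ≤ f`.

*Levels.* The partitions show that `f` has locally bounded increments at all large times
(`HasPartitions.exists_local_increment`). Hence `f(t_n) = v_n + O(1)` and `a(τ_n) = w_n + O(1)`
(`abs_sub_passage_le`), so that the growth of `f` along `t_n` and of `a` along `τ_n` is read off
from the explicit levels. In particular, `Ψ(a(τ_n(γ))) = (1 + γ) log n + O(1)`. By the relation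
between `f` and `a`, `f(t_{n+1}) - f(t_n)` is at most `n^{-κ/2} a(s_n)`, and `Ψ(a(s_n))` is at
least `(1 - δ/4) log n` up to the choice of small `κ` and `ϱ` (`exponential_levels`,
`polynomial_levels`). For `μ = 1` this uses that a slowly varying function grows slower than any
power (`SlowlyVarying.exists_le_rpow`).

*Upper bound* (`ae_eventually_abs_le`). Exponential moments give
`P(|X(s_n) - b(s_n)| ≥ (1 + δ)(2aΨ(a))^{1/2}) ≤ 2 exp(-(1 + δ)Ψ(a))` at `s_n`, which is summable.
Between `t_n` and `t_{n+1}` the centred process moves by `o(a(s_n)^{1/2})` (`ae_oscillation_le`):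
a chaining argument with two levels handles the partition points, and monotonicity of the
majorizing process controls what happens between them. As `a` is almost minimal at `s_n`, the
bound at `s_n` extends to the whole interval.

*Lower bound* (`ae_frequently_le`). The index sets `R(τ_n)` are replaced by finite subsets `F_n`
that carry almost as much variance. The sums over `F_n` are independent for different `n`, and by
Kolmogorov's lower exponential bound (`le_tail`) each exceeds `(1 - δ)(2aΨ(a))^{1/2}` with
probability at least `1/(2n)`; by the second Borel-Cantelli lemma this happens infinitely often.
The indices outside `F_n` carry a small share of the variance and contribute at most
`δ(2aΨ(a))^{1/2}` for large `n`. The same argument for `-X` gives the lower limit.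
-/

namespace IndicatorLIL

section

variable {Ω : Type*} [MeasurableSpace Ω]

/-! ### Exponential moments of bounded independent variables -/

lemma abs_exp_sub_quadratic_le {y : ℝ} (hy : |y| ≤ 1) :
    |Real.exp y - (1 + y + y ^ 2 / 2)| ≤ 3 * |y| ^ 3 := by
  have h := Complex.norm_exp_sub_sum_le_norm_mul_exp (y : ℂ) 3
  have h2 : Complex.exp (y : ℂ) - ∑ m ∈ Finset.range 3, (y : ℂ) ^ m / m.factorial
      = ((Real.exp y - (1 + y + y ^ 2 / 2) : ℝ) : ℂ) := by
    simp [Finset.sum_range_succ, Nat.factorial]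
  rw [h2, Complex.norm_real, Complex.norm_real, Real.norm_eq_abs, Real.norm_eq_abs] at h
  refine h.trans ?_
  have h3 : Real.exp |y| ≤ 3 :=
    (Real.exp_le_exp.2 hy).trans (Real.exp_one_lt_d9.le.trans (by norm_num))
  have := mul_le_mul_of_nonneg_left h3 (by positivity : 0 ≤ |y| ^ 3)
  linarith

lemma integrable_of_abs_le {P : Measure Ω} [IsFiniteMeasure P] {Y : Ω → ℝ}
    (hm : Measurable Y) {K : ℝ} (hK : ∀ᵐ ω ∂P, |Y ω| ≤ K) : Integrable Y P :=
  Integrable.of_bound hm.aestronglyMeasurable K hK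

lemma abs_integral_exp_sub_le {P : Measure Ω} [IsProbabilityMeasure P] {Y : Ω → ℝ}
    (hm : Measurable Y) {K u : ℝ} (hK : ∀ᵐ ω ∂P, |Y ω| ≤ K) (h0 : ∫ ω, Y ω ∂P = 0)
    (hu : |u| * K ≤ 1) :
    |∫ ω, Real.exp (u * Y ω) ∂P - (1 + u ^ 2 * (∫ ω, Y ω ^ 2 ∂P) / 2)| ≤
      3 * |u| * K * (u ^ 2 * ∫ ω, Y ω ^ 2 ∂P) := by
  have hi1 : Integrable Y P := integrable_of_abs_le hm hK
  have hi2 : Integrable (fun ω => Y ω ^ 2) P := by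
    refine integrable_of_abs_le (hm.pow_const 2) (K := K ^ 2) ?_
    filter_upwards [hK] with ω h
    rw [abs_pow]
    exact pow_le_pow_left₀ (abs_nonneg _) h 2
  have hie : Integrable (fun ω => Real.exp (u * Y ω)) P := by
    refine integrable_of_abs_le (hm.const_mul u).exp (K := Real.exp 1) ?_
    filter_upwards [hK] with ω h
    rw [abs_of_pos (Real.exp_pos _)]
    apply Real.exp_le_exp.2
    calc u * Y ω ≤ |u * Y ω| := le_abs_self _
      _ = |u| * |Y ω| := abs_mul _ _
      _ ≤ |u| * K := by gcongr
      _ ≤ 1 := hu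
  have hq : Integrable (fun ω => 1 + u * Y ω + u ^ 2 / 2 * Y ω ^ 2) P :=
    ((integrable_const _).add (hi1.const_mul u)).add (hi2.const_mul _)
  have hqi : ∫ ω, (1 + u * Y ω + u ^ 2 / 2 * Y ω ^ 2) ∂P
      = 1 + u ^ 2 * (∫ ω, Y ω ^ 2 ∂P) / 2 := by
    have hq1 : Integrable (fun ω => 1 + u * Y ω) P := (integrable_const _).add (hi1.const_mul u)
    rw [integral_add hq1 (hi2.const_mul _),
      integral_add (integrable_const _) (hi1.const_mul u), integral_const_mul,
      integral_const_mul, h0]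
    simp
    ring
  rw [← hqi, ← integral_sub hie hq, ← Real.norm_eq_abs, ← integral_const_mul,
    ← integral_const_mul]
  refine norm_integral_le_of_norm_le ((hi2.const_mul _).const_mul _) ?_
  filter_upwards [hK] with ω h
  have h1 : |u * Y ω| ≤ |u| * K := by rw [abs_mul]; gcongr
  have h2 := abs_exp_sub_quadratic_le (h1.trans hu)
  rw [Real.norm_eq_abs]
  have e : Real.exp (u * Y ω) - (1 + u * Y ω + u ^ 2 / 2 * Y ω ^ 2)
      = Real.exp (u * Y ω) - (1 + u * Y ω + (u * Y ω) ^ 2 / 2) := by ring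
  rw [e]
  refine h2.trans ?_
  calc 3 * |u * Y ω| ^ 3 = 3 * |u * Y ω| * (|u * Y ω| ^ 2) := by ring
    _ = 3 * |u * Y ω| * (u ^ 2 * Y ω ^ 2) := by rw [sq_abs]; ring
    _ ≤ 3 * (|u| * K) * (u ^ 2 * Y ω ^ 2) := by gcongr
    _ = _ := by ring

lemma integral_exp_le {P : Measure Ω} [IsProbabilityMeasure P] {Y : Ω → ℝ}
    (hm : Measurable Y) {K u : ℝ} (hK : ∀ᵐ ω ∂P, |Y ω| ≤ K) (h0 : ∫ ω, Y ω ∂P = 0)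
    (hu : |u| * K ≤ 1) :
    ∫ ω, Real.exp (u * Y ω) ∂P ≤
      Real.exp (u ^ 2 * (∫ ω, Y ω ^ 2 ∂P) * (1 / 2 + 3 * |u| * K)) := by
  have h := (abs_le.1 (abs_integral_exp_sub_le hm hK h0 hu)).2
  have h2 := Real.add_one_le_exp (u ^ 2 * (∫ ω, Y ω ^ 2 ∂P) * (1 / 2 + 3 * |u| * K))
  linarith

lemma exp_sub_sq_le {z : ℝ} (hz : 0 ≤ z) (hz1 : z ≤ 1) : Real.exp (z - z ^ 2) ≤ 1 + z := by
  have h := abs_le.1 (Real.abs_exp_sub_one_sub_id_le (x := z - z ^ 2)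
    (by rw [abs_le]; constructor <;> nlinarith))
  have : (z - z ^ 2) ^ 2 ≤ z ^ 2 := by
    apply pow_le_pow_left₀ <;> nlinarith
  linarith [h.2]

/-- Matching lower bound for the exponential moment of a centred variable bounded by `1`. -/
lemma le_integral_exp {P : Measure Ω} [IsProbabilityMeasure P] {Y : Ω → ℝ}
    (hm : Measurable Y) {u : ℝ} (hK : ∀ᵐ ω ∂P, |Y ω| ≤ 1) (h0 : ∫ ω, Y ω ∂P = 0)
    (hu : |u| ≤ 1 / 8) :
    Real.exp (u ^ 2 * (∫ ω, Y ω ^ 2 ∂P) * (1 / 2 - 4 * |u|)) ≤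
      ∫ ω, Real.exp (u * Y ω) ∂P := by
  have h := (abs_le.1 (abs_integral_exp_sub_le hm hK h0 (u := u) (by linarith))).1
  set v := ∫ ω, Y ω ^ 2 ∂P with hv
  have hv0 : 0 ≤ v := integral_nonneg fun ω => sq_nonneg _
  have hv1 : v ≤ 1 := by
    have : v ≤ ∫ _ω, (1 : ℝ) ∂P := by
      refine integral_mono_of_nonneg (ae_of_all _ fun ω => sq_nonneg _) (integrable_const _) ?_
      filter_upwards [hK] with ω h
      show Y ω ^ 2 ≤ 1
      rw [← sq_abs]
      exact pow_le_one₀ (abs_nonneg _) h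
    simpa using this
  have hu0 := abs_nonneg u
  set w := u ^ 2 * v with hw
  have hw0 : 0 ≤ w := by positivity
  have hwu : w ≤ |u| / 8 := by
    rw [hw, ← sq_abs]
    calc |u| ^ 2 * v ≤ |u| ^ 2 * 1 := by gcongr
      _ ≤ |u| / 8 := by nlinarith
  have hz0 : 0 ≤ w * (1 / 2 - 3 * |u|) := mul_nonneg hw0 (by linarith)
  have hz1 : w * (1 / 2 - 3 * |u|) ≤ w := mul_le_of_le_one_right hw0 (by linarith)
  have h3 := exp_sub_sq_le hz0 (by linarith)
  have h4 : Real.exp (w * (1 / 2 - 4 * |u|)) ≤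
      Real.exp (w * (1 / 2 - 3 * |u|) - (w * (1 / 2 - 3 * |u|)) ^ 2) := by
    apply Real.exp_le_exp.2
    have : (w * (1 / 2 - 3 * |u|)) ^ 2 ≤ w ^ 2 := pow_le_pow_left₀ hz0 hz1 2
    nlinarith
  linarith

lemma integral_exp_sum {P : Measure Ω} {ι : Type*} {Y : ι → Ω → ℝ}
    (hind : iIndepFun Y P) (hm : ∀ k, Measurable (Y k)) (F : Finset ι) (u : ℝ) :
    ∫ ω, Real.exp (u * ∑ k ∈ F, Y k ω) ∂P = ∏ k ∈ F, ∫ ω, Real.exp (u * Y k ω) ∂P := by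
  have := hind.mgf_sum (t := u) hm F
  simpa [mgf, Finset.sum_apply] using this

lemma integral_exp_sum_le {P : Measure Ω} [IsProbabilityMeasure P] {ι : Type*} {Y : ι → Ω → ℝ}
    (hind : iIndepFun Y P) (hm : ∀ k, Measurable (Y k)) {K u : ℝ}
    (hK : ∀ k, ∀ᵐ ω ∂P, |Y k ω| ≤ K) (h0 : ∀ k, ∫ ω, Y k ω ∂P = 0) (hu : |u| * K ≤ 1)
    (F : Finset ι) :
    ∫ ω, Real.exp (u * ∑ k ∈ F, Y k ω) ∂P ≤
      Real.exp (u ^ 2 * (∑ k ∈ F, ∫ ω, Y k ω ^ 2 ∂P) * (1 / 2 + 3 * |u| * K)) := by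
  rw [integral_exp_sum hind hm, Finset.mul_sum, Finset.sum_mul, Real.exp_sum]
  exact Finset.prod_le_prod (fun k _ => integral_nonneg fun ω => (Real.exp_pos _).le)
    fun k _ => integral_exp_le (hm k) (hK k) (h0 k) hu

lemma le_integral_exp_sum {P : Measure Ω} [IsProbabilityMeasure P] {ι : Type*}
    {Y : ι → Ω → ℝ} (hind : iIndepFun Y P) (hm : ∀ k, Measurable (Y k)) {u : ℝ}
    (hK : ∀ k, ∀ᵐ ω ∂P, |Y k ω| ≤ 1) (h0 : ∀ k, ∫ ω, Y k ω ∂P = 0) (hu : |u| ≤ 1 / 8)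
    (F : Finset ι) :
    Real.exp (u ^ 2 * (∑ k ∈ F, ∫ ω, Y k ω ^ 2 ∂P) * (1 / 2 - 4 * |u|)) ≤
      ∫ ω, Real.exp (u * ∑ k ∈ F, Y k ω) ∂P := by
  rw [integral_exp_sum hind hm, Finset.mul_sum, Finset.sum_mul, Real.exp_sum]
  exact Finset.prod_le_prod (fun k _ => (Real.exp_pos _).le)
    fun k _ => le_integral_exp (hm k) (hK k) (h0 k) hu

/-- **Exponential tail bound** for a convergent series of bounded independent variables: the
bound on the exponential moments of the partial sums passes to the limit by Fatou's lemma. -/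
theorem tail_le {P : Measure Ω} [IsProbabilityMeasure P] {Y : ℕ → Ω → ℝ}
    (hind : iIndepFun Y P) (hm : ∀ k, Measurable (Y k)) {K u V : ℝ}
    (hK : ∀ k, ∀ᵐ ω ∂P, |Y k ω| ≤ K) (h0 : ∀ k, ∫ ω, Y k ω ∂P = 0) (hu0 : 0 ≤ u)
    (hK0 : 0 ≤ K) (hu : u * K ≤ 1) (hV : ∀ n, ∑ k ∈ Finset.range n, ∫ ω, Y k ω ^ 2 ∂P ≤ V)
    {S : Ω → ℝ} (hSm : AEMeasurable S P)
    (hS : ∀ᵐ ω ∂P, Tendsto (fun n => ∑ k ∈ Finset.range n, Y k ω) atTop (𝓝 (S ω))) (x : ℝ) :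
    P {ω | x ≤ S ω} ≤ ENNReal.ofReal (Real.exp (-u * x + u ^ 2 * V * (1 / 2 + 3 * u * K))) := by
  set C := Real.exp (u ^ 2 * V * (1 / 2 + 3 * u * K)) with hC
  have hF : ∫⁻ ω, ENNReal.ofReal (Real.exp (u * S ω)) ∂P ≤ ENNReal.ofReal C := by
    have h1 : ∫⁻ ω, ENNReal.ofReal (Real.exp (u * S ω)) ∂P
        ≤ ∫⁻ ω, liminf (fun n : ℕ => ENNReal.ofReal
          (Real.exp (u * ∑ k ∈ Finset.range n, Y k ω))) atTop ∂P := by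
      refine lintegral_mono_ae ?_
      filter_upwards [hS] with ω h
      have : Tendsto (fun n : ℕ => ENNReal.ofReal
          (Real.exp (u * ∑ k ∈ Finset.range n, Y k ω))) atTop
          (𝓝 (ENNReal.ofReal (Real.exp (u * S ω)))) :=
        (ENNReal.continuous_ofReal.tendsto _).comp
          ((Real.continuous_exp.tendsto _).comp (h.const_mul u))
      exact this.liminf_eq.ge
    refine h1.trans ((lintegral_liminf_le fun n => ?_).trans ?_)
    · exact (((Finset.measurable_sum _ fun k _ => hm k).const_mul u).exp).ennreal_ofReal
    refine (liminf_le_limsup).trans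
      (limsup_le_of_le (by isBoundedDefault) (Eventually.of_forall fun n => ?_))
    rw [← ofReal_integral_eq_lintegral_ofReal]
    · apply ENNReal.ofReal_le_ofReal
      refine (integral_exp_sum_le hind hm hK h0 (by rwa [abs_of_nonneg hu0]) _).trans ?_
      rw [abs_of_nonneg hu0]
      apply Real.exp_le_exp.2
      gcongr
      exact hV n
    · have hall : ∀ᵐ ω ∂P, ∀ k, |Y k ω| ≤ K := ae_all_iff.2 hK
      refine integrable_of_abs_le ((Finset.measurable_sum _ fun k _ => hm k).const_mul u).exp
        (K := Real.exp (u * (n * K))) ?_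
      filter_upwards [hall] with ω h
      rw [abs_of_pos (Real.exp_pos _)]
      apply Real.exp_le_exp.2
      gcongr
      calc ∑ k ∈ Finset.range n, Y k ω ≤ ∑ k ∈ Finset.range n, K :=
            Finset.sum_le_sum fun k _ => (le_abs_self _).trans (h k)
        _ = n * K := by simp
    · exact ae_of_all _ fun ω => (Real.exp_pos _).le
  have hmark := mul_meas_ge_le_lintegral₀ (μ := P)
    (f := fun ω => ENNReal.ofReal (Real.exp (u * S ω)))
    ((hSm.const_mul u).exp.ennreal_ofReal) (ENNReal.ofReal (Real.exp (u * x)))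
  have hsub : P {ω | x ≤ S ω} ≤
      P {ω | ENNReal.ofReal (Real.exp (u * x)) ≤ ENNReal.ofReal (Real.exp (u * S ω))} := by
    refine measure_mono fun ω hω => ?_
    apply ENNReal.ofReal_le_ofReal
    apply Real.exp_le_exp.2
    exact mul_le_mul_of_nonneg_left hω hu0
  have hpos : 0 < Real.exp (u * x) := Real.exp_pos _
  have h2 : P {ω | x ≤ S ω} ≤ ENNReal.ofReal C / ENNReal.ofReal (Real.exp (u * x)) := by
    rw [ENNReal.le_div_iff_mul_le (Or.inl (by simpa using hpos)) (Or.inl ENNReal.ofReal_ne_top),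
      mul_comm]
    exact (mul_le_mul_right hsub _).trans (hmark.trans hF)
  refine h2.trans ?_
  rw [← ENNReal.ofReal_div_of_pos hpos, hC, ← Real.exp_sub]
  apply ENNReal.ofReal_le_ofReal
  apply Real.exp_le_exp.2
  linarith

end

section

variable {Ω : Type*} [MeasurableSpace Ω]

/-! ### Kolmogorov's lower exponential bound -/

/-- **Kolmogorov's lower exponential bound.** The exponential moment `E exp(uS)` is concentrated
on the event that `S` is within `δuV` of `uV`: the contributions of the two complementary events
are bounded by exponential moments at `(1 - δ)u` and `(1 + δ)u`. -/
theorem le_tail {P : Measure Ω} [IsProbabilityMeasure P] {ι : Type*} {Y : ι → Ω → ℝ}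
    (hind : iIndepFun Y P) (hm : ∀ k, Measurable (Y k))
    (hK : ∀ k, ∀ᵐ ω ∂P, |Y k ω| ≤ 1) (h0 : ∀ k, ∫ ω, Y k ω ∂P = 0) (F : Finset ι)
    {δ u V : ℝ} (hV : V = ∑ k ∈ F, ∫ ω, Y k ω ^ 2 ∂P) (hδ0 : 0 < δ) (hδ1 : δ < 1)
    (hu0 : 0 < u) (hu : u ≤ δ ^ 2 / 256) (hlarge : 8 ≤ u ^ 2 * V * δ ^ 2) :
    1 / 2 * Real.exp (-(u ^ 2 * V * (1 / 2 + 2 * δ))) ≤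
      P.real {ω | (1 - δ) * u * V ≤ ∑ k ∈ F, Y k ω} := by
  set S : Ω → ℝ := fun ω => ∑ k ∈ F, Y k ω with hSdef
  have hSm : Measurable S := Finset.measurable_sum _ fun k _ => hm k
  have hδ2 : δ ^ 2 ≤ 1 := by nlinarith
  have hQ : 0 < u ^ 2 * V := by
    by_contra h
    push Not at h
    nlinarith [sq_nonneg δ]
  set Q := u ^ 2 * V with hQdef
  have hint : ∀ c : ℝ, Integrable (fun ω => Real.exp (c * S ω)) P := by
    intro c
    have hall : ∀ᵐ ω ∂P, ∀ k ∈ F, |Y k ω| ≤ 1 := by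
      have := (Finset.eventually_all F (l := ae P) (p := fun k ω => |Y k ω| ≤ 1)).2
        fun k _ => hK k
      exact this
    refine integrable_of_abs_le (hSm.const_mul c).exp (K := Real.exp (|c| * F.card)) ?_
    filter_upwards [hall] with ω h
    rw [abs_of_pos (Real.exp_pos _)]
    apply Real.exp_le_exp.2
    refine (le_abs_self _).trans ?_
    rw [abs_mul]
    gcongr
    calc |∑ k ∈ F, Y k ω| ≤ ∑ k ∈ F, |Y k ω| := Finset.abs_sum_le_sum_abs _ _
      _ ≤ ∑ k ∈ F, 1 := Finset.sum_le_sum h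
      _ = F.card := by simp
  -- the exponential moments at `u`, `(1 - δ)u` and `(1 + δ)u`
  have hlow := le_integral_exp_sum hind hm hK h0 (u := u)
    (by rw [abs_of_pos hu0]; linarith) F
  have hup : ∀ c : ℝ, 0 < c → c ≤ 2 → ∫ ω, Real.exp (c * u * S ω) ∂P ≤
      Real.exp (Q * (c ^ 2 * (1 / 2) + δ ^ 2 / 8)) := by
    intro c hc0 hc2
    have hcu : 0 < c * u := by positivity
    have hcu2 : c * u ≤ δ ^ 2 / 128 := by nlinarith
    refine (integral_exp_sum_le hind hm hK h0 (u := c * u) (K := 1)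
      (by rw [abs_of_pos hcu]; linarith) F).trans ?_
    rw [← hV, abs_of_pos hcu]
    apply Real.exp_le_exp.2
    have h1 : c ^ 2 * (3 * (c * u)) ≤ δ ^ 2 / 8 := by
      have : c ^ 2 ≤ 4 := by nlinarith
      calc c ^ 2 * (3 * (c * u)) ≤ 4 * (3 * (δ ^ 2 / 128)) := by gcongr
        _ ≤ δ ^ 2 / 8 := by nlinarith [sq_nonneg δ]
    calc (c * u) ^ 2 * V * (1 / 2 + 3 * (c * u) * 1)
        = Q * (c ^ 2 * (1 / 2) + c ^ 2 * (3 * (c * u))) := by rw [hQdef]; ring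
      _ ≤ _ := by gcongr
  rw [← hV, abs_of_pos hu0] at hlow
  have hlow' : Real.exp (Q * (1 / 2 - δ ^ 2 / 32)) ≤ ∫ ω, Real.exp (u * S ω) ∂P := by
    refine le_trans (Real.exp_le_exp.2 ?_) hlow
    have : 4 * u ≤ δ ^ 2 / 32 := by linarith
    gcongr
  have hE := measurableSet_le (measurable_const (a := (1 - δ) * u * V)) hSm
  set E := {ω | (1 - δ) * u * V ≤ S ω} with hEdef
  -- on `S < (1 - δ)uV` the second term dominates `exp(uS)`, on `S > (1 + δ)uV` the third
  have hpt : ∀ ω, Real.exp (u * S ω) ≤ E.indicator (fun _ => Real.exp ((1 + δ) * Q)) ω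
      + Real.exp (δ * (1 - δ) * Q) * Real.exp ((1 - δ) * u * S ω)
      + Real.exp (-(δ * (1 + δ) * Q)) * Real.exp ((1 + δ) * u * S ω) := by
    intro ω
    have hin : 0 ≤ E.indicator (fun _ => Real.exp ((1 + δ) * Q)) ω :=
      Set.indicator_nonneg (fun _ _ => (Real.exp_pos _).le) _
    rw [← Real.exp_add, ← Real.exp_add]
    have p1 := Real.exp_pos (δ * (1 - δ) * Q + (1 - δ) * u * S ω)
    have p2 := Real.exp_pos (-(δ * (1 + δ) * Q) + (1 + δ) * u * S ω)
    by_cases hω : ω ∈ E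
    · by_cases h2 : S ω ≤ (1 + δ) * u * V
      · have : E.indicator (fun _ => Real.exp ((1 + δ) * Q)) ω = Real.exp ((1 + δ) * Q) :=
          Set.indicator_of_mem hω _
        have h3 : Real.exp (u * S ω) ≤ Real.exp ((1 + δ) * Q) := by
          apply Real.exp_le_exp.2
          calc u * S ω ≤ u * ((1 + δ) * u * V) := by gcongr
            _ = _ := by rw [hQdef]; ring
        linarith
      · push Not at h2
        have h3 : Real.exp (u * S ω) ≤
            Real.exp (-(δ * (1 + δ) * Q) + (1 + δ) * u * S ω) := by
          apply Real.exp_le_exp.2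
          have := mul_le_mul_of_nonneg_left h2.le (by positivity : 0 ≤ δ * u)
          rw [hQdef]
          linarith
        linarith
    · have h2 : S ω < (1 - δ) * u * V := not_le.1 hω
      have h3 : Real.exp (u * S ω) ≤ Real.exp (δ * (1 - δ) * Q + (1 - δ) * u * S ω) := by
        apply Real.exp_le_exp.2
        have := mul_le_mul_of_nonneg_left h2.le (by positivity : 0 ≤ δ * u)
        rw [hQdef]
        linarith
      linarith
  have hi1 : Integrable (E.indicator fun _ => Real.exp ((1 + δ) * Q)) P :=
    (integrable_const _).indicator hE
  have hi2 := (hint ((1 - δ) * u)).const_mul (Real.exp (δ * (1 - δ) * Q))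
  have hi3 := (hint ((1 + δ) * u)).const_mul (Real.exp (-(δ * (1 + δ) * Q)))
  have hi12 : Integrable (fun ω => E.indicator (fun _ => Real.exp ((1 + δ) * Q)) ω
      + Real.exp (δ * (1 - δ) * Q) * Real.exp ((1 - δ) * u * S ω)) P := hi1.add hi2
  have hmain := integral_mono (hint u) (hi12.add hi3) hpt
  have hsplit : ∫ ω, (E.indicator (fun _ => Real.exp ((1 + δ) * Q)) ω
      + Real.exp (δ * (1 - δ) * Q) * Real.exp ((1 - δ) * u * S ω)
      + Real.exp (-(δ * (1 + δ) * Q)) * Real.exp ((1 + δ) * u * S ω)) ∂P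
      = P.real E * Real.exp ((1 + δ) * Q)
        + Real.exp (δ * (1 - δ) * Q) * (∫ ω, Real.exp ((1 - δ) * u * S ω) ∂P)
        + Real.exp (-(δ * (1 + δ) * Q)) * ∫ ω, Real.exp ((1 + δ) * u * S ω) ∂P := by
    rw [integral_add hi12 hi3, integral_add hi1 hi2, integral_const_mul, integral_const_mul,
      integral_indicator_const _ hE, smul_eq_mul]
  have hmain' := hmain.trans_eq hsplit
  -- the tilting costs `δ²Q/2`; after the error terms at least `δ²Q/4 ≥ 2` is left, and `e⁻² ≤ 1/4`
  have hT1 : Real.exp (δ * (1 - δ) * Q) * (∫ ω, Real.exp ((1 - δ) * u * S ω) ∂P) ≤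
      1 / 4 * Real.exp (Q * (1 / 2 - δ ^ 2 / 32)) := by
    have h14 : Real.exp (-2) ≤ 1 / 4 := by
      rw [Real.exp_neg, show (2 : ℝ) = 1 + 1 by norm_num, Real.exp_add]
      have := Real.exp_one_gt_d9
      rw [inv_le_comm₀ (by positivity) (by norm_num)]
      nlinarith
    calc _ ≤ Real.exp (δ * (1 - δ) * Q) *
          Real.exp (Q * ((1 - δ) ^ 2 * (1 / 2) + δ ^ 2 / 8)) := by
          gcongr
          exact hup (1 - δ) (by linarith) (by linarith)
      _ ≤ Real.exp (-2) * Real.exp (Q * (1 / 2 - δ ^ 2 / 32)) := by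
          rw [← Real.exp_add, ← Real.exp_add]
          apply Real.exp_le_exp.2
          nlinarith
      _ ≤ _ := by gcongr
  have hT2 : Real.exp (-(δ * (1 + δ) * Q)) * (∫ ω, Real.exp ((1 + δ) * u * S ω) ∂P) ≤
      1 / 4 * Real.exp (Q * (1 / 2 - δ ^ 2 / 32)) := by
    have h14 : Real.exp (-2) ≤ 1 / 4 := by
      rw [Real.exp_neg, show (2 : ℝ) = 1 + 1 by norm_num, Real.exp_add]
      have := Real.exp_one_gt_d9
      rw [inv_le_comm₀ (by positivity) (by norm_num)]
      nlinarith
    calc _ ≤ Real.exp (-(δ * (1 + δ) * Q)) *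
          Real.exp (Q * ((1 + δ) ^ 2 * (1 / 2) + δ ^ 2 / 8)) := by
          gcongr
          exact hup (1 + δ) (by linarith) (by linarith)
      _ ≤ Real.exp (-2) * Real.exp (Q * (1 / 2 - δ ^ 2 / 32)) := by
          rw [← Real.exp_add, ← Real.exp_add]
          apply Real.exp_le_exp.2
          nlinarith
      _ ≤ _ := by gcongr
  have hfin : 1 / 2 * Real.exp (Q * (1 / 2 - δ ^ 2 / 32)) ≤
      P.real E * Real.exp ((1 + δ) * Q) := by linarith
  have : 1 / 2 * Real.exp (Q * (1 / 2 - δ ^ 2 / 32)) * Real.exp (-((1 + δ) * Q)) ≤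
      P.real E := by
    rw [Real.exp_neg, ← div_eq_mul_inv, div_le_iff₀ (Real.exp_pos _)]
    exact hfin
  refine le_trans ?_ this
  rw [mul_assoc (1 / 2 : ℝ) (Real.exp _), ← Real.exp_add]
  gcongr
  nlinarith

end

section

variable {Ω : Type*} [MeasurableSpace Ω]

/-! ### Series of bounded independent variables -/

lemma ae_eventually_notMem_of_summable {P : Measure Ω} {E : ℕ → Set Ω} {g : ℕ → ℝ}
    (hg : Summable g) (hE : ∀ᶠ n in atTop, P (E n) ≤ ENNReal.ofReal (g n)) :
    ∀ᵐ ω ∂P, ∀ᶠ n in atTop, ω ∉ E n := by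
  obtain ⟨N, hN⟩ := eventually_atTop.1 hE
  have h1 : (∑' n, P (E (n + N))) ≠ ∞ := by
    have h2 : Summable fun n => |g (n + N)| := ((summable_nat_add_iff N).2 hg).abs
    refine ne_top_of_le_ne_top h2.tsum_ofReal_ne_top (ENNReal.tsum_le_tsum fun n => ?_)
    exact (hN _ (by omega)).trans (ENNReal.ofReal_le_ofReal (le_abs_self _))
  filter_upwards [ae_eventually_notMem h1] with ω hω
  obtain ⟨m, hm⟩ := eventually_atTop.1 hω
  refine eventually_atTop.2 ⟨m + N, fun n hn => ?_⟩
  have := hm (n - N) (by omega)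
  rwa [Nat.sub_add_cancel (by omega)] at this

lemma ae_summable_of_summable_integral {P : Measure Ω} {Z : ℕ → Ω → ℝ}
    (hZ : ∀ k, Integrable (Z k) P) (hs : Summable fun k => ∫ ω, |Z k ω| ∂P) :
    ∀ᵐ ω ∂P, Summable fun k => Z k ω := by
  have h1 : ∫⁻ ω, ∑' k, ENNReal.ofReal |Z k ω| ∂P ≠ ∞ := by
    rw [lintegral_tsum fun k => (hZ k).abs.aemeasurable.ennreal_ofReal]
    simp_rw [← ofReal_integral_eq_lintegral_ofReal (hZ _).abs (ae_of_all _ fun ω => abs_nonneg _)]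
    exact hs.tsum_ofReal_ne_top
  have h2 : AEMeasurable (fun ω => ∑' k, ENNReal.ofReal |Z k ω|) P :=
    AEMeasurable.tsum fun k => (hZ k).abs.aemeasurable.ennreal_ofReal
  filter_upwards [ae_lt_top' h2 h1] with ω hω
  have : Summable fun k => (ENNReal.ofReal |Z k ω|).toReal := ENNReal.summable_toReal hω.ne
  simp only [ENNReal.toReal_ofReal (abs_nonneg _)] at this
  exact this.of_abs

lemma hasSum_integral_of_summable {P : Measure Ω} {Z : ℕ → Ω → ℝ}
    (hZ : ∀ k, Integrable (Z k) P) (hs : Summable fun k => ∫ ω, |Z k ω| ∂P) :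
    HasSum (fun k => ∫ ω, Z k ω ∂P) (∫ ω, ∑' k, Z k ω ∂P) :=
  hasSum_integral_of_summable_integral_norm hZ (by simpa only [Real.norm_eq_abs] using hs)

lemma aemeasurable_tsum_of_ae_summable {P : Measure Ω} {Z : ℕ → Ω → ℝ}
    (hm : ∀ k, Measurable (Z k)) (hs : ∀ᵐ ω ∂P, Summable fun k => Z k ω) :
    AEMeasurable (fun ω => ∑' k, Z k ω) P := by
  refine aemeasurable_of_tendsto_metrizable_ae (u := atTop)
    (f := fun (n : ℕ) ω => ∑ k ∈ Finset.range n, Z k ω)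
    (fun n => (Finset.measurable_sum _ fun k _ => hm k).aemeasurable) ?_
  filter_upwards [hs] with ω h using h.hasSum.tendsto_sum_nat

/-- Two-sided exponential tail bound for the deviation of a series of independent variables,
bounded by `K`, from its mean. -/
theorem series_tail_le {P : Measure Ω} [IsProbabilityMeasure P] {Z : ℕ → Ω → ℝ}
    (hind : iIndepFun Z P) (hm : ∀ k, Measurable (Z k)) {K u V : ℝ}
    (hK : ∀ k, ∀ᵐ ω ∂P, |Z k ω| ≤ K) (hs : Summable fun k => ∫ ω, |Z k ω| ∂P)
    (hu0 : 0 ≤ u) (hK0 : 0 ≤ K) (hu : u * (2 * K) ≤ 1)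
    (hV : ∀ n, ∑ k ∈ Finset.range n, variance (Z k) P ≤ V) (x : ℝ) :
    P {ω | x ≤ |∑' k, Z k ω - ∑' k, ∫ ω', Z k ω' ∂P|} ≤
      ENNReal.ofReal (2 * Real.exp (-u * x + u ^ 2 * V * (1 / 2 + 6 * u * K))) := by
  have hi : ∀ k, Integrable (Z k) P := fun k => integrable_of_abs_le (hm k) (hK k)
  have hmean := hasSum_integral_of_summable hi hs
  have hae := ae_summable_of_summable_integral hi hs
  have key : ∀ c : ℝ, |c| = 1 →
      P {ω | x ≤ c * (∑' k, Z k ω - ∑' k, ∫ ω', Z k ω' ∂P)} ≤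
      ENNReal.ofReal (Real.exp (-u * x + u ^ 2 * V * (1 / 2 + 3 * u * (2 * K)))) := by
    intro c hc
    have hc2 : c ^ 2 = 1 := by rw [← sq_abs, hc]; norm_num
    refine tail_le (Y := fun k ω => c * (Z k ω - ∫ ω', Z k ω' ∂P)) ?_ ?_ ?_ ?_ hu0 (by positivity)
      hu ?_ ?_ ?_ x
    · exact hind.comp (fun k y => c * (y - ∫ ω', Z k ω' ∂P)) fun k => by fun_prop
    · intro k
      exact ((hm k).sub_const _).const_mul c
    · intro k
      have h1 : |∫ ω', Z k ω' ∂P| ≤ K := by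
        have := norm_integral_le_of_norm_le (f := Z k) (μ := P) (integrable_const K)
          (by simpa using hK k)
        simpa using this
      filter_upwards [hK k] with ω h
      rw [abs_mul, hc, one_mul]
      exact (abs_sub _ _).trans (by linarith)
    · intro k
      rw [integral_const_mul, integral_sub (hi k) (integrable_const _)]
      simp
    · intro n
      refine le_of_eq_of_le (Finset.sum_congr rfl fun k _ => ?_) (hV n)
      rw [variance_eq_integral (hm k).aemeasurable]
      congr with ω
      rw [mul_pow, hc2, one_mul]
    · exact ((aemeasurable_tsum_of_ae_summable hm hae).sub_const _).const_mul c
    · filter_upwards [hae] with ω h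
      exact ((h.hasSum.sub hmean.summable.hasSum).mul_left c).tendsto_sum_nat
  have hsub : {ω | x ≤ |∑' k, Z k ω - ∑' k, ∫ ω', Z k ω' ∂P|} ⊆
      {ω | x ≤ 1 * (∑' k, Z k ω - ∑' k, ∫ ω', Z k ω' ∂P)} ∪
      {ω | x ≤ (-1) * (∑' k, Z k ω - ∑' k, ∫ ω', Z k ω' ∂P)} := by
    intro ω h
    simp only [Set.mem_union, Set.mem_ofPred_eq] at h ⊢
    rcases le_abs.1 h with h | h
    · left; linarith
    · right; linarith
  refine (measure_mono hsub).trans ((measure_union_le _ _).trans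
    ((add_le_add (key 1 (by simp)) (key (-1) (by simp))).trans ?_))
  rw [← ENNReal.ofReal_add (Real.exp_pos _).le (Real.exp_pos _).le]
  apply ENNReal.ofReal_le_ofReal
  rw [← two_mul, show 3 * u * (2 * K) = 6 * u * K by ring]

/-- The variance of a convergent series of independent `[0, 1]`-valued variables is the sum of
the variances. The square of the sum is integrable by monotone convergence, and dominates the
squares of the partial sums. -/
theorem hasSum_variance {P : Measure Ω} [IsProbabilityMeasure P] {Z : ℕ → Ω → ℝ}
    (hind : iIndepFun Z P) (hm : ∀ k, Measurable (Z k)) (h0 : ∀ k ω, 0 ≤ Z k ω)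
    (h1 : ∀ k ω, Z k ω ≤ 1) (hs : Summable fun k => ∫ ω, Z k ω ∂P) :
    HasSum (fun k => variance (Z k) P) (variance (fun ω => ∑' k, Z k ω) P) := by
  have hK : ∀ k, ∀ᵐ ω ∂P, |Z k ω| ≤ 1 := fun k => ae_of_all _ fun ω => by
    rw [abs_of_nonneg (h0 k ω)]; exact h1 k ω
  have hi : ∀ k, Integrable (Z k) P := fun k => integrable_of_abs_le (hm k) (hK k)
  have hs' : Summable fun k => ∫ ω, |Z k ω| ∂P := by
    simpa only [abs_of_nonneg (h0 _ _)] using hs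
  have hae := ae_summable_of_summable_integral hi hs'
  have hmean := hasSum_integral_of_summable hi hs'
  have hL : ∀ k, MemLp (Z k) 2 P := fun k => MemLp.of_bound (hm k).aestronglyMeasurable 1
    (by simpa using hK k)
  set S : ℕ → Ω → ℝ := fun n ω => ∑ k ∈ Finset.range n, Z k ω with hS
  have hSm : ∀ n, Measurable (S n) := fun n => Finset.measurable_sum _ fun k _ => hm k
  have hSL : ∀ n, MemLp (S n) 2 P := fun n => memLp_finsetSum _ fun k _ => hL k
  have hSvar : ∀ n, variance (S n) P = ∑ k ∈ Finset.range n, variance (Z k) P := by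
    intro n
    have := IndepFun.variance_sum (μ := P) (X := Z) (s := Finset.range n) (fun k _ => hL k)
      (fun i _ j _ hij => hind.indepFun hij)
    rw [← this]
    congr 1
    ext ω
    simp [hS]
  have hSmean : ∀ n, ∫ ω, S n ω ∂P = ∑ k ∈ Finset.range n, ∫ ω, Z k ω ∂P := fun n =>
    integral_finsetSum _ fun k _ => hi k
  set T : Ω → ℝ := fun ω => ∑' k, Z k ω with hT
  have hTm : AEMeasurable T P := aemeasurable_tsum_of_ae_summable hm hae
  have hS0 : ∀ n ω, 0 ≤ S n ω := fun n ω => Finset.sum_nonneg fun k _ => h0 k ω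
  have hT0 : ∀ ω, 0 ≤ T ω := fun ω => tsum_nonneg fun k => h0 k ω
  have hconv : ∀ᵐ ω ∂P, Tendsto (fun n => S n ω) atTop (𝓝 (T ω)) := by
    filter_upwards [hae] with ω h using h.hasSum.tendsto_sum_nat
  set m := ∑' k, ∫ ω, Z k ω ∂P with hmdef
  have hz0 : ∀ k, 0 ≤ ∫ ω, Z k ω ∂P := fun k => integral_nonneg (h0 k)
  have hmn : ∀ n, ∑ k ∈ Finset.range n, ∫ ω, Z k ω ∂P ≤ m := fun n =>
    hs.sum_le_tsum _ fun k _ => hz0 k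
  have hvar_le : ∀ k, variance (Z k) P ≤ ∫ ω, Z k ω ∂P := by
    intro k
    refine (variance_le_expectation_sq (hm k).aestronglyMeasurable).trans ?_
    refine integral_mono_of_nonneg (ae_of_all _ fun ω => sq_nonneg _) (hi k)
      (ae_of_all _ fun ω => ?_)
    have := h0 k ω
    have := h1 k ω
    show Z k ω ^ 2 ≤ Z k ω
    nlinarith
  have hS2 : ∀ n, ∫ ω, S n ω ^ 2 ∂P ≤ m + m ^ 2 := by
    intro n
    have e := variance_eq_sub (hSL n)
    rw [hSvar, hSmean] at e
    have e2 : ∫ ω, S n ω ^ 2 ∂P = ∑ k ∈ Finset.range n, variance (Z k) P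
        + (∑ k ∈ Finset.range n, ∫ ω, Z k ω ∂P) ^ 2 := by
      simp only [Pi.pow_apply] at e
      linarith
    rw [e2]
    have h3 := (Finset.sum_le_sum fun k (_ : k ∈ Finset.range n) => hvar_le k).trans (hmn n)
    have h4 : (∑ k ∈ Finset.range n, ∫ ω, Z k ω ∂P) ^ 2 ≤ m ^ 2 :=
      pow_le_pow_left₀ (Finset.sum_nonneg fun k _ => hz0 k) (hmn n) 2
    linarith
  have hT2 : Integrable (fun ω => T ω ^ 2) P := by
    refine ⟨(hTm.pow_const 2).aestronglyMeasurable, ?_⟩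
    rw [hasFiniteIntegral_iff_ofReal (ae_of_all _ fun ω => sq_nonneg _)]
    have hle : ∫⁻ ω, ENNReal.ofReal (T ω ^ 2) ∂P
        ≤ ∫⁻ ω, liminf (fun n : ℕ => ENNReal.ofReal (S n ω ^ 2)) atTop ∂P := by
      refine lintegral_mono_ae ?_
      filter_upwards [hconv] with ω h
      exact (((ENNReal.continuous_ofReal.tendsto _).comp (h.pow 2)).liminf_eq).ge
    refine (hle.trans ((lintegral_liminf_le fun n =>
      ((hSm n).pow_const 2).ennreal_ofReal).trans ?_)).trans_lt
      (ENNReal.ofReal_lt_top (r := m + m ^ 2))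
    refine (liminf_le_limsup).trans
      (limsup_le_of_le (by isBoundedDefault) (Eventually.of_forall fun n => ?_))
    rw [← ofReal_integral_eq_lintegral_ofReal (hSL n).integrable_sq
      (ae_of_all _ fun ω => sq_nonneg _)]
    exact ENNReal.ofReal_le_ofReal (hS2 n)
  have hTL : MemLp T 2 P := (memLp_two_iff_integrable_sq hTm.aestronglyMeasurable).2 hT2
  have hlim2 : Tendsto (fun n => ∫ ω, S n ω ^ 2 ∂P) atTop (𝓝 (∫ ω, T ω ^ 2 ∂P)) := by
    refine tendsto_integral_of_dominated_convergence (fun ω => T ω ^ 2)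
      (fun n => ((hSm n).pow_const 2).aestronglyMeasurable) hT2 (fun n => ?_) ?_
    · filter_upwards [hae] with ω h
      rw [Real.norm_eq_abs, abs_of_nonneg (sq_nonneg _)]
      exact pow_le_pow_left₀ (hS0 n ω) (h.sum_le_tsum _ fun k _ => h0 k ω) 2
    · filter_upwards [hconv] with ω h using h.pow 2
  have hlim1 : Tendsto (fun n => ∫ ω, S n ω ∂P) atTop (𝓝 (∫ ω, T ω ∂P)) := by
    simp_rw [hSmean]
    exact hmean.tendsto_sum_nat
  have hlim : Tendsto (fun n => variance (S n) P) atTop (𝓝 (variance T P)) := by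
    rw [variance_eq_sub hTL]
    simp_rw [fun n => variance_eq_sub (hSL n)]
    exact hlim2.sub (hlim1.pow 2)
  simp_rw [hSvar] at hlim
  have hsv : Summable fun k => variance (Z k) P :=
    hs.of_nonneg_of_le (fun k => variance_nonneg _ _) hvar_le
  have := tendsto_nhds_unique hlim hsv.hasSum.tendsto_sum_nat
  rw [this]
  exact hsv.hasSum

/-- Events depending on disjoint blocks of independent variables are independent. -/
lemma iIndepSet_of_disjoint_blocks {P : Measure Ω} {β : Type*} [MeasurableSpace β]
    {W : ℕ → Ω → β} (hind : iIndepFun W P) (hm : ∀ k, Measurable (W k)) (F : ℕ → Set ℕ)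
    (hF : Pairwise fun i j => Disjoint (F i) (F j)) (E : ℕ → Set Ω)
    (hE : ∀ n, MeasurableSet[⨆ k ∈ F n, MeasurableSpace.comap (W k) inferInstance] (E n)) :
    iIndepSet E P := by
  have : IsProbabilityMeasure P := hind.isProbabilityMeasure
  have hle : ∀ S : Set ℕ, (⨆ k ∈ S, MeasurableSpace.comap (W k) inferInstance)
      ≤ (inferInstance : MeasurableSpace Ω) :=
    fun S => iSup₂_le fun k _ => (hm k).comap_le
  rw [iIndepSet_iff_meas_biInter fun n => hle _ _ (hE n)]
  intro s
  induction s using Finset.induction_on with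
  | empty => simp
  | insert a s ha ih =>
    rw [Finset.prod_insert ha, ← ih, Finset.set_biInter_insert]
    have hd : Disjoint (F a) (⋃ i ∈ s, F i) := by
      simp only [Set.disjoint_iUnion_right]
      intro i hi
      exact hF (by rintro rfl; exact ha hi)
    have hI := indep_iSup_of_disjoint (fun k => (hm k).comap_le) hind.iIndep hd
    refine (Indep_iff _ _ _).1 hI _ _ (hE a) ?_
    refine Finset.measurableSet_biInter s fun i hi => ?_
    refine (?_ : (⨆ k ∈ F i, MeasurableSpace.comap (W k) inferInstance) ≤ _) _ (hE i)
    exact biSup_mono fun k hk => Set.mem_biUnion hi hk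

end

section

/-! ### Means, variances and increments of the counting process -/

/-- The indicator of the event `A_k(t)`. -/
noncomputable def occ {Ω : Type*} (A : ℕ → ℝ≥0 → Set Ω) (k : ℕ) (t : ℝ≥0) (ω : Ω) : ℝ :=
  (A k t).indicator (fun _ => (1 : ℝ)) ω

section paths

variable {Ω : Type*} {A : ℕ → ℝ≥0 → Set Ω} {Φ : ℕ → ℝ≥0 → Ω → ℕ}

lemma occ_nonneg (k : ℕ) (t : ℝ≥0) (ω : Ω) : 0 ≤ occ A k t ω :=
  Set.indicator_nonneg (fun _ _ => zero_le_one) _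

lemma occ_le_one (k : ℕ) (t : ℝ≥0) (ω : Ω) : occ A k t ω ≤ 1 :=
  Set.indicator_le_self' (fun _ _ => zero_le_one) _

lemma abs_occ_le_one (k : ℕ) (t : ℝ≥0) (ω : Ω) : |occ A k t ω| ≤ 1 := by
  rw [abs_of_nonneg (occ_nonneg k t ω)]
  exact occ_le_one k t ω

lemma occ_sq (k : ℕ) (t : ℝ≥0) (ω : Ω) : occ A k t ω ^ 2 = occ A k t ω := by
  by_cases h : ω ∈ A k t <;> simp [occ, h]

/-- The indicator of `A_k(t)` for `k ∈ R`, and `0` for other `k`. -/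
noncomputable def occOn {Ω : Type*} (A : ℕ → ℝ≥0 → Set Ω) (R : Set ℕ) (k : ℕ) (t : ℝ≥0)
    (ω : Ω) : ℝ :=
  R.indicator (fun k => occ A k t ω) k

lemma occOn_nonneg (R : Set ℕ) (k : ℕ) (t : ℝ≥0) (ω : Ω) : 0 ≤ occOn A R k t ω :=
  Set.indicator_nonneg (fun _ _ => occ_nonneg _ _ _) _

lemma occOn_le_occ (R : Set ℕ) (k : ℕ) (t : ℝ≥0) (ω : Ω) : occOn A R k t ω ≤ occ A k t ω :=
  Set.indicator_le_self' (fun _ _ => occ_nonneg _ _ _) _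

lemma occOn_of_mem {R : Set ℕ} {k : ℕ} (hk : k ∈ R) (t : ℝ≥0) : occOn A R k t = occ A k t := by
  ext ω
  simp [occOn, hk]

lemma occOn_of_notMem {R : Set ℕ} {k : ℕ} (hk : k ∉ R) (t : ℝ≥0) :
    occOn A R k t = 0 := by
  ext ω
  simp [occOn, hk]

lemma countOn_eq (R : Set ℕ) (t : ℝ≥0) (ω : Ω) :
    countOn A R t ω = ∑' k, occOn A R k t ω :=
  tsum_subtype R fun k => occ A k t ω

lemma count_eq (t : ℝ≥0) (ω : Ω) : count A t ω = ∑' k, occ A k t ω := rfl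

lemma countOn_univ (t : ℝ≥0) : countOn A Set.univ t = count A t := by
  ext ω
  rw [countOn_eq, count_eq]
  simp [occOn]

/-- The process `Y(t) = ∑_k Φ_k(t)`. -/
noncomputable def majorantSum {Ω : Type*} (Φ : ℕ → ℝ≥0 → Ω → ℕ) (t : ℝ≥0) (ω : Ω) : ℝ :=
  ∑' k, (Φ k t ω : ℝ)

/-- The sample points at which both series converge for all times and the increments of every
`Φ_k` dominate those of `1_{A_k}`. -/
structure RegularPath {Ω : Type*} (A : ℕ → ℝ≥0 → Set Ω) (Φ : ℕ → ℝ≥0 → Ω → ℕ) (ω : Ω) : Prop where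
  summable_occ : ∀ t, Summable fun k => occ A k t ω
  summable_majorant : ∀ t, Summable fun k => (Φ k t ω : ℝ)
  monotone : ∀ k, Monotone fun t => Φ k t ω
  abs_sub_le : ∀ k s t, s ≤ t →
    |occ A k t ω - occ A k s ω| ≤ (Φ k t ω : ℝ) - (Φ k s ω : ℝ)

lemma RegularPath.majorantSum_mono {ω : Ω} (h : RegularPath A Φ ω) {s t : ℝ≥0} (hst : s ≤ t) :
    majorantSum Φ s ω ≤ majorantSum Φ t ω :=
  (h.summable_majorant s).tsum_le_tsum (fun k => by exact_mod_cast h.monotone k hst)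
    (h.summable_majorant t)

lemma RegularPath.abs_count_sub_le {ω : Ω} (h : RegularPath A Φ ω) {s t : ℝ≥0} (hst : s ≤ t) :
    |count A t ω - count A s ω| ≤ majorantSum Φ t ω - majorantSum Φ s ω := by
  rw [count_eq, count_eq, majorantSum, majorantSum,
    ← (h.summable_occ t).tsum_sub (h.summable_occ s),
    ← (h.summable_majorant t).tsum_sub (h.summable_majorant s)]
  have hs := (h.summable_majorant t).sub (h.summable_majorant s)
  have := tsum_of_norm_bounded hs.hasSum (f := fun k => occ A k t ω - occ A k s ω)
    fun k => h.abs_sub_le k s t hst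
  simpa using this

end paths

variable {Ω : Type*} [MeasurableSpace Ω]

section events

variable {P : Measure Ω} {A : ℕ → ℝ≥0 → Set Ω}

lemma measurable_occ (hA : IsIndepEvents P A) (k : ℕ) (t : ℝ≥0) : Measurable (occ A k t) :=
  measurable_const.indicator (hA.measurableSet k t)

lemma measurable_occ_path (hA : IsIndepEvents P A) (k : ℕ) :
    Measurable fun ω t => occ A k t ω :=
  measurable_pi_lambda _ fun t => measurable_occ hA k t

lemma integral_occ (hA : IsIndepEvents P A) (k : ℕ) (t : ℝ≥0) :
    ∫ ω, occ A k t ω ∂P = P.real (A k t) := by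
  simp only [occ]
  rw [integral_indicator_const _ (hA.measurableSet k t), smul_eq_mul, mul_one]

lemma iIndepFun_occ (hA : IsIndepEvents P A) :
    iIndepFun (fun k ω (t : ℝ≥0) => occ A k t ω) P := by
  rw [iIndepFun_iff_iIndep]
  refine iIndep_of_iIndep_of_le hA.indep fun k => ?_
  refine measurable_iff_comap_le.1 ?_
  refine (@measurable_pi_iff _ _ _ (_) _ _).2 fun t => ?_
  exact (@measurable_const _ _ _ (_) 1).indicator
    (MeasurableSpace.measurableSet_generateFrom ⟨t, rfl⟩)

lemma measurable_occOn (hA : IsIndepEvents P A) (R : Set ℕ) (k : ℕ) (t : ℝ≥0) :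
    Measurable (occOn A R k t) := by
  by_cases hk : k ∈ R
  · rw [occOn_of_mem hk]; exact measurable_occ hA k t
  · rw [occOn_of_notMem hk]; exact measurable_const

lemma iIndepFun_occOn (hA : IsIndepEvents P A) (R : Set ℕ) (t : ℝ≥0) :
    iIndepFun (fun k => occOn A R k t) P := by
  have := (iIndepFun_occ hA).comp (fun k (x : ℝ≥0 → ℝ) => R.indicator (fun _ => x t) k)
    fun k => by
      by_cases hk : k ∈ R
      · simpa [hk] using measurable_pi_apply t
      · simp [hk]
  exact this

variable [IsProbabilityMeasure P]

lemma integrable_occ (hA : IsIndepEvents P A) (k : ℕ) (t : ℝ≥0) : Integrable (occ A k t) P :=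
  integrable_of_abs_le (measurable_occ hA k t) (ae_of_all _ (abs_occ_le_one k t))

lemma summable_integral_occOn (hA : IsIndepEvents P A) (R : Set ℕ) (t : ℝ≥0) :
    Summable fun k => ∫ ω, occOn A R k t ω ∂P := by
  refine (hA.summable t).of_nonneg_of_le (fun k => integral_nonneg (occOn_nonneg R k t))
    fun k => ?_
  rw [← integral_occ hA]
  exact integral_mono_of_nonneg (ae_of_all _ (occOn_nonneg R k t)) (integrable_occ hA k t)
    (ae_of_all _ (occOn_le_occ R k t))

lemma hasSum_meanCount (hA : IsIndepEvents P A) (t : ℝ≥0) :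
    HasSum (fun k => P.real (A k t)) (meanCount P A t) := by
  have := hasSum_integral_of_summable (P := P) (Z := fun k => occ A k t)
    (fun k => integrable_occ hA k t)
    (by simpa only [abs_of_nonneg (occ_nonneg _ _ _), integral_occ hA] using hA.summable t)
  simp only [integral_occ hA] at this
  exact this

lemma ae_summable_occ (hA : IsIndepEvents P A) (t : ℝ≥0) :
    ∀ᵐ ω ∂P, Summable fun k => occ A k t ω :=
  ae_summable_of_summable_integral (fun k => integrable_occ hA k t)
    (by simpa only [abs_of_nonneg (occ_nonneg _ _ _), integral_occ hA] using hA.summable t)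

lemma variance_occ (hA : IsIndepEvents P A) (k : ℕ) (t : ℝ≥0) :
    variance (occ A k t) P = P.real (A k t) * (1 - P.real (A k t)) := by
  have hL : MemLp (occ A k t) 2 P := MemLp.of_bound
    (measurable_occ hA k t).aestronglyMeasurable 1 (ae_of_all _ (abs_occ_le_one k t))
  rw [variance_eq_sub hL]
  simp only [Pi.pow_apply, occ_sq, integral_occ hA]
  ring

lemma hasSum_variance_countOn (hA : IsIndepEvents P A) (R : Set ℕ) (t : ℝ≥0) :
    HasSum (R.indicator fun k => variance (occ A k t) P) (variance (countOn A R t) P) := by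
  have h := hasSum_variance (iIndepFun_occOn hA R t) (fun k => measurable_occOn hA R k t)
    (fun k => occOn_nonneg R k t) (fun k ω => (occOn_le_occ R k t ω).trans (occ_le_one k t ω))
    (summable_integral_occOn hA R t)
  have e : countOn A R t = fun ω => ∑' k, occOn A R k t ω := funext (countOn_eq R t)
  rw [e]
  convert h using 2 with k
  by_cases hk : k ∈ R
  · simp [hk, occOn_of_mem hk]
  · simp [hk, occOn_of_notMem hk, variance_zero]

lemma hasSum_varCount (hA : IsIndepEvents P A) (t : ℝ≥0) :
    HasSum (fun k => variance (occ A k t) P) (varCount P A t) := by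
  have := hasSum_variance_countOn hA Set.univ t
  rw [countOn_univ, Set.indicator_univ] at this
  exact this

lemma varCount_le_meanCount (hA : IsIndepEvents P A) (t : ℝ≥0) :
    varCount P A t ≤ meanCount P A t := by
  refine hasSum_le (fun k => ?_) (hasSum_varCount hA t) (hasSum_meanCount hA t)
  rw [variance_occ hA]
  have : 0 ≤ P.real (A k t) := measureReal_nonneg
  nlinarith

/-- Exponential tail bound for the centred number of events with index in `R`. -/
lemma countOn_tail_le (hA : IsIndepEvents P A) (R : Set ℕ) (t : ℝ≥0) {u : ℝ} (hu0 : 0 ≤ u)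
    (hu : 2 * u ≤ 1) (x : ℝ) :
    P {ω | x ≤ |countOn A R t ω - ∑' k, ∫ ω', occOn A R k t ω' ∂P|} ≤
      ENNReal.ofReal (2 * Real.exp
        (-u * x + u ^ 2 * variance (countOn A R t) P * (1 / 2 + 6 * u))) := by
  have h := series_tail_le (P := P) (iIndepFun_occOn hA R t)
    (fun k => measurable_occOn hA R k t) (K := 1) (u := u) (V := variance (countOn A R t) P)
    (fun k => ae_of_all _ fun ω => by
      rw [abs_of_nonneg (occOn_nonneg R k t ω)]
      exact (occOn_le_occ R k t ω).trans (occ_le_one k t ω))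
    (by simpa only [abs_of_nonneg (occOn_nonneg _ _ _ _)] using summable_integral_occOn hA R t)
    hu0 zero_le_one (by linarith)
    (fun n => by
      refine le_trans (Finset.sum_le_sum fun k _ => ?_) (sum_le_hasSum (Finset.range n)
        (fun k _ => Set.indicator_nonneg (fun _ _ => variance_nonneg _ _) _)
        (hasSum_variance_countOn hA R t))
      by_cases hk : k ∈ R
      · simp [hk, occOn_of_mem hk]
      · simp [hk, occOn_of_notMem hk, variance_zero]) x
  simpa only [countOn_eq, mul_one] using h

lemma count_tail_le (hA : IsIndepEvents P A) (t : ℝ≥0) {u : ℝ} (hu0 : 0 ≤ u)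
    (hu : 2 * u ≤ 1) (x : ℝ) :
    P {ω | x ≤ |count A t ω - meanCount P A t|} ≤
      ENNReal.ofReal (2 * Real.exp
        (-u * x + u ^ 2 * varCount P A t * (1 / 2 + 6 * u))) := by
  have h := countOn_tail_le hA Set.univ t hu0 hu x
  have e : ∑' k, ∫ ω', occOn A Set.univ k t ω' ∂P = meanCount P A t := by
    rw [← (hasSum_meanCount hA t).tsum_eq]
    refine tsum_congr fun k => ?_
    rw [occOn_of_mem (Set.mem_univ k), integral_occ hA]
  rw [e, countOn_univ] at h
  exact h

end events

section majorant

variable {P : Measure Ω} {A : ℕ → ℝ≥0 → Set Ω} {M : ℕ} {Φ : ℕ → ℝ≥0 → Ω → ℕ}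

lemma integrable_majorant [IsProbabilityMeasure P] (hΦ : IsMajorant P A M Φ) (k : ℕ) (t : ℝ≥0) :
    Integrable (fun ω => (Φ k t ω : ℝ)) P := by
  refine integrable_of_abs_le (measurable_from_nat.comp (hΦ.measurable k t)) (K := M)
    (ae_of_all _ fun ω => ?_)
  simp only [Nat.abs_cast]
  exact_mod_cast hΦ.le_bound k t ω

lemma hasSum_meanMajorant [IsProbabilityMeasure P] (hΦ : IsMajorant P A M Φ) (t : ℝ≥0) :
    HasSum (fun k => ∫ ω, (Φ k t ω : ℝ) ∂P) (meanMajorant P Φ t) := by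
  have e : lmeanMajorant P Φ t = ∑' k, ENNReal.ofReal (∫ ω, (Φ k t ω : ℝ) ∂P) := by
    have hm : ∀ k, AEMeasurable (fun ω => (Φ k t ω : ℝ≥0∞)) P := fun k =>
      (measurable_from_nat.comp (hΦ.measurable k t)).aemeasurable
    rw [lmeanMajorant, lintegral_tsum hm]
    refine tsum_congr fun k => ?_
    rw [ofReal_integral_eq_lintegral_ofReal (integrable_majorant hΦ k t)
      (ae_of_all _ fun ω => Nat.cast_nonneg _)]
    simp
  have hne := hΦ.finite_mean t
  rw [e] at hne
  have hs := ENNReal.hasSum_toReal hne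
  have e2 : meanMajorant P Φ t = ∑' k, (ENNReal.ofReal (∫ ω, (Φ k t ω : ℝ) ∂P)).toReal := by
    rw [meanMajorant, e, ENNReal.tsum_toReal_eq fun k => ENNReal.ofReal_ne_top]
  rw [e2]
  have e3 : ∀ k, (ENNReal.ofReal (∫ ω, (Φ k t ω : ℝ) ∂P)).toReal = ∫ ω, (Φ k t ω : ℝ) ∂P :=
    fun k => ENNReal.toReal_ofReal (integral_nonneg fun ω => Nat.cast_nonneg _)
  simpa only [e3] using hs

variable [IsProbabilityMeasure P]

lemma integral_abs_occ_sub_le (hA : IsIndepEvents P A) (hΦ : IsMajorant P A M Φ) (k : ℕ)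
    {s t : ℝ≥0} (hst : s ≤ t) :
    ∫ ω, |occ A k t ω - occ A k s ω| ∂P ≤
      ∫ ω, (Φ k t ω : ℝ) ∂P - ∫ ω, (Φ k s ω : ℝ) ∂P := by
  rcases hst.eq_or_lt with rfl | hst
  · simp
  rw [← integral_sub (integrable_majorant hΦ k t) (integrable_majorant hΦ k s)]
  refine integral_mono_ae ((integrable_occ hA k t).sub (integrable_occ hA k s)).abs
    ((integrable_majorant hΦ k t).sub (integrable_majorant hΦ k s)) ?_
  filter_upwards [hΦ.abs_sub_le k] with ω h using h s t hst

lemma abs_prob_sub_le (hA : IsIndepEvents P A) (hΦ : IsMajorant P A M Φ) (k : ℕ)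
    {s t : ℝ≥0} (hst : s ≤ t) :
    |P.real (A k t) - P.real (A k s)| ≤
      ∫ ω, (Φ k t ω : ℝ) ∂P - ∫ ω, (Φ k s ω : ℝ) ∂P := by
  rw [← integral_occ hA, ← integral_occ hA,
    ← integral_sub (integrable_occ hA k t) (integrable_occ hA k s)]
  exact (abs_integral_le_integral_abs).trans (integral_abs_occ_sub_le hA hΦ k hst)

lemma meanMajorant_mono (hA : IsIndepEvents P A) (hΦ : IsMajorant P A M Φ) :
    Monotone (meanMajorant P Φ) := fun s t hst =>
  hasSum_le (fun k => by
    have := (abs_nonneg _).trans (abs_prob_sub_le hA hΦ k hst)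
    linarith) (hasSum_meanMajorant hΦ s) (hasSum_meanMajorant hΦ t)

lemma abs_meanCount_sub_le (hA : IsIndepEvents P A) (hΦ : IsMajorant P A M Φ)
    {s t : ℝ≥0} (hst : s ≤ t) :
    |meanCount P A t - meanCount P A s| ≤ meanMajorant P Φ t - meanMajorant P Φ s := by
  have h := tsum_of_norm_bounded
    ((hasSum_meanMajorant hΦ t).sub (hasSum_meanMajorant hΦ s))
    (f := fun k => P.real (A k t) - P.real (A k s)) fun k => abs_prob_sub_le hA hΦ k hst
  rwa [((hasSum_meanCount hA t).sub (hasSum_meanCount hA s)).tsum_eq] at h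

lemma abs_varCount_sub_le (hA : IsIndepEvents P A) (hΦ : IsMajorant P A M Φ)
    {s t : ℝ≥0} (hst : s ≤ t) :
    |varCount P A t - varCount P A s| ≤ meanMajorant P Φ t - meanMajorant P Φ s := by
  have h := tsum_of_norm_bounded
    ((hasSum_meanMajorant hΦ t).sub (hasSum_meanMajorant hΦ s))
    (f := fun k => variance (occ A k t) P - variance (occ A k s) P) fun k => by
      refine le_trans ?_ (abs_prob_sub_le hA hΦ k hst)
      rw [variance_occ hA, variance_occ hA, Real.norm_eq_abs]
      have e : P.real (A k t) * (1 - P.real (A k t)) - P.real (A k s) * (1 - P.real (A k s))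
        = (P.real (A k t) - P.real (A k s)) * (1 - P.real (A k t) - P.real (A k s)) := by ring
      rw [e, abs_mul]
      refine mul_le_of_le_one_right (abs_nonneg _) ?_
      have h1 : 0 ≤ P.real (A k t) := measureReal_nonneg
      have h2 : 0 ≤ P.real (A k s) := measureReal_nonneg
      have h3 : P.real (A k t) ≤ 1 := measureReal_le_one
      have h4 : P.real (A k s) ≤ 1 := measureReal_le_one
      rw [abs_le]
      constructor <;> linarith
  rwa [((hasSum_varCount hA t).sub (hasSum_varCount hA s)).tsum_eq] at h

lemma varCount_le_meanMajorant (hA : IsIndepEvents P A) (hΦ : IsMajorant P A M Φ) (t : ℝ≥0) :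
    varCount P A t ≤ meanMajorant P Φ t := by
  have h1 := varCount_le_meanCount hA t
  have h2 := (abs_le.1 (abs_meanCount_sub_le hA hΦ (zero_le : 0 ≤ t))).2
  have h3 := hΦ.mean_zero_le
  linarith

lemma ae_summable_majorant (hΦ : IsMajorant P A M Φ) (t : ℝ≥0) :
    ∀ᵐ ω ∂P, Summable fun k => (Φ k t ω : ℝ) :=
  ae_summable_of_summable_integral (Z := fun k ω => (Φ k t ω : ℝ))
    (fun k => integrable_majorant hΦ k t)
    (by simpa only [Nat.abs_cast] using (hasSum_meanMajorant hΦ t).summable)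

lemma ae_regularPath (hA : IsIndepEvents P A) (hΦ : IsMajorant P A M Φ) :
    ∀ᵐ ω ∂P, RegularPath A Φ ω := by
  have h1 : ∀ᵐ ω ∂P, ∀ n : ℕ, Summable fun k => (Φ k n ω : ℝ) :=
    ae_all_iff.2 fun n => ae_summable_majorant hΦ n
  filter_upwards [h1, ae_summable_occ hA 0, ae_all_iff.2 hΦ.monotone,
    ae_all_iff.2 hΦ.abs_sub_le] with ω hs h0 hmono hsub
  have hsub' : ∀ k s t, s ≤ t → |occ A k t ω - occ A k s ω| ≤ (Φ k t ω : ℝ) - (Φ k s ω : ℝ) := by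
    intro k s t hst
    rcases hst.eq_or_lt with rfl | hst
    · simp
    · exact hsub k s t hst
  have hsm : ∀ t : ℝ≥0, Summable fun k => (Φ k t ω : ℝ) := by
    intro t
    obtain ⟨n, hn⟩ := exists_nat_ge t
    exact (hs n).of_nonneg_of_le (fun k => Nat.cast_nonneg _)
      fun k => by exact_mod_cast hmono k hn
  refine ⟨fun t => ?_, hsm, hmono, hsub'⟩
  have hd : Summable fun k => occ A k t ω - occ A k 0 ω :=
    ((hsm t).sub (hsm 0)).of_norm_bounded fun k => hsub' k 0 t zero_le
  simpa using hd.add h0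

/-- Exponential tail bound for the increments of the centred counting process. -/
lemma count_sub_tail_le (hA : IsIndepEvents P A) (hΦ : IsMajorant P A M Φ) {s t : ℝ≥0}
    (hst : s ≤ t) {u : ℝ} (hu0 : 0 ≤ u) (hu : 2 * u ≤ 1) (x : ℝ) :
    P {ω | x ≤ |(count A t ω - meanCount P A t) - (count A s ω - meanCount P A s)|} ≤
      ENNReal.ofReal (2 * Real.exp
        (-u * x + 4 * u ^ 2 * (meanMajorant P Φ t - meanMajorant P Φ s))) := by
  set Z : ℕ → Ω → ℝ := fun k ω => occ A k t ω - occ A k s ω with hZ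
  have hm : ∀ k, Measurable (Z k) := fun k => (measurable_occ hA k t).sub (measurable_occ hA k s)
  have hK : ∀ k ω, |Z k ω| ≤ 1 := fun k ω => by
    have h1 := occ_nonneg (A := A) k t ω
    have h2 := occ_nonneg (A := A) k s ω
    have h3 := occ_le_one (A := A) k t ω
    have h4 := occ_le_one (A := A) k s ω
    rw [abs_le]
    constructor <;> simp only [hZ] <;> linarith
  have hind : iIndepFun Z P :=
    (iIndepFun_occ hA).comp (fun _ (x : ℝ≥0 → ℝ) => x t - x s)
      fun _ => (measurable_pi_apply t).sub (measurable_pi_apply s)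
  have hsumd := (hasSum_meanMajorant hΦ t).sub (hasSum_meanMajorant hΦ s)
  have hs : Summable fun k => ∫ ω, |Z k ω| ∂P :=
    hsumd.summable.of_nonneg_of_le (fun k => integral_nonneg fun ω => abs_nonneg _)
      fun k => integral_abs_occ_sub_le hA hΦ k hst
  have hvar : ∀ k, variance (Z k) P ≤
      ∫ ω, (Φ k t ω : ℝ) ∂P - ∫ ω, (Φ k s ω : ℝ) ∂P := by
    intro k
    refine (variance_le_expectation_sq (hm k).aestronglyMeasurable).trans
      (le_trans ?_ (integral_abs_occ_sub_le hA hΦ k hst))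
    refine integral_mono_of_nonneg (ae_of_all _ fun ω => sq_nonneg _)
      ((integrable_occ hA k t).sub (integrable_occ hA k s)).abs (ae_of_all _ fun ω => ?_)
    show Z k ω ^ 2 ≤ |Z k ω|
    have := hK k ω
    have := abs_nonneg (Z k ω)
    rw [← sq_abs]
    nlinarith
  have h := series_tail_le hind hm (fun k => ae_of_all _ (hK k)) hs hu0 zero_le_one
    (by linarith) (V := meanMajorant P Φ t - meanMajorant P Φ s)
    (fun n => (Finset.sum_le_sum fun k _ => hvar k).trans
      (sum_le_hasSum _ (fun k _ => (variance_nonneg _ _).trans (hvar k)) hsumd)) x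
  have hmean : ∑' k, ∫ ω, Z k ω ∂P = meanCount P A t - meanCount P A s := by
    rw [← ((hasSum_meanCount hA t).sub (hasSum_meanCount hA s)).tsum_eq]
    refine tsum_congr fun k => ?_
    rw [integral_sub (integrable_occ hA k t) (integrable_occ hA k s), integral_occ hA,
      integral_occ hA]
  rw [hmean] at h
  have hae : {ω | x ≤ |(count A t ω - meanCount P A t) - (count A s ω - meanCount P A s)|}
      ≤ᵐ[P] {ω | x ≤ |∑' k, Z k ω - (meanCount P A t - meanCount P A s)|} := by
    filter_upwards [ae_summable_occ hA t, ae_summable_occ hA s] with ω h1 h2 h3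
    have e : ∑' k, Z k ω = count A t ω - count A s ω := h1.tsum_sub h2
    have h3' : x ≤ |(count A t ω - meanCount P A t) - (count A s ω - meanCount P A s)| := h3
    show x ≤ |∑' k, Z k ω - (meanCount P A t - meanCount P A s)|
    rw [e]
    convert h3' using 2
    ring
  refine (measure_mono_ae hae).trans (h.trans ?_)
  apply ENNReal.ofReal_le_ofReal
  have hd0 : 0 ≤ meanMajorant P Φ t - meanMajorant P Φ s :=
    sub_nonneg.2 (meanMajorant_mono hA hΦ hst)
  refine mul_le_mul_of_nonneg_left (Real.exp_le_exp.2 (add_le_add le_rfl ?_)) zero_le_two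
  calc u ^ 2 * (meanMajorant P Φ t - meanMajorant P Φ s) * (1 / 2 + 6 * u * 1)
      ≤ u ^ 2 * (meanMajorant P Φ t - meanMajorant P Φ s) * 4 := by
        gcongr
        linarith
    _ = _ := by ring

/-- Exponential tail bound for the increments of the majorizing process. -/
lemma majorantSum_sub_tail_le (hA : IsIndepEvents P A) (hΦ : IsMajorant P A M Φ) {s t : ℝ≥0}
    (hst : s ≤ t) {u : ℝ} (hu0 : 0 ≤ u) (hu : u * (2 * M) ≤ 1) (x : ℝ) :
    P {ω | x ≤ |(majorantSum Φ t ω - majorantSum Φ s ω) -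
        (meanMajorant P Φ t - meanMajorant P Φ s)|} ≤
      ENNReal.ofReal (2 * Real.exp
        (-u * x + 4 * u ^ 2 * (M * (meanMajorant P Φ t - meanMajorant P Φ s)))) := by
  set Z : ℕ → Ω → ℝ := fun k ω => (Φ k t ω : ℝ) - (Φ k s ω : ℝ) with hZ
  have hm : ∀ k, Measurable (Z k) := fun k =>
    (measurable_from_nat.comp (hΦ.measurable k t)).sub
      (measurable_from_nat.comp (hΦ.measurable k s))
  have hK : ∀ k ω, |Z k ω| ≤ M := fun k ω => by
    have h1 : (0 : ℝ) ≤ Φ k t ω := Nat.cast_nonneg _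
    have h2 : (0 : ℝ) ≤ Φ k s ω := Nat.cast_nonneg _
    have h3 : (Φ k t ω : ℝ) ≤ M := by exact_mod_cast hΦ.le_bound k t ω
    have h4 : (Φ k s ω : ℝ) ≤ M := by exact_mod_cast hΦ.le_bound k s ω
    rw [abs_le]
    constructor <;> simp only [hZ] <;> linarith
  have hZ0 : ∀ k, ∀ᵐ ω ∂P, 0 ≤ Z k ω := by
    intro k
    filter_upwards [hΦ.monotone k] with ω h
    exact sub_nonneg.2 (by exact_mod_cast h hst)
  have hind : iIndepFun Z P :=
    hΦ.indep.comp (fun _ (x : ℝ≥0 → ℕ) => (x t : ℝ) - (x s : ℝ))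
      fun _ => (measurable_from_nat.comp (measurable_pi_apply t)).sub
        (measurable_from_nat.comp (measurable_pi_apply s))
  have hsumd := (hasSum_meanMajorant hΦ t).sub (hasSum_meanMajorant hΦ s)
  have hint : ∀ k, ∫ ω, Z k ω ∂P = ∫ ω, (Φ k t ω : ℝ) ∂P - ∫ ω, (Φ k s ω : ℝ) ∂P :=
    fun k => integral_sub (integrable_majorant hΦ k t) (integrable_majorant hΦ k s)
  have hintabs : ∀ k, ∫ ω, |Z k ω| ∂P = ∫ ω, Z k ω ∂P := fun k =>
    integral_congr_ae (by filter_upwards [hZ0 k] with ω h using abs_of_nonneg h)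
  have hs : Summable fun k => ∫ ω, |Z k ω| ∂P := by
    simp only [hintabs, hint]
    exact hsumd.summable
  have hvar : ∀ k, variance (Z k) P ≤
      M * (∫ ω, (Φ k t ω : ℝ) ∂P - ∫ ω, (Φ k s ω : ℝ) ∂P) := by
    intro k
    refine (variance_le_expectation_sq (hm k).aestronglyMeasurable).trans ?_
    rw [← hint, ← hintabs, ← integral_const_mul]
    refine integral_mono_of_nonneg (ae_of_all _ fun ω => sq_nonneg _)
      (((integrable_majorant hΦ k t).sub (integrable_majorant hΦ k s)).abs.const_mul _)
      (ae_of_all _ fun ω => ?_)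
    show Z k ω ^ 2 ≤ M * |Z k ω|
    rw [← sq_abs, sq]
    exact mul_le_mul_of_nonneg_right (hK k ω) (abs_nonneg _)
  have h := series_tail_le hind hm (fun k => ae_of_all _ (hK k)) hs hu0 (Nat.cast_nonneg M)
    hu (V := M * (meanMajorant P Φ t - meanMajorant P Φ s))
    (fun n => (Finset.sum_le_sum fun k _ => hvar k).trans
      (sum_le_hasSum _ (fun k _ => (variance_nonneg _ _).trans (hvar k))
        (hsumd.mul_left (M : ℝ)))) x
  simp only [hint] at h
  rw [hsumd.tsum_eq] at h
  have hae : {ω | x ≤ |(majorantSum Φ t ω - majorantSum Φ s ω) -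
        (meanMajorant P Φ t - meanMajorant P Φ s)|}
      ≤ᵐ[P] {ω | x ≤ |∑' k, Z k ω - (meanMajorant P Φ t - meanMajorant P Φ s)|} := by
    filter_upwards [ae_summable_majorant hΦ t, ae_summable_majorant hΦ s] with ω h1 h2 h3
    have e : ∑' k, Z k ω = majorantSum Φ t ω - majorantSum Φ s ω := h1.tsum_sub h2
    show x ≤ |∑' k, Z k ω - (meanMajorant P Φ t - meanMajorant P Φ s)|
    rw [e]
    exact h3
  refine (measure_mono_ae hae).trans (h.trans ?_)
  apply ENNReal.ofReal_le_ofReal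
  have hd0 : 0 ≤ meanMajorant P Φ t - meanMajorant P Φ s :=
    sub_nonneg.2 (meanMajorant_mono hA hΦ hst)
  refine mul_le_mul_of_nonneg_left (Real.exp_le_exp.2 (add_le_add le_rfl ?_)) zero_le_two
  calc u ^ 2 * (M * (meanMajorant P Φ t - meanMajorant P Φ s)) * (1 / 2 + 6 * u * M)
      ≤ u ^ 2 * (M * (meanMajorant P Φ t - meanMajorant P Φ s)) * 4 := by
        gcongr
        linarith
    _ = _ := by ring

end majorant

end

section

/-! ### Oscillation of the centred process between partition points -/

/-- `p 0 < p 1 < … < p j` is a partition along which the increments of `f` lie in `[1, B]`. -/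
structure IsUnitPartition (f : ℝ≥0 → ℝ) (B : ℝ) (j : ℕ) (p : ℕ → ℝ≥0) : Prop where
  lt : ∀ k < j, p k < p (k + 1)
  one_le : ∀ k < j, 1 ≤ f (p (k + 1)) - f (p k)
  le : ∀ k < j, f (p (k + 1)) - f (p k) ≤ B

section partition

variable {f : ℝ≥0 → ℝ} {B : ℝ} {j : ℕ} {p : ℕ → ℝ≥0}

lemma IsUnitPartition.mono (h : IsUnitPartition f B j p) {k l : ℕ} (hkl : k ≤ l) (hl : l ≤ j) :
    p k ≤ p l := by
  induction l, hkl using Nat.le_induction with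
  | base => exact le_rfl
  | succ l hkl ih => exact (ih (by omega)).trans (h.lt l (by omega)).le

lemma IsUnitPartition.sub_le (h : IsUnitPartition f B j p) {k l : ℕ} (hkl : k ≤ l) (hl : l ≤ j) :
    f (p l) - f (p k) ≤ B * (l - k : ℕ) := by
  induction l, hkl using Nat.le_induction with
  | base => simp
  | succ l hkl ih =>
    have h1 := ih (by omega)
    have h2 := h.le l (by omega)
    rw [Nat.succ_sub hkl]
    push_cast
    linarith

lemma IsUnitPartition.le_sub (h : IsUnitPartition f B j p) {l : ℕ} (hl : l ≤ j) :
    (l : ℝ) ≤ f (p l) - f (p 0) := by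
  induction l with
  | zero => simp
  | succ l ih =>
    have h1 := ih (by omega)
    have h2 := h.one_le l (by omega)
    push_cast
    linarith

lemma IsUnitPartition.exists_mem_Icc (h : IsUnitPartition f B j p) (hj : 1 ≤ j) {u : ℝ≥0}
    (h0 : p 0 ≤ u) (h1 : u ≤ p j) : ∃ k < j, p k ≤ u ∧ u ≤ p (k + 1) := by
  classical
  have hex : ∃ k, k ≤ j ∧ u ≤ p k := ⟨j, le_rfl, h1⟩
  obtain ⟨hle, hu⟩ := Nat.find_spec hex
  set k := Nat.find hex
  rcases Nat.eq_zero_or_pos k with hk | hk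
  · refine ⟨0, by omega, h0, ?_⟩
    rw [hk] at hu
    exact hu.trans (h.lt 0 (by omega)).le
  · refine ⟨k - 1, by omega, ?_, by rwa [Nat.sub_add_cancel hk]⟩
    have := Nat.find_min hex (m := k - 1) (by omega)
    by_contra hlt
    exact this ⟨by omega, (not_le.1 hlt).le⟩

end partition

variable {Ω : Type*} [MeasurableSpace Ω]

/-- The centred process `X(t) - E X(t)`. -/
noncomputable def centredCount (P : Measure Ω) (A : ℕ → ℝ≥0 → Set Ω) (t : ℝ≥0) (ω : Ω) : ℝ :=
  count A t ω - meanCount P A t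

lemma exp_neg_min_le (x y : ℝ) : Real.exp (-min x y) ≤ Real.exp (-x) + Real.exp (-y) := by
  have h1 := Real.exp_pos (-x)
  have h2 := Real.exp_pos (-y)
  rcases min_cases x y with ⟨h, _⟩ | ⟨h, _⟩ <;> rw [h] <;> linarith

section

variable {P : Measure Ω} [IsProbabilityMeasure P] {A : ℕ → ℝ≥0 → Set Ω} {M : ℕ}
  {Φ : ℕ → ℝ≥0 → Ω → ℕ}

lemma centredCount_sub_tail_le (hA : IsIndepEvents P A) (hΦ : IsMajorant P A M Φ) {s t : ℝ≥0}
    (hst : s ≤ t) {x D : ℝ} (hx : 0 ≤ x) (hD : 0 < D)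
    (hfD : meanMajorant P Φ t - meanMajorant P Φ s ≤ D) :
    P {ω | x ≤ |centredCount P A t ω - centredCount P A s ω|} ≤
      ENNReal.ofReal (2 * (Real.exp (-(x / 4)) + Real.exp (-(x ^ 2 / (16 * D))))) := by
  -- `x / (8D)` minimizes the exponent `-ux + 4u²D`; the exponential bound needs `u ≤ 1/2`
  set u := min (1 / 2) (x / (8 * D)) with hu
  have hu0 : 0 ≤ u := le_min (by norm_num) (by positivity)
  have hu1 : u ≤ 1 / 2 := min_le_left _ _
  have hu2 : u ≤ x / (8 * D) := min_le_right _ _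
  refine (count_sub_tail_le hA hΦ hst hu0 (by linarith) x).trans ?_
  apply ENNReal.ofReal_le_ofReal
  refine mul_le_mul_of_nonneg_left ((Real.exp_le_exp.2 ?_).trans (exp_neg_min_le _ _)) zero_le_two
  have h1 : u * (8 * D) ≤ x := by rwa [le_div_iff₀ (by positivity)] at hu2
  have h2 : 4 * u ^ 2 * (meanMajorant P Φ t - meanMajorant P Φ s) ≤ u * x / 2 := by
    calc 4 * u ^ 2 * (meanMajorant P Φ t - meanMajorant P Φ s) ≤ 4 * u ^ 2 * D := by gcongr
      _ = u * (u * (8 * D)) / 2 := by ring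
      _ ≤ u * x / 2 := by gcongr
  have h3 : min (x / 4) (x ^ 2 / (16 * D)) = u * x / 2 := by
    rw [hu, mul_div_assoc, min_mul_of_nonneg _ _ (by positivity)]
    congr 1
    · ring
    · field_simp
      ring
  rw [h3]
  linarith

/-- Two-level chaining over a unit partition: on the complement of a small event, the centred
process moves by at most `4x` from the left end point. Every `m`-th partition point is compared
with the left end point, every partition point with the preceding `m`-th one, and the
oscillation between neighbouring partition points is controlled by the majorizing process. -/
lemma exists_oscillation_event (hA : IsIndepEvents P A) (hΦ : IsMajorant P A M Φ) {B : ℝ} {j : ℕ}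
    {p : ℕ → ℝ≥0} (hp : IsUnitPartition (meanMajorant P Φ) B j p) (hj : 1 ≤ j) (hB : 1 < B)
    {m : ℕ} (hm : 1 ≤ m) {x : ℝ} (hx : 2 * B ≤ x) :
    ∃ E : Set Ω, P E ≤ ENNReal.ofReal (
        ((j / m : ℕ) + 1) * (2 * (Real.exp (-(x / 4)) +
          Real.exp (-(x ^ 2 / (16 * (meanMajorant P Φ (p j) - meanMajorant P Φ (p 0)))))))
        + (j + 1) * (2 * (Real.exp (-(x / 4)) + Real.exp (-(x ^ 2 / (16 * (B * m))))))
        + j * (2 * (Real.exp (4 * (M * B)) * Real.exp (-(x / (2 * M + 1)))))) ∧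
      ∀ ω, RegularPath A Φ ω → ω ∉ E → ∀ u ∈ Set.Icc (p 0) (p j),
        |centredCount P A u ω - centredCount P A (p 0) ω| ≤ 4 * x := by
  set f := meanMajorant P Φ with hf
  have hfm : Monotone f := meanMajorant_mono hA hΦ
  have hB0 : 0 < B := by linarith
  have hx0 : 0 ≤ x := by linarith
  have hj1 : (1 : ℝ) ≤ j := by exact_mod_cast hj
  have hD : 0 < f (p j) - f (p 0) := by
    have := hp.le_sub le_rfl
    linarith
  -- large increments over the coarse mesh, over the fine mesh, and of the majorizing process
  let E1 : Set Ω := ⋃ i ∈ Finset.range (j / m + 1),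
    {ω | x ≤ |centredCount P A (p (i * m)) ω - centredCount P A (p 0) ω|}
  let E2 : Set Ω := ⋃ k ∈ Finset.range (j + 1),
    {ω | x ≤ |centredCount P A (p k) ω - centredCount P A (p (k / m * m)) ω|}
  let E3 : Set Ω := ⋃ k ∈ Finset.range j,
    {ω | x ≤ |(majorantSum Φ (p (k + 1)) ω - majorantSum Φ (p k) ω) -
        (f (p (k + 1)) - f (p k))|}
  have union_bound : ∀ (n : ℕ) (G : ℕ → Set Ω) (y : ℝ), 0 ≤ y →
      (∀ k < n, P (G k) ≤ ENNReal.ofReal y) →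
      P (⋃ k ∈ Finset.range n, G k) ≤ ENNReal.ofReal (n * y) := by
    intro n G y hy hG
    refine (measure_biUnion_finset_le _ _).trans ?_
    refine (Finset.sum_le_sum fun k hk => hG k (Finset.mem_range.1 hk)).trans ?_
    rw [Finset.sum_const, Finset.card_range, nsmul_eq_mul, ENNReal.ofReal_mul (Nat.cast_nonneg _),
      ENNReal.ofReal_natCast]
  have hE1 : P E1 ≤ ENNReal.ofReal (((j / m + 1 : ℕ) : ℝ) * (2 * (Real.exp (-(x / 4)) +
      Real.exp (-(x ^ 2 / (16 * (f (p j) - f (p 0)))))))) := by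
    refine union_bound _ _ _ (by positivity) fun i hi => ?_
    have him : i * m ≤ j :=
      (Nat.mul_le_mul_right m (by omega)).trans (Nat.div_mul_le_self j m)
    refine centredCount_sub_tail_le hA hΦ (hp.mono (Nat.zero_le _) him) hx0 hD ?_
    have := hfm (hp.mono him le_rfl)
    linarith
  have hE2 : P E2 ≤ ENNReal.ofReal (((j + 1 : ℕ) : ℝ) * (2 * (Real.exp (-(x / 4)) +
      Real.exp (-(x ^ 2 / (16 * (B * m))))))) := by
    refine union_bound _ _ _ (by positivity) fun k hk => ?_
    have hkm := Nat.div_mul_le_self k m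
    have hmpos : (0 : ℝ) < m := by exact_mod_cast hm
    refine centredCount_sub_tail_le hA hΦ (hp.mono hkm (by omega)) hx0 (by positivity) ?_
    refine (hp.sub_le hkm (by omega)).trans ?_
    gcongr
    have h1 := Nat.div_add_mod k m
    have h2 := Nat.mod_lt k (show 0 < m by omega)
    have h3 : k / m * m = m * (k / m) := Nat.mul_comm _ _
    omega
  have hE3 : P E3 ≤ ENNReal.ofReal ((j : ℝ) * (2 * (Real.exp (4 * (M * B)) *
      Real.exp (-(x / (2 * M + 1)))))) := by
    refine union_bound _ _ _ (by positivity) fun k hk => ?_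
    have hM0 : (0 : ℝ) ≤ M := Nat.cast_nonneg M
    have hu1 : 1 / (2 * (M : ℝ) + 1) ≤ 1 := by
      rw [div_le_one (by positivity)]
      linarith
    refine (majorantSum_sub_tail_le hA hΦ (hp.lt k hk).le (u := 1 / (2 * M + 1))
      (by positivity) ?_ x).trans ?_
    · rw [div_mul_eq_mul_div, div_le_one (by positivity)]
      linarith
    · apply ENNReal.ofReal_le_ofReal
      rw [← Real.exp_add]
      refine mul_le_mul_of_nonneg_left (Real.exp_le_exp.2 ?_) zero_le_two
      have h1 : 4 * (1 / (2 * (M : ℝ) + 1)) ^ 2 * (M * (f (p (k + 1)) - f (p k))) ≤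
          4 * 1 * (M * B) := by
        have hpos : 0 ≤ f (p (k + 1)) - f (p k) := by
          have := hp.one_le k hk
          linarith
        gcongr
        · exact pow_le_one₀ (by positivity) hu1
        · exact hp.le k hk
      have h2 : -(1 / (2 * (M : ℝ) + 1)) * x = -(x / (2 * M + 1)) := by ring
      linarith
  refine ⟨E1 ∪ E2 ∪ E3, ?_, ?_⟩
  · refine (measure_union_le _ _).trans ((add_le_add ((measure_union_le _ _).trans
      (add_le_add hE1 hE2)) hE3).trans ?_)
    rw [← ENNReal.ofReal_add (by positivity) (by positivity),
      ← ENNReal.ofReal_add (by positivity) (by positivity)]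
    push_cast
    exact le_rfl
  · intro ω hω hE u hu
    obtain ⟨k, hkj, hk1, hk2⟩ := hp.exists_mem_Icc hj hu.1 hu.2
    simp only [E1, E2, E3, Set.mem_union, Set.mem_iUnion, Finset.mem_range, not_or,
      not_exists, Set.mem_ofPred_eq, not_le] at hE
    obtain ⟨⟨e1, e2⟩, e3⟩ := hE
    have h1 := e1 (k / m) (Nat.lt_succ_of_le (Nat.div_le_div_right hkj.le))
    have h2 := e2 k (by omega)
    have h3 := e3 k hkj
    have h4 := hω.abs_count_sub_le hk1
    have h5 := hω.majorantSum_mono hk2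
    have h6 := abs_meanCount_sub_le hA hΦ hk1
    have h7 := hfm hk2
    have h8 := hp.le k hkj
    have h9 : |centredCount P A u ω - centredCount P A (p k) ω| ≤ x + 2 * B := by
      have h10 := (abs_lt.1 h3).2
      rw [← hf] at h6
      have e : centredCount P A u ω - centredCount P A (p k) ω
          = (count A u ω - count A (p k) ω) - (meanCount P A u - meanCount P A (p k)) := by
        simp only [centredCount]
        ring
      rw [e]
      refine (abs_sub _ _).trans ?_
      linarith
    have e : centredCount P A u ω - centredCount P A (p 0) ω
        = (centredCount P A u ω - centredCount P A (p k) ω)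
          + (centredCount P A (p k) ω - centredCount P A (p (k / m * m)) ω)
          + (centredCount P A (p (k / m * m)) ω - centredCount P A (p 0) ω) := by ring
    rw [e]
    refine (abs_add_three _ _ _).trans ?_
    linarith

lemma summable_exp_rpow_sub {c η : ℝ} (hc : 0 < c) (hη : 0 < η) :
    Summable fun n : ℕ => Real.exp ((n : ℝ) ^ (c / 2) - η * (n : ℝ) ^ c) := by
  have h1 : ∀ᶠ x : ℝ in atTop, 2 / η ≤ x ^ (c / 2) :=
    (tendsto_rpow_atTop (by linarith)).eventually_ge_atTop _
  have h2 : Real.log =o[atTop] fun x : ℝ => x ^ c := isLittleO_log_rpow_atTop hc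
  have h3 := h1.and (h2.def (by positivity : 0 < η / 4))
  have h4 := (h3.and (eventually_ge_atTop 1)).natCast_atTop
  refine Summable.of_norm_bounded_eventually_nat (g := fun n : ℕ => ((n : ℝ) ^ 2)⁻¹)
    (Real.summable_nat_pow_inv.2 one_lt_two) ?_
  filter_upwards [h4] with n hn
  obtain ⟨⟨ha, hb⟩, hn1⟩ := hn
  have hn0 : (0 : ℝ) < n := by linarith
  have hl : 0 ≤ Real.log n := Real.log_nonneg hn1
  have hc2 : (n : ℝ) ^ c = (n : ℝ) ^ (c / 2) * (n : ℝ) ^ (c / 2) := by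
    rw [← Real.rpow_add hn0, add_halves]
  have ha' : (n : ℝ) ^ (c / 2) ≤ η / 2 * (n : ℝ) ^ c := by
    rw [div_le_iff₀ hη] at ha
    have := mul_le_mul_of_nonneg_right ha (by positivity : (0 : ℝ) ≤ (n : ℝ) ^ (c / 2))
    rw [hc2]
    linarith
  rw [Real.norm_eq_abs, Real.norm_eq_abs, abs_of_nonneg hl, abs_of_nonneg (by positivity)] at hb
  rw [Real.norm_eq_abs, abs_of_pos (Real.exp_pos _), ← Real.exp_log (by positivity :
    (0 : ℝ) < ((n : ℝ) ^ 2)⁻¹), Real.log_inv, Real.log_pow]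
  apply Real.exp_le_exp.2
  push_cast
  linarith

lemma summable_exp_sub_exp_rpow {c η : ℝ} (hc : 0 < c) (hη : 0 < η) :
    Summable fun n : ℕ => Real.exp (2 * n) * Real.exp (-(η * Real.exp ((n : ℝ) ^ c))) := by
  have h1 : Tendsto (fun x : ℝ => x ^ c) atTop atTop := tendsto_rpow_atTop hc
  have h2 : (fun x : ℝ => x ^ (1 / c)) =o[atTop] Real.exp :=
    isLittleO_rpow_exp_atTop (1 / c)
  have h3 := ((h2.comp_tendsto h1).def (by positivity : 0 < η / 3))
  have h4 := (h3.and (eventually_ge_atTop 1)).natCast_atTop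
  refine Summable.of_norm_bounded_eventually_nat (g := fun n : ℕ => Real.exp (-n))
    Real.summable_exp_neg_nat ?_
  filter_upwards [h4] with n hn
  obtain ⟨ha, hn1⟩ := hn
  have hn0 : (0 : ℝ) < n := by linarith
  simp only [Function.comp] at ha
  rw [← Real.rpow_mul hn0.le, mul_one_div_cancel hc.ne', Real.rpow_one, Real.norm_eq_abs,
    Real.norm_eq_abs, abs_of_pos hn0, abs_of_pos (Real.exp_pos _)] at ha
  rw [← Real.exp_add, Real.norm_eq_abs, abs_of_pos (Real.exp_pos _)]
  apply Real.exp_le_exp.2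
  linarith

end

end

section

variable {Ω : Type*} [MeasurableSpace Ω]

section

variable {P : Measure Ω} [IsProbabilityMeasure P] {A : ℕ → ℝ≥0 → Set Ω} {M : ℕ}
  {Φ : ℕ → ℝ≥0 → Ω → ℕ}

/-! ### Oscillation of the centred process between levels -/

/-- Over intervals `[t_n, t_{n+1}]` on which `f` grows by less than `n^{-c} α_n`, the centred
process oscillates by `o(√α_n)`. The two chaining levels are separated by a mesh of about
`j_n exp(-n^{c/2})` partition points: the coarse level then has only `exp(n^{c/2})` points, and
the fine increments have variances smaller than `α_n` by the factor `exp(-n^{c/2})`. -/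
theorem ae_oscillation_le (hA : IsIndepEvents P A) (hΦ : IsMajorant P A M Φ) {t : ℕ → ℝ≥0}
    {j : ℕ → ℕ} {B c δ : ℝ} {α : ℕ → ℝ} (hB : 1 < B)
    (hpart : ∀ᶠ n in atTop, 1 ≤ j n ∧ ∃ p : ℕ → ℝ≥0, p 0 = t n ∧ p (j n) = t (n + 1) ∧
      ∀ k < j n, p k < p (k + 1) ∧
        1 ≤ meanMajorant P Φ (p (k + 1)) - meanMajorant P Φ (p k) ∧
        meanMajorant P Φ (p (k + 1)) - meanMajorant P Φ (p k) ≤ B)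
    (hc : 0 < c)
    (hα : ∀ᶠ n : ℕ in atTop,
      (n : ℝ) ^ c * (meanMajorant P Φ (t (n + 1)) - meanMajorant P Φ (t n)) ≤ α n)
    (hgrow : ∀ᶠ n : ℕ in atTop,
      meanMajorant P Φ (t (n + 1)) - meanMajorant P Φ (t n) ≤ Real.exp (2 * n))
    (hsum : ∀ ε : ℝ, 0 < ε → Summable fun n => (j n : ℝ) * Real.exp (-ε * √(α n)))
    (hδ : 0 < δ) :
    ∀ᵐ ω ∂P, ∀ᶠ n in atTop, ∀ u ∈ Set.Icc (t n) (t (n + 1)),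
      |centredCount P A u ω - centredCount P A (t n) ω| ≤ δ * √(α n) := by
  set f := meanMajorant P Φ with hf
  set C := 2 * Real.exp (4 * (M * B)) with hC
  set ε₁ := δ / 16 with hε₁
  set ε₂ := δ ^ 2 / (512 * B) with hε₂
  set ε₃ := δ / (4 * (2 * M + 1)) with hε₃
  have hB0 : 0 < B := by linarith
  have hε₁0 : 0 < ε₁ := by positivity
  have hε₂0 : 0 < ε₂ := by positivity
  have hε₃0 : 0 < ε₃ := by positivity
  -- `g n` bounds the probability of the exceptional event of `exists_oscillation_event` at
  -- `x = (δ/4)√(α n)`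
  let g : ℕ → ℝ := fun n => 8 * ((j n : ℝ) * Real.exp (-ε₁ * √(α n)))
    + 4 * Real.exp ((n : ℝ) ^ (c / 2) - δ ^ 2 / 256 * (n : ℝ) ^ c)
    + 4 * ((j n : ℝ) * Real.exp (-ε₂ * √(α n)))
    + 4 * (Real.exp (2 * n) * Real.exp (-(ε₂ * Real.exp ((n : ℝ) ^ (c / 2)))))
    + C * ((j n : ℝ) * Real.exp (-ε₃ * √(α n)))
  have hg : Summable g :=
    (((((hsum ε₁ hε₁0).mul_left 8).add
      ((summable_exp_rpow_sub hc (by positivity)).mul_left 4)).add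
      ((hsum ε₂ hε₂0).mul_left 4)).add
      ((summable_exp_sub_exp_rpow (half_pos hc) hε₂0).mul_left 4)).add
      ((hsum ε₃ hε₃0).mul_left C)
  have hlarge : ∀ᶠ n : ℕ in atTop, 1 ≤ (n : ℝ) ^ c ∧ (8 * B / δ) ^ 2 ≤ (n : ℝ) ^ c := by
    have h1 : Tendsto (fun n : ℕ => (n : ℝ) ^ c) atTop atTop :=
      (tendsto_rpow_atTop hc).comp tendsto_natCast_atTop_atTop
    exact (h1.eventually_ge_atTop 1).and (h1.eventually_ge_atTop _)
  have hev : ∀ᶠ n in atTop, ∃ E : Set Ω, P E ≤ ENNReal.ofReal (g n) ∧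
      ∀ ω, RegularPath A Φ ω → ω ∉ E → ∀ u ∈ Set.Icc (t n) (t (n + 1)),
        |centredCount P A u ω - centredCount P A (t n) ω| ≤ δ * √(α n) := by
    filter_upwards [hpart, hα, hgrow, hlarge] with n hp hαn hgn hn
    obtain ⟨hj, p, hp0, hp1, hpk⟩ := hp
    have hP : IsUnitPartition f B (j n) p :=
      ⟨fun k hk => (hpk k hk).1, fun k hk => (hpk k hk).2.1, fun k hk => (hpk k hk).2.2⟩
    have hjD := hP.le_sub le_rfl
    rw [hp0, hp1] at hjD
    set D := f (t (n + 1)) - f (t n) with hD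
    have hj1 : (1 : ℝ) ≤ j n := by exact_mod_cast hj
    have hD1 : 1 ≤ D := hj1.trans hjD
    have hncα : (n : ℝ) ^ c ≤ α n := by
      refine le_trans ?_ hαn
      exact le_mul_of_one_le_right (by linarith [hn.1]) hD1
    have hDα : D ≤ α n := by
      refine le_trans ?_ hαn
      exact le_mul_of_one_le_left (by linarith) hn.1
    have hα1 : 1 ≤ α n := hD1.trans hDα
    have hα0 : 0 < α n := by linarith
    have hsq : √(α n) ^ 2 = α n := Real.sq_sqrt hα0.le
    have hs1 : 1 ≤ √(α n) := Real.one_le_sqrt.2 hα1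
    set h := (n : ℝ) ^ (c / 2) with hh
    set y := (j n : ℝ) * Real.exp (-h) with hy
    have hy0 : 0 ≤ y := by positivity
    -- the mesh is `1` if `j_n exp(-n^{c/2})` is small, and comparable with it otherwise
    set m := ⌊y⌋₊ + 1 with hm
    have hmy : y < m := by
      rw [hm]
      push_cast
      exact Nat.lt_floor_add_one y
    have hmy2 : (m : ℝ) ≤ y + 1 := by
      rw [hm]
      push_cast
      linarith [Nat.floor_le hy0]
    have hm0 : (0 : ℝ) < m := hy0.trans_lt hmy
    set x := δ / 4 * √(α n) with hx
    have hx2 : x ^ 2 = δ ^ 2 / 16 * α n := by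
      rw [hx, mul_pow, hsq]
      ring
    have hxB : 2 * B ≤ x := by
      have h1 : 8 * B / δ ≤ √(α n) := Real.le_sqrt_of_sq_le (hn.2.trans hncα)
      rw [div_le_iff₀ hδ] at h1
      rw [hx]
      linarith
    obtain ⟨E, hE, hE2⟩ := exists_oscillation_event hA hΦ hP hj hB (m := m) (by omega) hxB
    rw [hp0, hp1] at hE hE2
    refine ⟨E, hE.trans (ENNReal.ofReal_le_ofReal ?_), fun ω hω hωE u hu => ?_⟩
    · rw [← hf, ← hD]
      have hdivj : ((j n / m : ℕ) : ℝ) ≤ j n := by exact_mod_cast Nat.div_le_self _ _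
      have hdive : ((j n / m : ℕ) : ℝ) ≤ Real.exp h := by
        refine Nat.cast_div_le.trans ?_
        rw [div_le_iff₀ hm0]
        have : (j n : ℝ) = Real.exp h * y := by
          rw [hy, Real.exp_neg]
          field_simp
        rw [this]
        gcongr
      have hexp1 : 1 ≤ Real.exp h := Real.one_le_exp (by positivity)
      have e1 : Real.exp (-(x / 4)) = Real.exp (-ε₁ * √(α n)) := by
        congr 1
        rw [hx, hε₁]
        ring
      have e2 : Real.exp (-(x ^ 2 / (16 * D))) ≤ Real.exp (-(δ ^ 2 / 256 * (n : ℝ) ^ c)) := by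
        apply Real.exp_le_exp.2
        rw [neg_le_neg_iff, hx2, le_div_iff₀ (by positivity)]
        calc δ ^ 2 / 256 * (n : ℝ) ^ c * (16 * D) = δ ^ 2 / 16 * ((n : ℝ) ^ c * D) := by ring
          _ ≤ _ := by gcongr
      have e3 : Real.exp (-(x / (2 * M + 1))) = Real.exp (-ε₃ * √(α n)) := by
        congr 1
        rw [hx, hε₃]
        field_simp
      have e4 : (j n : ℝ) * Real.exp (-(x ^ 2 / (16 * (B * m)))) ≤
          (j n : ℝ) * Real.exp (-ε₂ * √(α n))
            + Real.exp (2 * n) * Real.exp (-(ε₂ * Real.exp h)) := by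
        have hr : x ^ 2 / (16 * (B * m)) = 2 * ε₂ * (α n / m) := by
          rw [hx2, hε₂]
          field_simp
          ring
        rw [hr]
        -- for `y ≤ 1` the fine increments have bounded variance, and the summability condition on
        -- the partitions applies; for `y ≥ 1` it is enough that `j_n ≤ exp(2n)`
        rcases le_total y 1 with hy1 | hy1
        · have hm2 : (m : ℝ) ≤ 2 := by linarith
          have h1 : √(α n) / 2 ≤ α n / m := by
            gcongr
            nlinarith
          have h2 : Real.exp (-(2 * ε₂ * (α n / m))) ≤ Real.exp (-ε₂ * √(α n)) := by
            apply Real.exp_le_exp.2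
            have := mul_le_mul_of_nonneg_left h1 (by positivity : 0 ≤ 2 * ε₂)
            linarith
          have h3 := mul_le_mul_of_nonneg_left h2 (Nat.cast_nonneg (j n) : (0 : ℝ) ≤ j n)
          have h4 : 0 ≤ Real.exp (2 * n) * Real.exp (-(ε₂ * Real.exp h)) := by positivity
          linarith
        · have hm2 : (m : ℝ) ≤ 2 * α n * Real.exp (-h) := by
            have : y ≤ α n * Real.exp (-h) := by
              rw [hy]
              gcongr
              exact hjD.trans hDα
            linarith
          have h1 : Real.exp h / 2 ≤ α n / m := by
            rw [le_div_iff₀ hm0]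
            calc Real.exp h / 2 * m ≤ Real.exp h / 2 * (2 * α n * Real.exp (-h)) := by gcongr
              _ = α n * (Real.exp h * Real.exp (-h)) := by ring
              _ = α n := by rw [← Real.exp_add, add_neg_cancel, Real.exp_zero, mul_one]
          have h2 : Real.exp (-(2 * ε₂ * (α n / m))) ≤ Real.exp (-(ε₂ * Real.exp h)) := by
            apply Real.exp_le_exp.2
            have := mul_le_mul_of_nonneg_left h1 (by positivity : 0 ≤ 2 * ε₂)
            linarith
          have h3 : (j n : ℝ) * Real.exp (-(2 * ε₂ * (α n / m))) ≤
              Real.exp (2 * n) * Real.exp (-(ε₂ * Real.exp h)) := by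
            gcongr
            exact hjD.trans hgn
          have h4 : 0 ≤ (j n : ℝ) * Real.exp (-ε₂ * √(α n)) := by positivity
          linarith
      have f1 : (((j n / m : ℕ) : ℝ) + 1) * (2 * (Real.exp (-(x / 4)) +
          Real.exp (-(x ^ 2 / (16 * D))))) ≤ 4 * ((j n : ℝ) * Real.exp (-ε₁ * √(α n)))
            + 4 * Real.exp (h - δ ^ 2 / 256 * (n : ℝ) ^ c) := by
        have a1 : (((j n / m : ℕ) : ℝ) + 1) * Real.exp (-(x / 4)) ≤
            (2 * j n) * Real.exp (-ε₁ * √(α n)) := by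
          rw [e1]
          gcongr
          linarith
        have a2 : (((j n / m : ℕ) : ℝ) + 1) * Real.exp (-(x ^ 2 / (16 * D))) ≤
            (2 * Real.exp h) * Real.exp (-(δ ^ 2 / 256 * (n : ℝ) ^ c)) := by
          gcongr
          linarith
        rw [sub_eq_add_neg, Real.exp_add]
        linarith
      have f2 : ((j n : ℝ) + 1) * (2 * (Real.exp (-(x / 4)) +
          Real.exp (-(x ^ 2 / (16 * (B * m)))))) ≤ 4 * ((j n : ℝ) * Real.exp (-ε₁ * √(α n)))
            + 4 * ((j n : ℝ) * Real.exp (-(x ^ 2 / (16 * (B * m))))) := by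
        rw [e1]
        have : (j n : ℝ) + 1 ≤ 2 * j n := by linarith
        calc _ ≤ (2 * (j n : ℝ)) * (2 * (Real.exp (-ε₁ * √(α n)) +
              Real.exp (-(x ^ 2 / (16 * (B * m)))))) := by gcongr
          _ = _ := by ring
      have f3 : (j n : ℝ) * (2 * (Real.exp (4 * (M * B)) * Real.exp (-(x / (2 * M + 1))))) =
          C * ((j n : ℝ) * Real.exp (-ε₃ * √(α n))) := by
        rw [e3, hC]
        ring
      simp only [g]
      linarith
    · refine (hE2 ω hω hωE u hu).trans (le_of_eq ?_)
      rw [hx]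
      ring
  -- a total choice of exceptional events, as they are available for large `n` only
  have hchoice : ∀ n, ∃ E : Set Ω, (∃ E : Set Ω, P E ≤ ENNReal.ofReal (g n) ∧
      ∀ ω, RegularPath A Φ ω → ω ∉ E → ∀ u ∈ Set.Icc (t n) (t (n + 1)),
        |centredCount P A u ω - centredCount P A (t n) ω| ≤ δ * √(α n)) →
      (P E ≤ ENNReal.ofReal (g n) ∧
      ∀ ω, RegularPath A Φ ω → ω ∉ E → ∀ u ∈ Set.Icc (t n) (t (n + 1)),
        |centredCount P A u ω - centredCount P A (t n) ω| ≤ δ * √(α n)) := by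
    intro n
    by_cases h : ∃ E : Set Ω, P E ≤ ENNReal.ofReal (g n) ∧
      ∀ ω, RegularPath A Φ ω → ω ∉ E → ∀ u ∈ Set.Icc (t n) (t (n + 1)),
        |centredCount P A u ω - centredCount P A (t n) ω| ≤ δ * √(α n)
    · exact ⟨h.choose, fun _ => h.choose_spec⟩
    · exact ⟨∅, fun h' => absurd h' h⟩
  choose E hE using hchoice
  have hBC := ae_eventually_notMem_of_summable (P := P) (E := E) hg
    (hev.mono fun n hn => (hE n hn).1)
  filter_upwards [hBC, ae_regularPath hA hΦ] with ω h1 h2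
  filter_upwards [h1, hev] with n h3 h4
  exact (hE n h4).2 ω h2 h3

end

end

section

/-! ### Upper bound for the normalized process -/

/-- The properties of `Ψ = (q + 1) log log` and of `Ψ = (μ - 1) log` that matter for the
normalization `(2 a Ψ(a))^{1/2}`. -/
structure IsNormalizer (Ψ : ℝ → ℝ) : Prop where
  tendsto_atTop : Tendsto Ψ atTop atTop
  tendsto_div : Tendsto (fun x => Ψ x / x) atTop (𝓝 0)
  mul_le : ∀ c ∈ Set.Ioo (0 : ℝ) 1, ∀ᶠ x in atTop, ∀ y, c * x ≤ y → c * Ψ x ≤ Ψ y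

lemma tendsto_sqrt_normalizer {Ψ : ℝ → ℝ} (hΨ : IsNormalizer Ψ) (r : ℝ) :
    Tendsto (fun x => r * √(2 * x * Ψ x) / x) atTop (𝓝 0) := by
  have h1 : Tendsto (fun x => r * √(2 * (Ψ x / x))) atTop (𝓝 (r * √(2 * 0))) :=
    ((Real.continuous_sqrt.tendsto _).comp (hΨ.tendsto_div.const_mul 2)).const_mul r
  simp only [mul_zero, Real.sqrt_zero] at h1
  refine h1.congr' ?_
  filter_upwards [eventually_gt_atTop 0] with x hx
  rw [mul_div_assoc]
  congr 1
  rw [eq_div_iff hx.ne', ← Real.sqrt_sq hx.le, ← Real.sqrt_mul', Real.sqrt_sq hx.le]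
  · congr 1
    field_simp
  · positivity

/-- The intervals `[t_n, t_{n+1}]`, `n ≥ N`, cover a neighbourhood of infinity. -/
lemma exists_mem_Icc_of_tendsto {t : ℕ → ℝ≥0} (ht : Tendsto t atTop atTop) (N : ℕ) {u : ℝ≥0}
    (hu : t N ≤ u) : ∃ n ≥ N, u ∈ Set.Icc (t n) (t (n + 1)) := by
  classical
  have hex : ∃ n, N ≤ n ∧ u < t (n + 1) := by
    have h1 := (tendsto_add_atTop_iff_nat 1).2 ht
    obtain ⟨n, hn1, hn2⟩ := ((eventually_ge_atTop N).and (h1.eventually_gt_atTop u)).exists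
    exact ⟨n, hn1, hn2⟩
  obtain ⟨h1, h2⟩ := Nat.find_spec hex
  refine ⟨Nat.find hex, h1, ?_, h2.le⟩
  rcases h1.eq_or_lt with h | h
  · rw [← h]; exact hu
  · have := Nat.find_min hex (m := Nat.find hex - 1) (by omega)
    rw [Nat.sub_add_cancel (by omega)] at this
    by_contra hlt
    exact this ⟨by omega, not_le.1 hlt⟩

/-- For `c < 1` and large `n`, the values of `a` on `[t_n, t_{n+1}]` are at least `c a(s_n)`. -/
lemma IsNearMinimizer.eventually_le {a : ℝ≥0 → ℝ} {t s : ℕ → ℝ≥0} (h : IsNearMinimizer a t s)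
    (ha : Tendsto a atTop atTop) (ht : Tendsto t atTop atTop) {c : ℝ} (hc : c ∈ Set.Ioo (0 : ℝ) 1) :
    ∀ᶠ n in atTop, ∀ u ∈ Set.Icc (t n) (t (n + 1)), c * a (s n) ≤ a u := by
  obtain ⟨a₀, haa, hs⟩ := h
  -- `(1 - ε)/(1 + ε) = c`
  set ε := (1 - c) / (1 + c) with hε
  have hc0 := hc.1
  have hc1 := hc.2
  have hε0 : 0 < ε := div_pos (by linarith) (by linarith)
  have hε1 : ε < 1 := by
    rw [hε, div_lt_one (by linarith)]
    linarith
  have hce : c * (1 + ε) = 1 - ε := by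
    rw [hε]
    field_simp
    ring
  have h1 := (haa.isLittleO.def hε0).and (ha.eventually_gt_atTop 0)
  obtain ⟨T, hT⟩ := eventually_atTop.1 h1
  have key : ∀ u ≥ T, 0 < a₀ u ∧ (1 - ε) * a₀ u ≤ a u ∧ a u ≤ (1 + ε) * a₀ u := by
    intro u hu
    obtain ⟨h2, h3⟩ := hT u hu
    simp only [Pi.sub_apply, Real.norm_eq_abs] at h2
    have h4 := abs_le.1 h2
    have h5 : 0 < a₀ u := by
      by_contra hneg
      push Not at hneg
      rw [abs_of_nonpos hneg] at h4
      nlinarith [h4.2]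
    rw [abs_of_pos h5] at h4
    exact ⟨h5, by linarith [h4.1], by linarith [h4.2]⟩
  filter_upwards [hs, ht.eventually_ge_atTop T] with n hn hTn u hu
  obtain ⟨h5, h6, -⟩ := key u (hTn.trans hu.1)
  obtain ⟨h7, -, h8⟩ := key (s n) (hTn.trans hn.1.1)
  have h9 := hn.2 u hu
  have h10 := mul_le_mul_of_nonneg_left h8 hc0.le
  have h11 := mul_le_mul_of_nonneg_left h9 (by linarith : 0 ≤ 1 - ε)
  have h12 : c * ((1 + ε) * a₀ (s n)) = (1 - ε) * a₀ (s n) := by rw [← mul_assoc, hce]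
  linarith

variable {Ω : Type*} [MeasurableSpace Ω]

section

variable {P : Measure Ω} [IsProbabilityMeasure P] {A : ℕ → ℝ≥0 → Set Ω} {M : ℕ}
  {Φ : ℕ → ℝ≥0 → Ω → ℕ}

lemma eventually_normalized_tail_le (hA : IsIndepEvents P A) {Ψ : ℝ → ℝ} (hΨ : IsNormalizer Ψ)
    {s : ℕ → ℝ≥0} (hs : Tendsto (fun n => varCount P A (s n)) atTop atTop) {δ : ℝ} (hδ : 0 < δ) :
    ∀ᶠ n in atTop, P {ω | (1 + δ) * √(2 * varCount P A (s n) * Ψ (varCount P A (s n))) ≤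
      |centredCount P A (s n) ω|} ≤
      ENNReal.ofReal (2 * Real.exp (-((1 + δ) * Ψ (varCount P A (s n))))) := by
  have h1 := ((tendsto_sqrt_normalizer hΨ (1 + δ)).comp hs).eventually_lt_const
    (show 0 < min (1 / 2) (δ / (12 * (1 + δ))) by positivity)
  filter_upwards [h1, hs.eventually_gt_atTop 0, (hΨ.tendsto_atTop.comp hs).eventually_gt_atTop 0]
    with n hn ha0 hΨ0
  simp only [Function.comp] at hn hΨ0
  set a := varCount P A (s n) with ha
  set x := (1 + δ) * √(2 * a * Ψ a) with hx
  have hx0 : 0 ≤ x := by positivity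
  have hu0 : 0 ≤ x / a := by positivity
  have hu1 := (hn.trans_le (min_le_left _ _)).le
  have hu2 := (hn.trans_le (min_le_right _ _)).le
  refine (count_tail_le hA (s n) hu0 (by linarith) x).trans ?_
  apply ENNReal.ofReal_le_ofReal
  refine mul_le_mul_of_nonneg_left (Real.exp_le_exp.2 ?_) zero_le_two
  rw [← ha]
  have hx2 : x ^ 2 = (1 + δ) ^ 2 * (2 * a * Ψ a) := by
    rw [hx, mul_pow, Real.sq_sqrt (by positivity)]
  have e : -(x / a) * x + (x / a) ^ 2 * a * (1 / 2 + 6 * (x / a))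
      = -(x ^ 2 / a) * (1 / 2 - 6 * (x / a)) := by
    field_simp
    ring
  have e2 : x ^ 2 / a = 2 * (1 + δ) ^ 2 * Ψ a := by
    rw [hx2]
    field_simp
  rw [e, e2]
  rw [le_div_iff₀ (by positivity)] at hu2
  nlinarith [mul_pos (by linarith : 0 < 1 + δ) hΨ0]

/-- If the intervals `[t_n, t_{n+1}]` are short compared with the variance, the variance on them
is nearly minimal at `s_n`, and `Ψ(a(s_n))` is at least `(1 - δ/4) log n`, then the limit superior
of the normalized process is at most `1 + 4δ`. -/
theorem ae_eventually_abs_le (hA : IsIndepEvents P A) (hΦ : IsMajorant P A M Φ) {Ψ : ℝ → ℝ}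
    (hΨ : IsNormalizer Ψ) (hvar : Tendsto (varCount P A) atTop atTop) {t s : ℕ → ℝ≥0}
    {c δ : ℝ} (hδ : 0 < δ) (hδ1 : δ ≤ 1)
    (hmin : IsNearMinimizer (varCount P A) t s)
    (hpart : HasPartitions (meanMajorant P Φ) (varCount P A) t s)
    (ht : Tendsto t atTop atTop) (hc : 0 < c)
    (hα : ∀ᶠ n : ℕ in atTop, (n : ℝ) ^ c *
      (meanMajorant P Φ (t (n + 1)) - meanMajorant P Φ (t n)) ≤ varCount P A (s n))
    (hgrow : ∀ᶠ n : ℕ in atTop,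
      meanMajorant P Φ (t (n + 1)) - meanMajorant P Φ (t n) ≤ Real.exp (2 * n))
    (hlog : ∀ᶠ n : ℕ in atTop, (1 - δ / 4) * Real.log n ≤ Ψ (varCount P A (s n))) :
    ∀ᵐ ω ∂P, ∀ᶠ u in atTop, |centredCount P A u ω| ≤
      (1 + 4 * δ) * √(2 * varCount P A u * Ψ (varCount P A u)) := by
  set a := varCount P A with ha
  obtain ⟨B, j, hB, hp, hj⟩ := hpart
  have hsI : ∀ᶠ n in atTop, s n ∈ Set.Icc (t n) (t (n + 1)) := by
    obtain ⟨a₀, -, h⟩ := hmin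
    exact h.mono fun n hn => hn.1
  have hst : Tendsto s atTop atTop :=
    tendsto_atTop_mono' _ (hsI.mono fun n hn => hn.1) ht
  have has : Tendsto (fun n => a (s n)) atTop atTop := hvar.comp hst
  have hosc := ae_oscillation_le (α := fun n => a (s n)) hA hΦ hB hp hc hα hgrow hj (half_pos hδ)
  have htail := eventually_normalized_tail_le hA hΨ has hδ
  have hsummable : Summable fun n : ℕ => 2 * ((n : ℝ) ^ (1 + δ / 2))⁻¹ :=
    (Real.summable_nat_rpow_inv.2 (by linarith)).mul_left 2
  have hBC := ae_eventually_notMem_of_summable (P := P) hsummable (E := fun n =>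
    {ω | (1 + δ) * √(2 * a (s n) * Ψ (a (s n))) ≤ |centredCount P A (s n) ω|}) (by
      filter_upwards [htail, hlog, eventually_ge_atTop 1] with n h1 h2 hn
      refine h1.trans (ENNReal.ofReal_le_ofReal ?_)
      refine mul_le_mul_of_nonneg_left ?_ zero_le_two
      have hn0 : (0 : ℝ) < n := by exact_mod_cast hn
      have hl : 0 ≤ Real.log n := Real.log_nonneg (by exact_mod_cast hn)
      rw [← Real.rpow_neg hn0.le, Real.rpow_def_of_pos hn0]
      apply Real.exp_le_exp.2
      have h3 := mul_le_mul_of_nonneg_left h2 (by linarith : 0 ≤ 1 + δ)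
      have h4 : (1 + δ / 2) * Real.log n ≤ (1 + δ) * ((1 - δ / 4) * Real.log n) := by
        rw [← mul_assoc]
        gcongr
        nlinarith
      linarith)
  -- the oscillation turns `1 + δ` into `1 + 2δ`; replacing `a(s_n)` by `a(u)` turns this into
  -- `1 + 4δ`
  set r := (1 + 2 * δ) / (1 + 4 * δ) with hr
  have hr0 : 0 < r := by positivity
  have hr1 : r < 1 := by
    rw [hr, div_lt_one (by positivity)]
    linarith
  have hr4 : (1 + 4 * δ) * r = 1 + 2 * δ := by
    rw [hr]
    field_simp
  have hnear := hmin.eventually_le hvar ht ⟨hr0, hr1⟩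
  filter_upwards [hosc, hBC] with ω h1 h2
  have hall := (((h1.and h2).and (hnear.and hsI)).and
    ((has.eventually (hΨ.mul_le r ⟨hr0, hr1⟩)).and (has.eventually_gt_atTop 0))).and
    ((hΨ.tendsto_atTop.comp has).eventually_ge_atTop 1)
  obtain ⟨N, hN⟩ := eventually_atTop.1 hall
  refine eventually_atTop.2 ⟨t N, fun u hu => ?_⟩
  obtain ⟨n, hnN, hun⟩ := exists_mem_Icc_of_tendsto ht N hu
  obtain ⟨⟨⟨⟨g1, g2⟩, g3, g4⟩, g5, g6⟩, g7⟩ := hN n hnN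
  simp only [Function.comp] at g7
  have k1 := g1 u hun
  have k2 := g1 (s n) g4
  have k3 := not_le.1 g2
  have k4 := g3 u hun
  have k5 := g5 _ k4
  set α := a (s n) with hαdef
  have k6 : √α ≤ √(2 * α * Ψ α) := by
    apply Real.sqrt_le_sqrt
    nlinarith
  have k7 : |centredCount P A u ω| ≤ (1 + 2 * δ) * √(2 * α * Ψ α) := by
    have e : centredCount P A u ω = (centredCount P A u ω - centredCount P A (t n) ω)
        - (centredCount P A (s n) ω - centredCount P A (t n) ω) + centredCount P A (s n) ω := by
      ring
    rw [e]
    refine (abs_add_le _ _).trans ?_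
    have := abs_sub (centredCount P A u ω - centredCount P A (t n) ω)
      (centredCount P A (s n) ω - centredCount P A (t n) ω)
    have k8 := mul_le_mul_of_nonneg_left k6 hδ.le
    linarith
  refine k7.trans ?_
  rw [← hr4, mul_assoc]
  refine mul_le_mul_of_nonneg_left ?_ (by positivity)
  rw [← Real.sqrt_sq hr0.le, ← Real.sqrt_mul (sq_nonneg r)]
  apply Real.sqrt_le_sqrt
  have k9 : r * α * (r * Ψ α) ≤ a u * Ψ (a u) := by
    apply mul_le_mul k4 k5 (by positivity)
    exact le_trans (by positivity) k4
  linarith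

end

end

section

variable {Ω : Type*} [MeasurableSpace Ω]

/-! ### Lower bound for the normalized process -/

section

variable {P : Measure Ω} [IsProbabilityMeasure P] {A : ℕ → ℝ≥0 → Set Ω}

/-- A finite set of indices in `R` that carries all but `η` of the variance carried by `R`. -/
lemma exists_finset_variance (hA : IsIndepEvents P A) (R : Set ℕ) (t : ℝ≥0) {η : ℝ} (hη : 0 < η) :
    ∃ F : Finset ℕ, (F : Set ℕ) ⊆ R ∧
      variance (countOn A R t) P - η ≤ ∑ k ∈ F, variance (occ A k t) P := by
  classical
  have h := hasSum_variance_countOn hA R t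
  obtain ⟨s, hs⟩ := (h.eventually (lt_mem_nhds (sub_lt_self _ hη))).exists
  refine ⟨s.filter (· ∈ R), fun k hk => (Finset.mem_filter.1 hk).2, hs.le.trans (le_of_eq ?_)⟩
  rw [Finset.sum_filter]
  exact Finset.sum_congr rfl fun k _ => rfl

lemma variance_countOn_compl (hA : IsIndepEvents P A) (F : Finset ℕ) (t : ℝ≥0) :
    variance (countOn A (F : Set ℕ)ᶜ t) P =
      varCount P A t - ∑ k ∈ F, variance (occ A k t) P := by
  have h1 := hasSum_variance_countOn hA (F : Set ℕ)ᶜ t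
  have h2 := hasSum_varCount hA t
  have h3 := h2.summable.sum_add_tsum_subtype_compl F
  rw [h2.tsum_eq] at h3
  rw [← h1.tsum_eq, ← h3, ← tsum_subtype, add_sub_cancel_left]
  rfl

/-- The centred process is the sum of the contributions of `F` and of its complement. -/
lemma centredCount_eq_add (hA : IsIndepEvents P A) (F : Finset ℕ) (t : ℝ≥0) {ω : Ω}
    (hω : Summable fun k => occ A k t ω) :
    centredCount P A t ω = ∑ k ∈ F, (occ A k t ω - ∫ ω', occ A k t ω' ∂P) +
      (countOn A (F : Set ℕ)ᶜ t ω - ∑' k, ∫ ω', occOn A (F : Set ℕ)ᶜ k t ω' ∂P) := by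
  have h1 := hω.sum_add_tsum_subtype_compl F
  have h2 := (hasSum_meanCount hA t).summable.sum_add_tsum_subtype_compl F
  rw [(hasSum_meanCount hA t).tsum_eq] at h2
  have h3 : ∑' k, ∫ ω', occOn A (F : Set ℕ)ᶜ k t ω' ∂P
      = ∑' k : ↥((F : Set ℕ)ᶜ), P.real (A k t) := by
    rw [tsum_subtype ((F : Set ℕ)ᶜ) fun k => P.real (A k t)]
    refine tsum_congr fun k => ?_
    by_cases hk : k ∈ (F : Set ℕ)ᶜ
    · rw [occOn_of_mem hk, integral_occ hA, Set.indicator_of_mem hk]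
    · rw [occOn_of_notMem hk, Set.indicator_of_notMem hk]
      simp
  have h4 : count A t ω = ∑' k, occ A k t ω := count_eq t ω
  have h5 : countOn A (F : Set ℕ)ᶜ t ω = ∑' k : ↥((F : Set ℕ)ᶜ), occ A k t ω := rfl
  simp only [integral_occ hA, Finset.sum_sub_distrib]
  rw [centredCount, h3, h5, h4, ← h1, ← h2]
  have h6 : ∀ g : ℕ → ℝ, ∑' k : ↥((F : Set ℕ)ᶜ), g k = ∑' k : {k // k ∉ F}, g k :=
    fun g => rfl
  rw [h6 fun k => occ A k t ω, h6 fun k => P.real (A k t)]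
  ring

/-- Kolmogorov's lower bound for the contribution of a finite set `F` of indices to the centred
process (`e = 1`) or its negative (`e = -1`). -/
lemma le_block_tail (hA : IsIndepEvents P A) (F : Finset ℕ) (t : ℝ≥0) {e : ℝ} (he : |e| = 1)
    {δ u : ℝ} (hδ0 : 0 < δ) (hδ1 : δ < 1) (hu0 : 0 < u) (hu : u ≤ δ ^ 2 / 256)
    (hlarge : 8 ≤ u ^ 2 * (∑ k ∈ F, variance (occ A k t) P) * δ ^ 2) :
    1 / 2 * Real.exp (-(u ^ 2 * (∑ k ∈ F, variance (occ A k t) P) * (1 / 2 + 2 * δ))) ≤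
      P.real {ω | (1 - δ) * u * (∑ k ∈ F, variance (occ A k t) P) ≤
        ∑ k ∈ F, e * (occ A k t ω - ∫ ω', occ A k t ω' ∂P)} := by
  have he2 : e ^ 2 = 1 := by rw [← sq_abs, he]; norm_num
  refine le_tail (Y := fun k ω => e * (occ A k t ω - ∫ ω', occ A k t ω' ∂P)) ?_ ?_ ?_ ?_ F ?_
    hδ0 hδ1 hu0 hu hlarge
  · exact (iIndepFun_occ hA).comp
      (fun k (x : ℝ≥0 → ℝ) => e * (x t - ∫ ω', occ A k t ω' ∂P))
      fun k => by fun_prop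
  · exact fun k => ((measurable_occ hA k t).sub_const _).const_mul e
  · refine fun k => ae_of_all _ fun ω => ?_
    rw [abs_mul, he, one_mul, integral_occ hA]
    have h1 := occ_nonneg (A := A) k t ω
    have h2 := occ_le_one (A := A) k t ω
    have h3 : 0 ≤ P.real (A k t) := measureReal_nonneg
    have h4 : P.real (A k t) ≤ 1 := measureReal_le_one
    rw [abs_le]
    constructor <;> linarith
  · intro k
    rw [integral_const_mul, integral_sub (integrable_occ hA k t) (integrable_const _)]
    simp
  · refine Finset.sum_congr rfl fun k _ => ?_
    rw [variance_eq_integral (measurable_occ hA k t).aemeasurable]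
    congr with ω
    rw [mul_pow, he2, one_mul]

/-- The indices outside blocks carrying all but the share `2ς` of the variance contribute less
than `δ` to the normalized process. -/
lemma ae_eventually_compl_lt (hA : IsIndepEvents P A) {Ψ : ℝ → ℝ} (hΨ : IsNormalizer Ψ)
    {τ : ℕ → ℝ≥0} (hτ : Tendsto (fun n => varCount P A (τ n)) atTop atTop) {F : ℕ → Finset ℕ}
    {δ ς : ℝ} (hδ : 0 < δ) (hς : 0 < ς) (hςδ : ς ≤ δ ^ 2 / 16)
    (hshare : ∀ᶠ n in atTop, (1 - 2 * ς) * varCount P A (τ n) ≤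
      ∑ k ∈ F n, variance (occ A k (τ n)) P)
    (hlow : ∀ᶠ n : ℕ in atTop, 1 / 2 * Real.log n ≤ Ψ (varCount P A (τ n))) :
    ∀ᵐ ω ∂P, ∀ᶠ n in atTop,
      |countOn A (F n : Set ℕ)ᶜ (τ n) ω -
        ∑' k, ∫ ω', occOn A (F n : Set ℕ)ᶜ k (τ n) ω' ∂P| <
      δ * √(2 * varCount P A (τ n) * Ψ (varCount P A (τ n))) := by
  set a : ℕ → ℝ := fun n => varCount P A (τ n) with ha
  set V : ℕ → ℝ := fun n => ∑ k ∈ F n, variance (occ A k (τ n)) P with hV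
  have hVle : ∀ n, V n ≤ a n := fun n =>
    sum_le_hasSum _ (fun k _ => variance_nonneg _ _) (hasSum_varCount hA (τ n))
  have hapos : ∀ᶠ n in atTop, 0 < a n := hτ.eventually_gt_atTop 0
  have hΨlarge : ∀ K : ℝ, ∀ᶠ n in atTop, K ≤ Ψ (a n) := fun K =>
    (hΨ.tendsto_atTop.comp hτ).eventually_ge_atTop K
  have hsmall : ∀ r η : ℝ, 0 < η → ∀ᶠ n in atTop, r * √(2 * a n * Ψ (a n)) / a n ≤ η :=
    fun r η hη => (((tendsto_sqrt_normalizer hΨ r).comp hτ).eventually_lt_const hη).mono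
      fun n hn => hn.le
  have hrest : ∀ᵐ ω ∂P, ∀ᶠ n in atTop, ω ∉ {ω | δ * √(2 * a n * Ψ (a n)) ≤
      |countOn A (F n : Set ℕ)ᶜ (τ n) ω -
        ∑' k, ∫ ω', occOn A (F n : Set ℕ)ᶜ k (τ n) ω' ∂P|} := by
    refine ae_eventually_notMem_of_summable (g := fun n : ℕ => 2 * ((n : ℝ) ^ 2)⁻¹)
      ((Real.summable_nat_pow_inv.2 one_lt_two).mul_left 2) ?_
    filter_upwards [hapos, hshare, hΨlarge 0, hlow, eventually_ge_atTop 1,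
      hsmall (δ / (4 * ς)) (1 / 12) (by norm_num)] with n h1 h2 h3 h4 h5 h6
    set x := δ * √(2 * a n * Ψ (a n)) with hx
    have hx0 : 0 ≤ x := by positivity
    have hx2 : x ^ 2 = δ ^ 2 * (2 * a n * Ψ (a n)) := by
      rw [hx, mul_pow, Real.sq_sqrt (by positivity)]
    -- the minimizer of `-ux + 2ςau²`, where `2ςa` bounds the variance outside the block
    set u := x / (4 * ς * a n) with hu
    have hu0 : 0 ≤ u := by positivity
    have hu1 : u ≤ 1 / 12 := by
      refine le_of_eq_of_le ?_ h6
      rw [hu, hx]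
      field_simp
    refine (countOn_tail_le hA _ (τ n) hu0 (by linarith) x).trans ?_
    apply ENNReal.ofReal_le_ofReal
    refine mul_le_mul_of_nonneg_left ?_ zero_le_two
    rw [variance_countOn_compl hA]
    have hn0 : (0 : ℝ) < n := by exact_mod_cast h5
    rw [← Real.exp_log (by positivity : (0 : ℝ) < ((n : ℝ) ^ 2)⁻¹), Real.log_inv, Real.log_pow]
    apply Real.exp_le_exp.2
    have k1 : u ^ 2 * (a n - V n) * (1 / 2 + 6 * u) ≤ u ^ 2 * (2 * ς * a n) * 1 := by
      have : 0 ≤ a n - V n := by linarith [hVle n]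
      gcongr
      · linarith
      · linarith
    have k2 : -u * x + u ^ 2 * (2 * ς * a n) * 1 = -(x ^ 2 / (8 * ς * a n)) := by
      rw [hu]
      field_simp
      ring
    have k3 : 4 * Ψ (a n) ≤ x ^ 2 / (8 * ς * a n) := by
      rw [le_div_iff₀ (by positivity), hx2]
      have := mul_le_mul_of_nonneg_right hςδ (by positivity : 0 ≤ 32 * a n * Ψ (a n))
      linarith
    push_cast
    have k4 : u ^ 2 * (varCount P A (τ n) - ∑ k ∈ F n, variance (occ A k (τ n)) P) *
        (1 / 2 + 6 * u) = u ^ 2 * (a n - V n) * (1 / 2 + 6 * u) := rfl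
    have h4' : 1 / 2 * Real.log n ≤ Ψ (a n) := h4
    rw [k4]
    linarith
  filter_upwards [hrest] with ω h
  exact h.mono fun n hn => not_le.1 hn

/-- The choice of parameters for Kolmogorov's lower bound: for a block of variance `V` close to `a`
and a level `x = (1 - δ)(2aψ)^{1/2}`, the exponent is at most any `L ≥ ψ/(1 + δ/8)`. -/
lemma block_parameters {δ δ' ς a V ψ x u L : ℝ} (hδ : 0 < δ) (hδ1 : δ < 1) (hδ' : δ' = δ / 16)
    (hςδ : ς ≤ δ / 16) (ha : 0 < a) (hV : (1 - 2 * ς) * a ≤ V) (hVa : V ≤ a)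
    (hψ : 0 < ψ) (hx2 : x ^ 2 = (1 - δ) ^ 2 * (2 * a * ψ)) (hu : u = x / ((1 - δ') * V))
    (hL : 0 ≤ L) (hψL : ψ ≤ (1 + δ / 8) * L) (hlarge : 8 / (δ' ^ 2 * (1 - δ) ^ 2) ≤ ψ) :
    8 ≤ u ^ 2 * V * δ' ^ 2 ∧ u ^ 2 * V * (1 / 2 + 2 * δ') ≤ L := by
  have d0 : 0 < δ' := by linarith
  have d1 : 0 < 1 - δ' := by linarith
  have d2 : 0 < 1 - 2 * ς := by linarith
  have d3 : 0 < 1 - δ := by linarith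
  have hV0 : 0 < V := (mul_pos d2 ha).trans_le hV
  have hu2 : u ^ 2 * V = x ^ 2 / ((1 - δ') ^ 2 * V) := by
    rw [hu]
    field_simp
  constructor
  · rw [hu2, hx2, div_mul_eq_mul_div, le_div_iff₀ (by positivity)]
    rw [div_le_iff₀ (by positivity)] at hlarge
    have e1 : (1 - δ') ^ 2 * V ≤ 1 * a :=
      mul_le_mul (pow_le_one₀ d1.le (by linarith)) hVa hV0.le zero_le_one
    have e2 := mul_le_mul_of_nonneg_right hlarge ha.le
    have e3 : 0 ≤ ψ * (δ' ^ 2 * (1 - δ) ^ 2) * a := by positivity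
    linarith
  · have q1 : u ^ 2 * V ≤ (1 - δ) ^ 2 * 2 * ψ / ((1 - δ') ^ 2 * (1 - 2 * ς)) := by
      rw [hu2, hx2, div_le_div_iff₀ (by positivity) (by positivity)]
      have := mul_le_mul_of_nonneg_left hV
        (by positivity : 0 ≤ (1 - δ) ^ 2 * 2 * ψ * (1 - δ') ^ 2)
      linarith
    have q2 : (1 - δ) ^ 2 * (1 + δ / 8) * (1 + 4 * δ') ≤ (1 - δ') ^ 2 * (1 - 2 * ς) := by
      have r1 : (1 - δ) * ((1 + δ / 8) * (1 + 4 * δ')) ≤ 1 := by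
        rw [hδ']
        nlinarith [mul_pos hδ hδ, mul_pos hδ (mul_pos hδ hδ)]
      have r2 : 1 - δ ≤ (1 - δ') ^ 2 * (1 - 2 * ς) := by
        have r3 : 1 - 2 * δ' ≤ (1 - δ') ^ 2 := by nlinarith [sq_nonneg δ']
        have r4 : 1 - δ / 8 ≤ 1 - 2 * ς := by linarith
        have r5 : 1 - δ ≤ (1 - 2 * δ') * (1 - δ / 8) := by
          rw [hδ']
          nlinarith
        exact r5.trans (mul_le_mul r3 r4 (by linarith) (sq_nonneg _))
      have r5 := mul_le_mul_of_nonneg_left r1 d3.le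
      calc (1 - δ) ^ 2 * (1 + δ / 8) * (1 + 4 * δ')
          = (1 - δ) * ((1 - δ) * ((1 + δ / 8) * (1 + 4 * δ'))) := by ring
        _ ≤ _ := by linarith
    have q3 : (1 - δ) ^ 2 * 2 * ψ ≤ (1 - δ) ^ 2 * 2 * ((1 + δ / 8) * L) :=
      mul_le_mul_of_nonneg_left hψL (by positivity)
    have q7 : 0 < (1 - δ') ^ 2 * (1 - 2 * ς) := by positivity
    have q4 : u ^ 2 * V * ((1 - δ') ^ 2 * (1 - 2 * ς)) ≤ (1 - δ) ^ 2 * 2 * ψ := by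
      rwa [le_div_iff₀ q7] at q1
    have q5 := mul_le_mul_of_nonneg_right (q4.trans q3) (by positivity : 0 ≤ 1 / 2 + 2 * δ')
    have q6 := mul_le_mul_of_nonneg_right q2 hL
    refine le_of_mul_le_mul_left ?_ q7
    linarith

/-- A block carrying the share `1 - 2ς` of the variance exceeds `(1 - δ)(2aΨ(a))^{1/2}` with
probability at least `1/(2n)`. -/
lemma eventually_inv_le_block (hA : IsIndepEvents P A) {Ψ : ℝ → ℝ} (hΨ : IsNormalizer Ψ)
    {τ : ℕ → ℝ≥0} (hτ : Tendsto (fun n => varCount P A (τ n)) atTop atTop) {F : ℕ → Finset ℕ}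
    {δ ς : ℝ} (hδ : 0 < δ) (hδ1 : δ < 1) (hςδ : ς ≤ δ / 16)
    (hshare : ∀ᶠ n in atTop, (1 - 2 * ς) * varCount P A (τ n) ≤
      ∑ k ∈ F n, variance (occ A k (τ n)) P)
    (hup : ∀ᶠ n : ℕ in atTop, Ψ (varCount P A (τ n)) ≤ (1 + δ / 8) * Real.log n)
    {e : ℝ} (he : |e| = 1) :
    ∀ᶠ n : ℕ in atTop, 1 / 2 * ((n : ℝ))⁻¹ ≤
      P.real {ω | (1 - δ) * √(2 * varCount P A (τ n) * Ψ (varCount P A (τ n))) ≤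
        ∑ k ∈ F n, e * (occ A k (τ n) ω - ∫ ω', occ A k (τ n) ω' ∂P)} := by
  set a : ℕ → ℝ := fun n => varCount P A (τ n) with ha
  set V : ℕ → ℝ := fun n => ∑ k ∈ F n, variance (occ A k (τ n)) P with hV
  have hVle : ∀ n, V n ≤ a n := fun n =>
    sum_le_hasSum _ (fun k _ => variance_nonneg _ _) (hasSum_varCount hA (τ n))
  have hapos : ∀ᶠ n in atTop, 0 < a n := hτ.eventually_gt_atTop 0
  have hΨlarge : ∀ K : ℝ, ∀ᶠ n in atTop, K ≤ Ψ (a n) := fun K =>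
    (hΨ.tendsto_atTop.comp hτ).eventually_ge_atTop K
  have hsmall : ∀ r η : ℝ, 0 < η → ∀ᶠ n in atTop, r * √(2 * a n * Ψ (a n)) / a n ≤ η :=
    fun r η hη => (((tendsto_sqrt_normalizer hΨ r).comp hτ).eventually_lt_const hη).mono
      fun n hn => hn.le
  set δ' := δ / 16 with hδ'
  have d0 : 0 < δ' := by positivity
  filter_upwards [hapos, hshare, hΨlarge 1, hΨlarge (8 / (δ' ^ 2 * (1 - δ) ^ 2)), hup,
    eventually_ge_atTop 1,
    hsmall ((1 - δ) / ((1 - δ') * (1 - 2 * ς))) (δ' ^ 2 / 256) (by positivity)]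
    with n h1 h2 h3 h4 h5 h6 h7
  have d1 : 0 < 1 - δ' := by linarith
  have d2 : 0 < 1 - 2 * ς := by linarith
  have d3 : 0 < 1 - δ := by linarith
  have hV0 : 0 < V n := lt_of_lt_of_le (by positivity) h2
  set x := (1 - δ) * √(2 * a n * Ψ (a n)) with hx
  have hΨ0 : 0 < Ψ (a n) := by linarith
  have hx0 : 0 < x := by positivity
  have hx2 : x ^ 2 = (1 - δ) ^ 2 * (2 * a n * Ψ (a n)) := by
    rw [hx, mul_pow, Real.sq_sqrt (by positivity)]
  -- chosen so that Kolmogorov's threshold `(1 - δ')uV` is `x`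
  set u := x / ((1 - δ') * V n) with hu
  have hu0 : 0 < u := div_pos hx0 (mul_pos d1 hV0)
  have hux : (1 - δ') * u * V n = x := by
    rw [hu]
    field_simp
  have hu1 : u ≤ δ' ^ 2 / 256 := by
    refine le_trans ?_ h7
    calc u ≤ x / ((1 - δ') * ((1 - 2 * ς) * a n)) := by
          rw [hu]
          gcongr
      _ = _ := by
          rw [hx]
          field_simp
  have hn0 : (0 : ℝ) < n := by exact_mod_cast h6
  obtain ⟨hl, hexp⟩ := block_parameters hδ hδ1 hδ' hςδ h1 h2 (hVle n) hΨ0 hx2 hu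
    (Real.log_nonneg (by exact_mod_cast h6)) h5 h4
  have hmain := le_block_tail hA (F n) (τ n) he (δ := δ') d0 (by linarith) hu0 hu1 hl
  have hux' : (1 - δ') * u * (∑ k ∈ F n, variance (occ A k (τ n)) P) = x := hux
  rw [hux'] at hmain
  refine le_trans (mul_le_mul_of_nonneg_left ?_ (by norm_num)) hmain
  rw [← Real.exp_log (inv_pos.2 hn0), Real.log_inv]
  exact Real.exp_le_exp.2 (neg_le_neg hexp)

/-- Threshold events of sums over disjoint finite blocks occur infinitely often if their
probabilities are at least of order `1/n`. -/
lemma ae_frequently_block (hA : IsIndepEvents P A) {τ : ℕ → ℝ≥0} {F : ℕ → Finset ℕ}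
    {R : ℝ≥0 → Set ℕ} (hFR : ∀ n, (F n : Set ℕ) ⊆ R (τ n)) (hdisj : EventuallyDisjoint R τ)
    {e : ℝ} {x : ℕ → ℝ}
    (hprob : ∀ᶠ n : ℕ in atTop, 1 / 2 * ((n : ℝ))⁻¹ ≤ P.real {ω | x n ≤
      ∑ k ∈ F n, e * (occ A k (τ n) ω - ∫ ω', occ A k (τ n) ω' ∂P)}) :
    ∀ᵐ ω ∂P, ∃ᶠ n in atTop, x n ≤
      ∑ k ∈ F n, e * (occ A k (τ n) ω - ∫ ω', occ A k (τ n) ω' ∂P) := by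
  let E : ℕ → Set Ω := fun n => {ω | x n ≤
    ∑ k ∈ F n, e * (occ A k (τ n) ω - ∫ ω', occ A k (τ n) ω' ∂P)}
  obtain ⟨n₀, hn₀⟩ := hdisj
  obtain ⟨n₁, hn₁⟩ := eventually_atTop.1 hprob
  set N := max n₀ n₁ with hN
  have hcomap : ∀ n, ∀ k ∈ F n, Measurable[⨆ k ∈ (F n : Set ℕ), MeasurableSpace.comap
      (fun ω (t : ℝ≥0) => occ A k t ω) inferInstance] (occ A k (τ n)) := by
    intro n k hk
    have h1 : Measurable[MeasurableSpace.comap (fun ω (t : ℝ≥0) => occ A k t ω) inferInstance]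
        (occ A k (τ n)) :=
      (measurable_pi_apply (τ n)).comp
        (comap_measurable fun ω (t : ℝ≥0) => occ A k t ω)
    exact h1.mono (le_biSup (fun k => MeasurableSpace.comap (fun ω (t : ℝ≥0) => occ A k t ω)
      inferInstance) hk) le_rfl
  have hmeas : ∀ n, MeasurableSet[⨆ k ∈ (F n : Set ℕ), MeasurableSpace.comap
      (fun ω (t : ℝ≥0) => occ A k t ω) inferInstance] (E n) := by
    intro n
    refine measurableSet_le measurable_const ?_
    exact Finset.measurable_sum _ fun k hk => ((hcomap n k hk).sub_const _).const_mul e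
  have hle : ∀ n, (⨆ k ∈ (F n : Set ℕ), MeasurableSpace.comap
      (fun ω (t : ℝ≥0) => occ A k t ω) inferInstance) ≤ (inferInstance : MeasurableSpace Ω) :=
    fun n => iSup₂_le fun k _ => (measurable_occ_path hA k).comap_le
  have hind : iIndepSet (fun n => E (n + N)) P := by
    refine iIndepSet_of_disjoint_blocks (iIndepFun_occ hA) (measurable_occ_path hA)
      (fun n => (F (n + N) : Set ℕ)) ?_ _ fun n => hmeas (n + N)
    intro i j hij
    refine Set.disjoint_of_subset (hFR _) (hFR _) (hn₀ ?_ ?_ (by omega))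
    · exact Set.mem_Ici.2 (by omega)
    · exact Set.mem_Ici.2 (by omega)
  have hinf : ∑' n, P (E (n + N)) = ∞ := by
    by_contra hne
    have h1 := ENNReal.summable_toReal hne
    have h2 : Summable fun n : ℕ => 1 / 2 * (((n + N : ℕ) : ℝ))⁻¹ :=
      h1.of_nonneg_of_le (fun n => by positivity) fun n => hn₁ (n + N) (by omega)
    have h3 : Summable fun n : ℕ => (((n + N : ℕ) : ℝ))⁻¹ :=
      (h2.mul_left 2).congr fun n => by ring
    exact Real.not_summable_natCast_inv
      ((summable_nat_add_iff (f := fun n : ℕ => ((n : ℝ))⁻¹) N).1 h3)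
  have hone := measure_limsup_eq_one (fun n => hle _ _ (hmeas (n + N))) hind hinf
  have hlm : MeasurableSet (limsup (fun n => E (n + N)) atTop) :=
    MeasurableSet.measurableSet_limsup fun n => hle _ _ (hmeas (n + N))
  have hae : ∀ᵐ ω ∂P, ω ∈ limsup (fun n => E (n + N)) atTop :=
    (mem_ae_iff_prob_eq_one hlm).2 hone
  filter_upwards [hae] with ω hω
  rw [mem_limsup_iff_frequently_mem] at hω
  exact (tendsto_add_atTop_nat N).frequently hω

/-- Along times `τ_n` with disjoint blocks carrying almost the whole variance, and with
`Ψ(a(τ_n))` at most `(1 + δ/8) log n`, the normalized process exceeds `1 - 2δ` infinitely often: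
the block sums are independent and the second Borel-Cantelli lemma applies, while the remaining
indices contribute little. -/
theorem ae_frequently_le (hA : IsIndepEvents P A) {Ψ : ℝ → ℝ} (hΨ : IsNormalizer Ψ)
    {τ : ℕ → ℝ≥0} (hτ : Tendsto (fun n => varCount P A (τ n)) atTop atTop) {R : ℝ≥0 → Set ℕ}
    (hdisj : EventuallyDisjoint R τ) {δ ς : ℝ} (hδ : 0 < δ) (hδ1 : δ < 1) (hς : 0 < ς)
    (hςδ : ς ≤ δ ^ 2 / 16)
    (hshare : ∀ᶠ n in atTop,
      (1 - ς) * varCount P A (τ n) ≤ variance (countOn A (R (τ n)) (τ n)) P)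
    (hlow : ∀ᶠ n : ℕ in atTop, 1 / 2 * Real.log n ≤ Ψ (varCount P A (τ n)))
    (hup : ∀ᶠ n : ℕ in atTop, Ψ (varCount P A (τ n)) ≤ (1 + δ / 8) * Real.log n)
    {e : ℝ} (he : |e| = 1) :
    ∀ᵐ ω ∂P, ∃ᶠ n in atTop,
      (1 - 2 * δ) * √(2 * varCount P A (τ n) * Ψ (varCount P A (τ n))) ≤
        e * centredCount P A (τ n) ω := by
  set a : ℕ → ℝ := fun n => varCount P A (τ n) with ha
  have hς16 : ς ≤ δ / 16 := by nlinarith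
  have hF : ∀ n, ∃ F : Finset ℕ, (F : Set ℕ) ⊆ R (τ n) ∧ (0 < varCount P A (τ n) →
      variance (countOn A (R (τ n)) (τ n)) P - ς * varCount P A (τ n) ≤
        ∑ k ∈ F, variance (occ A k (τ n)) P) := by
    intro n
    by_cases h : 0 < varCount P A (τ n)
    · obtain ⟨F, h1, h2⟩ := exists_finset_variance hA (R (τ n)) (τ n) (mul_pos hς h)
      exact ⟨F, h1, fun _ => h2⟩
    · exact ⟨∅, by simp, fun h' => absurd h' h⟩
  choose F hFR hFV using hF
  have hVge : ∀ᶠ n in atTop, (1 - 2 * ς) * varCount P A (τ n) ≤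
      ∑ k ∈ F n, variance (occ A k (τ n)) P := by
    filter_upwards [hτ.eventually_gt_atTop 0, hshare] with n h1 h2
    have := hFV n h1
    linarith
  have hrest := ae_eventually_compl_lt hA hΨ hτ hδ hς hςδ hVge hlow
  have hfreq := ae_frequently_block hA hFR hdisj
    (eventually_inv_le_block hA hΨ hτ hδ hδ1 hς16 hVge hup he)
  filter_upwards [hfreq, hrest, ae_all_iff.2 fun n => ae_summable_occ hA (τ n)] with ω h1 h2 h3
  refine (h1.and_eventually h2).mono fun n hn => ?_
  obtain ⟨g1, g2⟩ := hn
  rw [centredCount_eq_add hA (F n) (τ n) (h3 n), mul_add, Finset.mul_sum]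
  set Q := countOn A (F n : Set ℕ)ᶜ (τ n) ω -
        ∑' k, ∫ ω', occOn A (F n : Set ℕ)ᶜ k (τ n) ω' ∂P with hQ
  have g3 : -|Q| ≤ e * Q := by
    have : |e * Q| = |Q| := by rw [abs_mul, he, one_mul]
    rw [← this]
    exact neg_abs_le _
  linarith

end

end

section

/-! ### Growth of slowly varying functions -/

/-- A measurable slowly varying function is locally bounded relative to its values, uniformly in
`m ∈ [1, 2]`: for large `x`, the sets of `l ∈ [2, 4]` for which `L(lx)` is not comparable with
`L(x)`, respectively with `L(mx)`, have small measure and do not cover `[2, 4]`. -/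
lemma SlowlyVarying.eventually_mul_le {L : ℝ → ℝ} (hL : SlowlyVarying L) :
    ∀ᶠ x in atTop, ∀ m ∈ Set.Icc (1 : ℝ) 2, L (m * x) ≤ 4 * L x := by
  set Bad : ℝ → Set ℝ := fun x =>
    {l | l ∈ Set.Icc (1 : ℝ) 4 ∧ ¬ (1 / 2 < L (l * x) / L x ∧ L (l * x) / L x < 2)} with hBad
  have hmeas : ∀ x, MeasurableSet (Bad x) := by
    intro x
    have h1 : Measurable fun l => L (l * x) / L x :=
      (hL.measurable.comp (measurable_id.mul_const x)).div_const _
    exact measurableSet_Icc.inter ((measurableSet_lt measurable_const h1).inter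
      (measurableSet_lt h1 measurable_const)).compl
  have hlim : Tendsto (fun x => volume (Bad x)) atTop (𝓝 (volume (∅ : Set ℝ))) := by
    refine tendsto_measure_of_tendsto_indicator atTop hmeas (B := Set.Icc 1 4) measurableSet_Icc
      (by simp) (Eventually.of_forall fun x l hl => hl.1) fun l => ?_
    by_cases hl : 0 < l
    · have h1 := hL.tendsto l hl
      filter_upwards [h1.eventually (lt_mem_nhds (by norm_num : (1 / 2 : ℝ) < 1)),
        h1.eventually (gt_mem_nhds (by norm_num : (1 : ℝ) < 2))] with x h2 h3
      simp only [hBad, Set.mem_empty_iff_false, iff_false]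
      exact fun h => h.2 ⟨h2, h3⟩
    · refine Eventually.of_forall fun x => ?_
      simp only [Set.mem_empty_iff_false, iff_false]
      exact fun h => hl (by linarith [h.1.1])
  rw [measure_empty] at hlim
  have hsmall : ∀ᶠ x in atTop, volume (Bad x) < ENNReal.ofReal (1 / 2) ∧ 0 < L x :=
    (hlim.eventually (gt_mem_nhds (by simp))).and hL.pos
  obtain ⟨X, hX⟩ := eventually_atTop.1 hsmall
  filter_upwards [eventually_ge_atTop (max X 0)] with x hx m hm
  have hm0 : 0 < m := by linarith [hm.1]
  have hx0 : 0 ≤ x := (le_max_right _ _).trans hx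
  have hxX : X ≤ x := (le_max_left _ _).trans hx
  obtain ⟨hv1, hp1⟩ := hX x hxX
  obtain ⟨hv2, hp2⟩ := hX (m * x) (by nlinarith [hm.1])
  have hpre : volume ((m⁻¹ * ·) ⁻¹' Bad (m * x)) < ENNReal.ofReal 1 := by
    rw [Real.volume_preimage_mul_left (inv_ne_zero hm0.ne'), inv_inv, abs_of_pos hm0]
    calc ENNReal.ofReal m * volume (Bad (m * x))
        ≤ ENNReal.ofReal 2 * volume (Bad (m * x)) := by
          gcongr
          exact hm.2
      _ < ENNReal.ofReal 2 * ENNReal.ofReal (1 / 2) :=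
          ENNReal.mul_lt_mul_right (by simp) ENNReal.ofReal_ne_top hv2
      _ = ENNReal.ofReal 1 := by
          rw [← ENNReal.ofReal_mul (by norm_num)]
          norm_num
  have hex : ∃ l ∈ Set.Icc (2 : ℝ) 4, l ∉ Bad x ∧ l ∉ (m⁻¹ * ·) ⁻¹' Bad (m * x) := by
    by_contra hne
    push Not at hne
    have hsub : Set.Icc (2 : ℝ) 4 ⊆ Bad x ∪ (m⁻¹ * ·) ⁻¹' Bad (m * x) := by
      intro l hl
      by_cases h : l ∈ Bad x
      · exact Or.inl h
      · exact Or.inr (hne l hl h)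
    have h1 := (measure_mono hsub).trans (measure_union_le (μ := volume) _ _)
    have h2 : volume (Bad x) + volume ((m⁻¹ * ·) ⁻¹' Bad (m * x)) <
        ENNReal.ofReal (1 / 2) + ENNReal.ofReal 1 := ENNReal.add_lt_add hv1 hpre
    rw [Real.volume_Icc] at h1
    have h3 := h1.trans_lt h2
    rw [← ENNReal.ofReal_add (by norm_num) (by norm_num),
      ENNReal.ofReal_lt_ofReal_iff (by norm_num)] at h3
    norm_num at h3
  obtain ⟨l, hl, hl1, hl2⟩ := hex
  have g1 : 1 / 2 < L (l * x) / L x ∧ L (l * x) / L x < 2 := by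
    by_contra h
    exact hl1 ⟨⟨by linarith [hl.1], hl.2⟩, h⟩
  have g2 : 1 / 2 < L (l * x) / L (m * x) ∧ L (l * x) / L (m * x) < 2 := by
    by_contra h
    refine hl2 ⟨⟨?_, ?_⟩, ?_⟩
    · show 1 ≤ m⁻¹ * l
      rw [inv_mul_eq_div, le_div_iff₀ hm0]
      linarith [hm.2, hl.1]
    · show m⁻¹ * l ≤ 4
      rw [inv_mul_eq_div, div_le_iff₀ hm0]
      nlinarith [hm.1, hl.2]
    · have e : m⁻¹ * l * (m * x) = l * x := by field_simp
      show ¬ (1 / 2 < L (m⁻¹ * l * (m * x)) / L (m * x) ∧ L (m⁻¹ * l * (m * x)) / L (m * x) < 2)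
      rwa [e]
  have g3 := g1.2
  have g4 := g2.1
  rw [div_lt_iff₀ hp1] at g3
  rw [lt_div_iff₀ hp2] at g4
  linarith

/-- A measurable slowly varying function grows slower than any power. -/
lemma SlowlyVarying.exists_le_rpow {L : ℝ → ℝ} (hL : SlowlyVarying L) {ρ : ℝ} (hρ : 0 < ρ) :
    ∃ C, 0 < C ∧ ∀ᶠ x in atTop, L x ≤ C * x ^ ρ := by
  have h2ρ : (1 : ℝ) < 2 ^ ρ := Real.one_lt_rpow one_lt_two hρ
  have h1 := ((hL.tendsto 2 two_pos).eventually (gt_mem_nhds h2ρ)).and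
    (hL.eventually_mul_le.and hL.pos)
  obtain ⟨X', hX'⟩ := eventually_atTop.1 h1
  set X := max X' 1 with hXdef
  have hX1 : 1 ≤ X := le_max_right _ _
  have hX : ∀ x ≥ X, L (2 * x) ≤ 2 ^ ρ * L x ∧
      (∀ m ∈ Set.Icc (1 : ℝ) 2, L (m * x) ≤ 4 * L x) ∧ 0 < L x := by
    intro x hx
    obtain ⟨h2, h3, h4⟩ := hX' x ((le_max_left _ _).trans hx)
    rw [div_lt_iff₀ h4] at h2
    exact ⟨h2.le, h3, h4⟩
  have hX0 : 0 < X := by linarith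
  have hpow : ∀ k : ℕ, L (2 ^ k * X) ≤ (2 ^ k) ^ ρ * L X := by
    intro k
    induction k with
    | zero => simp
    | succ k ih =>
      have h3 := (hX (2 ^ k * X) (le_mul_of_one_le_left hX0.le (one_le_pow₀ one_le_two))).1
      have e : (2 : ℝ) ^ (k + 1) * X = 2 * (2 ^ k * X) := by ring
      have e2 : ((2 : ℝ) ^ (k + 1)) ^ ρ = 2 ^ ρ * (2 ^ k) ^ ρ := by
        rw [pow_succ, Real.mul_rpow (by positivity) (by positivity), mul_comm]
      rw [e, e2, mul_assoc]
      exact h3.trans (mul_le_mul_of_nonneg_left ih (by positivity))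
  have hLX := (hX X le_rfl).2.2
  refine ⟨4 * L X, by positivity, ?_⟩
  filter_upwards [eventually_ge_atTop X] with x hx
  obtain ⟨k, hk1, hk2⟩ := exists_nat_pow_near (x := x / X) (by rwa [one_le_div hX0]) one_lt_two
  have h2k : (0 : ℝ) < 2 ^ k := by positivity
  rw [le_div_iff₀ hX0] at hk1
  rw [div_lt_iff₀ hX0, pow_succ] at hk2
  have hkX : 0 < 2 ^ k * X := by positivity
  have h3 := (hX (2 ^ k * X) (le_mul_of_one_le_left hX0.le (one_le_pow₀ one_le_two))).2.1
    (x / (2 ^ k * X)) ⟨by rwa [one_le_div hkX], by rw [div_le_iff₀ hkX]; linarith⟩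
  rw [div_mul_cancel₀ _ hkX.ne'] at h3
  have h4 : ((2 : ℝ) ^ k) ^ ρ ≤ x ^ ρ := by
    apply Real.rpow_le_rpow h2k.le _ hρ.le
    exact le_trans (le_mul_of_one_le_right h2k.le hX1) hk1
  calc L x ≤ 4 * L (2 ^ k * X) := h3
    _ ≤ 4 * ((2 ^ k) ^ ρ * L X) := by
        have := hpow k
        linarith
    _ ≤ 4 * (x ^ ρ * L X) := by gcongr
    _ = 4 * L X * x ^ ρ := by ring

/-! ### First passage times -/

lemma exists_lt_and_not_succ {p : ℕ → Prop} {i j : ℕ} (hij : i ≤ j) (hi : p i) (hj : ¬ p j) :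
    ∃ k, i ≤ k ∧ k < j ∧ p k ∧ ¬ p (k + 1) := by
  induction j, hij using Nat.le_induction with
  | base => exact absurd hi hj
  | succ j hij ih =>
    by_cases h : p j
    · exact ⟨j, hij, by omega, h, hj⟩
    · obtain ⟨k, h1, h2, h3, h4⟩ := ih h
      exact ⟨k, h1, by omega, h3, h4⟩

/-- The partitions bound the increments of `f` over small neighbourhoods of all large times; in
particular, `f` has bounded jumps. -/
lemma HasPartitions.exists_local_increment {f a : ℝ≥0 → ℝ} {t s : ℕ → ℝ≥0}
    (h : HasPartitions f a t s) (hf : Monotone f) (ht : Tendsto t atTop atTop) :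
    ∃ (B : ℝ) (T : ℝ≥0), 0 < B ∧ ∀ u > T,
      (∃ v < u, f u - f v ≤ B) ∧ ∃ v > u, f v - f u ≤ B := by
  obtain ⟨B, j, hB, hp, -⟩ := h
  obtain ⟨N, hN⟩ := eventually_atTop.1 hp
  have hbig : ∀ u, ∃ n ≥ N, u < t n := fun u => by
    obtain ⟨n, h1, h2⟩ := ((eventually_ge_atTop N).and (ht.eventually_gt_atTop u)).exists
    exact ⟨n, h1, h2⟩
  -- a partition interval with `u` in a prescribed half-open position
  have key : ∀ Q : ℝ≥0 → Prop, Q (t N) → (∃ n ≥ N, ¬ Q (t n)) →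
      ∃ v w, Q v ∧ ¬ Q w ∧ f w - f v ≤ B := by
    intro Q hQ ⟨n, hnN, hn⟩
    obtain ⟨i, hi1, -, hi2, hi3⟩ := exists_lt_and_not_succ (p := fun i => Q (t i)) hnN hQ hn
    obtain ⟨-, p, hp0, hpj, hpk⟩ := hN i hi1
    rw [← hp0] at hi2
    rw [← hpj] at hi3
    obtain ⟨k, -, hk1, hk2, hk3⟩ :=
      exists_lt_and_not_succ (p := fun k => Q (p k)) (Nat.zero_le _) hi2 hi3
    exact ⟨p k, p (k + 1), hk2, hk3, (hpk k hk1).2.2⟩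
  refine ⟨B, t N, by linarith, fun u hu => ?_⟩
  obtain ⟨n, hn1, hn2⟩ := hbig u
  constructor
  · obtain ⟨v, w, hv, hw, hvw⟩ := key (· < u) hu ⟨n, hn1, hn2.le.not_gt⟩
    have := hf (not_lt.1 hw)
    exact ⟨v, hv, by linarith⟩
  · obtain ⟨v, w, hv, hw, hvw⟩ := key (· ≤ u) hu.le ⟨n, hn1, hn2.not_ge⟩
    have := hf hv
    exact ⟨w, not_le.1 hw, by linarith⟩

lemma nonempty_passage_set {g : ℝ≥0 → ℝ} (hg : Tendsto g atTop atTop) (v : ℝ) :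
    {t : ℝ≥0 | 0 < t ∧ v < g t}.Nonempty := by
  obtain ⟨t, h1, h2⟩ := ((eventually_gt_atTop 0).and (hg.eventually_gt_atTop v)).exists
  exact ⟨t, h1, h2⟩

lemma tendsto_passage {f g : ℝ≥0 → ℝ} (hf : Monotone f) (hgf : ∀ t, g t ≤ f t)
    (hg : Tendsto g atTop atTop) : Tendsto (passage g) atTop atTop := by
  refine tendsto_atTop.2 fun T => ?_
  filter_upwards [eventually_ge_atTop (f T)] with v hv
  refine le_csInf (nonempty_passage_set hg v) fun t ht => ?_
  by_contra hlt
  have h1 := hf (not_le.1 hlt).le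
  have h2 := hgf t
  have h3 := ht.2
  linarith

/-- At a first passage time, a function whose increments are dominated by those of `f` is close
to the level, as `f` has bounded jumps. -/
lemma abs_sub_passage_le {f g : ℝ≥0 → ℝ} (hfg : ∀ s t, s ≤ t → |g t - g s| ≤ f t - f s)
    (hg : Tendsto g atTop atTop) {B v : ℝ}
    (hloc : (∃ u < passage g v, f (passage g v) - f u ≤ B) ∧
      ∃ u > passage g v, f u - f (passage g v) ≤ B) : |g (passage g v) - v| ≤ B := by
  have hmono : Monotone f := fun s t hst => by
    have := (abs_nonneg _).trans (hfg s t hst)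
    linarith
  set τ := passage g v with hτ
  obtain ⟨⟨s, hs, hsB⟩, u, hu, huB⟩ := hloc
  have hne := nonempty_passage_set hg v
  rw [abs_le]
  constructor
  · obtain ⟨t, ht, htu⟩ := exists_lt_of_csInf_lt hne (show sInf _ < u from hu)
    have hτt : τ ≤ t := csInf_le' ht
    have h1 := (abs_le.1 (hfg τ t hτt)).2
    have h2 := hmono htu.le
    have h3 := ht.2
    linarith
  · obtain ⟨r, hr1, hr2⟩ := exists_between hs
    have hr : ¬ (0 < r ∧ v < g r) := fun h => (csInf_le' h : τ ≤ r).not_gt hr2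
    have hgr : g r ≤ v := not_lt.1 fun h => hr ⟨zero_le.trans_lt hr1, h⟩
    have h1 := (abs_le.1 (hfg r τ hr2.le)).2
    have h2 := hmono hr1.le
    linarith

end

section

/-! ### Asymptotics along the levels -/

lemma tendsto_natCast_rpow {c : ℝ} (hc : 0 < c) :
    Tendsto (fun n : ℕ => (n : ℝ) ^ c) atTop atTop :=
  (tendsto_rpow_atTop hc).comp tendsto_natCast_atTop_atTop

lemma tendsto_log_natCast : Tendsto (fun n : ℕ => Real.log n) atTop atTop :=
  Real.tendsto_log_atTop.comp tendsto_natCast_atTop_atTop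

lemma eventually_mul_log_add_le {c d : ℝ} (hcd : c < d) (K : ℝ) :
    ∀ᶠ n : ℕ in atTop, c * Real.log n + K ≤ d * Real.log n := by
  filter_upwards [tendsto_log_natCast.eventually_ge_atTop (K / (d - c))] with n hn
  rw [div_le_iff₀ (by linarith)] at hn
  linarith

lemma eventually_natCast_le_exp_rpow {β : ℝ} (hβ : 0 < β) {ε : ℝ} (hε : 0 < ε) :
    ∀ᶠ n : ℕ in atTop, (n : ℝ) ≤ ε * Real.exp ((n : ℝ) ^ β) := by
  have h := ((isLittleO_rpow_exp_atTop (1 / β)).comp_tendsto (tendsto_natCast_rpow hβ)).def hε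
  filter_upwards [h, eventually_ge_atTop 1] with n hn hn1
  have hn0 : (0 : ℝ) ≤ n := Nat.cast_nonneg n
  simp only [Function.comp] at hn
  rwa [← Real.rpow_mul hn0, mul_one_div_cancel hβ.ne', Real.rpow_one, Real.norm_eq_abs,
    Real.norm_eq_abs, abs_of_nonneg hn0, abs_of_pos (Real.exp_pos _)] at hn

lemma exp_rpow_succ_sub_le {β : ℝ} (hβ0 : 0 < β) (hβ1 : β < 1) {n : ℕ} (hn : 1 ≤ n) :
    Real.exp (((n + 1 : ℕ) : ℝ) ^ β) - Real.exp ((n : ℝ) ^ β) ≤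
      2 * Real.exp ((n : ℝ) ^ β) * (n : ℝ) ^ (β - 1) := by
  have hn0 : (0 : ℝ) < n := by exact_mod_cast hn
  have hn1 : (1 : ℝ) ≤ n := by exact_mod_cast hn
  set x := (n : ℝ) ^ β with hx
  have hp : (n : ℝ) ^ (β - 1) = x / n := by rw [Real.rpow_sub hn0, Real.rpow_one]
  have hp1 : (n : ℝ) ^ (β - 1) ≤ 1 := Real.rpow_le_one_of_one_le_of_nonpos hn1 (by linarith)
  have h1 : ((n + 1 : ℕ) : ℝ) ^ β ≤ x + (n : ℝ) ^ (β - 1) := by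
    have e : ((n + 1 : ℕ) : ℝ) = n * (1 + 1 / n) := by
      push_cast
      field_simp
    have h2 := rpow_one_add_le_one_add_mul_self (s := 1 / (n : ℝ)) (p := β)
      (by have : 0 ≤ 1 / (n : ℝ) := by positivity
          linarith) hβ0.le hβ1.le
    rw [e, Real.mul_rpow hn0.le (by positivity), hp]
    have hx0 : 0 ≤ x := by positivity
    calc x * (1 + 1 / n) ^ β ≤ x * (1 + β * (1 / n)) := by gcongr
      _ ≤ x * (1 + 1 * (1 / n)) := by gcongr
      _ = x + x / n := by ring
  set d := (n : ℝ) ^ (β - 1) with hd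
  have hd0 : 0 ≤ d := by positivity
  have h3 := (abs_le.1 (Real.abs_exp_sub_one_le (x := d) (by rwa [abs_of_nonneg hd0]))).2
  rw [abs_of_nonneg hd0] at h3
  have h4 : Real.exp (((n + 1 : ℕ) : ℝ) ^ β) ≤ Real.exp x * Real.exp d := by
    rw [← Real.exp_add]
    exact Real.exp_le_exp.2 h1
  have h5 := mul_le_mul_of_nonneg_left h3 (Real.exp_pos x).le
  linarith

lemma rpow_succ_sub_le {θ : ℝ} (hθ : 0 < θ) {n : ℕ} (hn : 1 ≤ n) (hθn : θ ≤ n) :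
    ((n + 1 : ℕ) : ℝ) ^ θ - (n : ℝ) ^ θ ≤ 2 * θ * (n : ℝ) ^ (θ - 1) := by
  have hn0 : (0 : ℝ) < n := by exact_mod_cast hn
  have e : ((n + 1 : ℕ) : ℝ) = n * (1 + 1 / n) := by
    push_cast
    field_simp
  have hp : (n : ℝ) ^ (θ - 1) = (n : ℝ) ^ θ / n := by rw [Real.rpow_sub hn0, Real.rpow_one]
  have h1 : (1 + 1 / (n : ℝ)) ^ θ ≤ 1 + 2 * (θ / n) := by
    have hd0 : 0 ≤ θ / n := by positivity
    have hd1 : θ / n ≤ 1 := by rwa [div_le_one hn0]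
    have h3 := (abs_le.1 (Real.abs_exp_sub_one_le (x := θ / n) (by rwa [abs_of_nonneg hd0]))).2
    rw [abs_of_nonneg hd0] at h3
    have h4 : (1 + 1 / (n : ℝ)) ^ θ ≤ Real.exp (θ / n) := by
      have h5 : 1 + 1 / (n : ℝ) ≤ Real.exp (1 / n) := by
        have := Real.add_one_le_exp (1 / (n : ℝ))
        linarith
      calc (1 + 1 / (n : ℝ)) ^ θ ≤ Real.exp (1 / n) ^ θ := by gcongr
        _ = Real.exp (θ / n) := by
          rw [← Real.exp_mul]
          congr 1
          ring
    linarith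
  rw [e, Real.mul_rpow hn0.le (by positivity), hp]
  have h2 := mul_le_mul_of_nonneg_left h1 (by positivity : 0 ≤ (n : ℝ) ^ θ)
  have h3 : 2 * θ * ((n : ℝ) ^ θ / n) = (n : ℝ) ^ θ * (2 * (θ / n)) := by ring
  rw [h3]
  linarith

/-- The growth of `f` over `[t_n, t_{n+1}]` and the variance at `s_n` for the levels
`exp(n^β)`, `β = (1 - κ)/(q + ϱ + 1)`. Here `F n`, `G n` and `α n` stand for `f(t_n)`, `f(s_n)`
and `a(s_n)`. -/
lemma exponential_levels {q ϱ κ B C : ℝ} {F G α : ℕ → ℝ} (hq : 0 ≤ q) (hϱ : 0 < ϱ) (hκ0 : 0 < κ)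
    (hκ1 : κ < 1) (hC : 0 < C)
    (hF : ∀ᶠ n : ℕ in atTop, |F n - Real.exp ((n : ℝ) ^ ((1 - κ) / (q + ϱ + 1)))| ≤ B)
    (hG : ∀ᶠ n in atTop, F n ≤ G n ∧ G n ≤ F (n + 1)) (hα : Tendsto α atTop atTop)
    (hαG : ∀ n, α n ≤ G n)
    (hGα : ∀ᶠ n in atTop, G n ≤ C * α n * Real.log (α n) ^ (q + ϱ)) :
    (∀ᶠ n : ℕ in atTop, (n : ℝ) ^ (κ / 2) * (F (n + 1) - F n) ≤ α n) ∧
    (∀ᶠ n : ℕ in atTop, F (n + 1) - F n ≤ Real.exp (2 * n)) ∧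
    ∃ K : ℝ, ∀ᶠ n : ℕ in atTop,
      (1 - κ) / (q + ϱ + 1) * Real.log n - K ≤ Real.log (Real.log (α n)) := by
  set β := (1 - κ) / (q + ϱ + 1) with hβ
  have hβ0 : 0 < β := div_pos (by linarith) (by linarith)
  have hβ1 : β < 1 := by
    rw [hβ, div_lt_one (by linarith)]
    linarith
  have hβm : β * (q + ϱ + 1) = 1 - κ := by
    rw [hβ]
    field_simp
  have hB : 0 ≤ B := by
    obtain ⟨n, hn⟩ := hF.exists
    exact (abs_nonneg _).trans hn
  have hF' := (tendsto_add_atTop_nat 1).eventually hF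
  -- the increments of `F`
  have hD : ∀ᶠ n : ℕ in atTop, F (n + 1) - F n ≤
      3 * Real.exp ((n : ℝ) ^ β) * (n : ℝ) ^ (β - 1) := by
    filter_upwards [hF, hF', eventually_ge_atTop 1,
      eventually_natCast_le_exp_rpow hβ0 (by positivity : 0 < 1 / (2 * B + 1))] with n h1 h2 h3 h4
    have hn0 : (0 : ℝ) < n := by exact_mod_cast h3
    have h5 := exp_rpow_succ_sub_le hβ0 hβ1 h3
    have h6 := (abs_le.1 h1).1
    have h7 := (abs_le.1 h2).2
    have h8 : 2 * B ≤ Real.exp ((n : ℝ) ^ β) * (n : ℝ) ^ (β - 1) := by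
      have h9 : (n : ℝ) ^ (-1 : ℝ) ≤ (n : ℝ) ^ (β - 1) :=
        Real.rpow_le_rpow_of_exponent_le (by exact_mod_cast h3) (by linarith)
      rw [Real.rpow_neg_one] at h9
      rw [div_mul_eq_mul_div, one_mul, le_div_iff₀ (by positivity)] at h4
      calc 2 * B ≤ Real.exp ((n : ℝ) ^ β) * (n : ℝ)⁻¹ := by
            rw [← div_eq_mul_inv, le_div_iff₀ hn0]
            linarith
        _ ≤ _ := by gcongr
    linarith
  have hlarge : ∀ K : ℝ, ∀ᶠ n : ℕ in atTop, K ≤ (n : ℝ) ^ β := fun K =>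
    (tendsto_natCast_rpow hβ0).eventually_ge_atTop K
  have hexplarge : ∀ K : ℝ, ∀ᶠ n : ℕ in atTop, K ≤ Real.exp ((n : ℝ) ^ β) := fun K =>
    (Real.tendsto_exp_atTop.comp (tendsto_natCast_rpow hβ0)).eventually_ge_atTop K
  refine ⟨?_, ?_, ?_⟩
  · filter_upwards [hF, hG, hD, hGα, eventually_ge_atTop 1, hexplarge (2 * B),
      hlarge (Real.log 5), hα.eventually_ge_atTop 1,
      (tendsto_natCast_rpow (half_pos hκ0)).eventually_ge_atTop (3 * (2 * C * 2 ^ (q + ϱ)))]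
      with n h1 h2 h3 h4 h5 h6 h7 h8 h9
    have hn0 : (0 : ℝ) < n := by exact_mod_cast h5
    have hn1 : (1 : ℝ) ≤ n := by exact_mod_cast h5
    set v := Real.exp ((n : ℝ) ^ β) with hv
    have hv0 : 0 < v := Real.exp_pos _
    have hFl := (abs_le.1 h1).1
    have hFu := (abs_le.1 h1).2
    have hp1 : (n : ℝ) ^ (β - 1) ≤ 1 := Real.rpow_le_one_of_one_le_of_nonpos hn1 (by linarith)
    have hF5 : F (n + 1) ≤ 5 * v := by
      have := mul_le_mul_of_nonneg_left hp1 (by positivity : 0 ≤ 3 * v)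
      linarith
    have hα0 : 0 < α n := by linarith
    have hlog0 : 0 ≤ Real.log (α n) := Real.log_nonneg h8
    have hlog : Real.log (α n) ≤ 2 * (n : ℝ) ^ β := by
      have h10 : α n ≤ 5 * v := by linarith [hαG n, h2.2]
      have h12 := Real.log_le_log hα0 h10
      rw [Real.log_mul (by norm_num) hv0.ne', hv, Real.log_exp] at h12
      linarith
    have hva : v ≤ 2 * C * 2 ^ (q + ϱ) * α n * (n : ℝ) ^ (β * (q + ϱ)) := by
      have h10 : v ≤ 2 * G n := by linarith [h2.1]
      have h11 : Real.log (α n) ^ (q + ϱ) ≤ 2 ^ (q + ϱ) * (n : ℝ) ^ (β * (q + ϱ)) := by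
        rw [Real.rpow_mul hn0.le, ← Real.mul_rpow (by norm_num) (by positivity)]
        exact Real.rpow_le_rpow hlog0 hlog (by linarith)
      have h12 := mul_le_mul_of_nonneg_left h11 (by positivity : 0 ≤ 2 * C * α n)
      linarith
    calc (n : ℝ) ^ (κ / 2) * (F (n + 1) - F n)
        ≤ (n : ℝ) ^ (κ / 2) * (3 * v * (n : ℝ) ^ (β - 1)) := by gcongr
      _ ≤ (n : ℝ) ^ (κ / 2) * (3 * (2 * C * 2 ^ (q + ϱ) * α n * (n : ℝ) ^ (β * (q + ϱ))) *
          (n : ℝ) ^ (β - 1)) := by gcongr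
      _ = 3 * (2 * C * 2 ^ (q + ϱ)) * α n *
          ((n : ℝ) ^ (κ / 2) * (n : ℝ) ^ (β * (q + ϱ)) * (n : ℝ) ^ (β - 1)) := by ring
      _ = 3 * (2 * C * 2 ^ (q + ϱ)) * α n * (n : ℝ) ^ (-(κ / 2)) := by
          rw [← Real.rpow_add hn0, ← Real.rpow_add hn0]
          congr 2
          linarith
      _ ≤ (n : ℝ) ^ (κ / 2) * α n * (n : ℝ) ^ (-(κ / 2)) := by gcongr
      _ = α n * ((n : ℝ) ^ (κ / 2) * (n : ℝ) ^ (-(κ / 2))) := by ring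
      _ = α n := by
          rw [← Real.rpow_add hn0, add_neg_cancel, Real.rpow_zero, mul_one]
  · filter_upwards [hD, eventually_ge_atTop 2] with n h1 h2
    have hn1 : (1 : ℝ) ≤ n := by
      have : 1 ≤ n := by omega
      exact_mod_cast this
    have hp1 : (n : ℝ) ^ (β - 1) ≤ 1 := Real.rpow_le_one_of_one_le_of_nonpos hn1 (by linarith)
    have hp2 : (n : ℝ) ^ β ≤ n := by
      conv_rhs => rw [← Real.rpow_one (n : ℝ)]
      exact Real.rpow_le_rpow_of_exponent_le hn1 hβ1.le
    have h3 : (3 : ℝ) ≤ Real.exp n := by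
      have h4 : (2 : ℝ) ≤ n := by exact_mod_cast h2
      have := Real.add_one_le_exp (n : ℝ)
      linarith
    calc F (n + 1) - F n ≤ 3 * Real.exp ((n : ℝ) ^ β) * (n : ℝ) ^ (β - 1) := h1
      _ ≤ Real.exp n * Real.exp n * 1 := by gcongr
      _ = Real.exp (2 * n) := by
          rw [mul_one, ← Real.exp_add]
          congr 1
          ring
  · refine ⟨Real.log 4, ?_⟩
    have hlogo := hα.eventually (((isLittleO_log_rpow_rpow_atTop (q + ϱ) one_pos).def
      (by positivity : 0 < 1 / C)))
    filter_upwards [hF, hG, hGα, hlogo, eventually_ge_atTop 1, hexplarge (2 * B),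
      hlarge (2 * Real.log 2), hα.eventually_ge_atTop 1] with n h1 h2 h4 h5 h6 h7 h8 h9
    have hn0 : (0 : ℝ) < n := by exact_mod_cast h6
    set v := Real.exp ((n : ℝ) ^ β) with hv
    have hv0 : 0 < v := Real.exp_pos _
    have hFl := (abs_le.1 h1).1
    have hα0 : 0 < α n := by linarith
    have hlog0 : 0 ≤ Real.log (α n) := Real.log_nonneg h9
    rw [Real.rpow_one, Real.norm_eq_abs, Real.norm_eq_abs, abs_of_nonneg (by positivity),
      abs_of_pos hα0, div_mul_eq_mul_div, one_mul, le_div_iff₀ hC] at h5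
    have h10 : v / 2 ≤ α n ^ 2 := by
      have := mul_le_mul_of_nonneg_left h5 hα0.le
      linarith [h2.1]
    have h11 := Real.log_le_log (by positivity) h10
    rw [Real.log_div hv0.ne' two_ne_zero, hv, Real.log_exp, Real.log_pow] at h11
    push_cast at h11
    have h12 : (n : ℝ) ^ β / 4 ≤ Real.log (α n) := by linarith
    have h13 := Real.log_le_log (by positivity) h12
    rwa [Real.log_div (by positivity) (by norm_num), Real.log_rpow hn0] at h13

/-- The growth of `f` over `[t_n, t_{n+1}]` and the variance at `s_n` for the levels
`n^{m(1-κ)/(m-1)}`, `m = μ + ϱ`. Here `F n`, `G n` and `α n` stand for `f(t_n)`, `f(s_n)` and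
`a(s_n)`. -/
lemma polynomial_levels {m κ B C : ℝ} {F G α : ℕ → ℝ} (hm : 1 < m) (hκ0 : 0 < κ)
    (hκ1 : κ < 1) (hκm : κ * m ≤ 1) (hC : 0 < C)
    (hF : ∀ᶠ n : ℕ in atTop, |F n - (n : ℝ) ^ (m * (1 - κ) / (m - 1))| ≤ B)
    (hG : ∀ᶠ n in atTop, F n ≤ G n) (hα : Tendsto α atTop atTop)
    (hGα : ∀ᶠ n in atTop, G n ≤ C * α n ^ m) :
    (∀ᶠ n : ℕ in atTop, (n : ℝ) ^ (κ / 2) * (F (n + 1) - F n) ≤ α n) ∧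
    (∀ᶠ n : ℕ in atTop, F (n + 1) - F n ≤ Real.exp (2 * n)) ∧
    ∃ K : ℝ, ∀ᶠ n : ℕ in atTop,
      (1 - κ) / (m - 1) * Real.log n - K ≤ Real.log (α n) := by
  set θ := m * (1 - κ) / (m - 1) with hθ
  set g := (1 - κ) / (m - 1) with hg
  have hm1 : 0 < m - 1 := by linarith
  have hθg : θ = g * m := by rw [hθ, hg]; ring
  have hθg' : θ - 1 = g - κ := by
    rw [hθ, hg]
    field_simp
    ring
  -- `θ ≥ 1` makes the error `2B` negligible against `n^{θ-1}`; this is where `κ m ≤ 1` enters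
  have hθ1 : 1 ≤ θ := by
    rw [hθ, le_div_iff₀ hm1]
    linarith
  have hB : 0 ≤ B := by
    obtain ⟨n, hn⟩ := hF.exists
    exact (abs_nonneg _).trans hn
  have hF' := (tendsto_add_atTop_nat 1).eventually hF
  have hK0 : 0 < 2 * θ + 2 * B := by linarith
  have hD : ∀ᶠ n : ℕ in atTop, F (n + 1) - F n ≤ (2 * θ + 2 * B) * (n : ℝ) ^ (θ - 1) := by
    filter_upwards [hF, hF', eventually_ge_atTop 1,
      tendsto_natCast_atTop_atTop.eventually_ge_atTop θ] with n h1 h2 h3 h4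
    have h5 := rpow_succ_sub_le (by linarith) h3 h4
    have h6 := (abs_le.1 h1).1
    have h7 := (abs_le.1 h2).2
    have h8 : 1 ≤ (n : ℝ) ^ (θ - 1) := Real.one_le_rpow (by exact_mod_cast h3) (by linarith)
    have h9 := mul_le_mul_of_nonneg_left h8 (by positivity : 0 ≤ 2 * B)
    linarith
  have hpow : ∀ᶠ n : ℕ in atTop, (n : ℝ) ^ θ ≤ 2 * C * α n ^ m := by
    filter_upwards [hF, hG, hGα,
      (tendsto_natCast_rpow (by linarith : 0 < θ)).eventually_ge_atTop (2 * B)] with n h1 h2 h3 h4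
    have h6 := (abs_le.1 h1).1
    linarith
  refine ⟨?_, ?_, ?_⟩
  · set c₁ := (2 * C) ^ (1 / m) with hc₁
    have hc₁0 : 0 < c₁ := by positivity
    filter_upwards [hD, hpow, eventually_ge_atTop 1, hα.eventually_ge_atTop 1,
      (tendsto_natCast_rpow (half_pos hκ0)).eventually_ge_atTop ((2 * θ + 2 * B) * c₁)]
      with n h1 h2 h3 h4 h5
    have hn0 : (0 : ℝ) < n := by exact_mod_cast h3
    have hα0 : 0 ≤ α n := by linarith
    have h6 : (n : ℝ) ^ g ≤ c₁ * α n := by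
      have h7 := Real.rpow_le_rpow (by positivity) h2 (by positivity : 0 ≤ 1 / m)
      rwa [Real.mul_rpow (by positivity) (by positivity), ← Real.rpow_mul hα0,
        ← Real.rpow_mul hn0.le, hθg, mul_assoc, mul_one_div_cancel (by linarith), mul_one,
        Real.rpow_one] at h7
    calc (n : ℝ) ^ (κ / 2) * (F (n + 1) - F n)
        ≤ (n : ℝ) ^ (κ / 2) * ((2 * θ + 2 * B) * (n : ℝ) ^ (θ - 1)) := by gcongr
      _ = (2 * θ + 2 * B) * ((n : ℝ) ^ g * (n : ℝ) ^ (-(κ / 2))) := by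
          rw [← Real.rpow_add hn0, mul_left_comm, ← Real.rpow_add hn0, hθg']
          congr 2
          ring
      _ ≤ (2 * θ + 2 * B) * (c₁ * α n * (n : ℝ) ^ (-(κ / 2))) := by gcongr
      _ = (2 * θ + 2 * B) * c₁ * α n * (n : ℝ) ^ (-(κ / 2)) := by ring
      _ ≤ (n : ℝ) ^ (κ / 2) * α n * (n : ℝ) ^ (-(κ / 2)) := by gcongr
      _ = α n * ((n : ℝ) ^ (κ / 2) * (n : ℝ) ^ (-(κ / 2))) := by ring
      _ = α n := by
          rw [← Real.rpow_add hn0, add_neg_cancel, Real.rpow_zero, mul_one]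
  · have h := ((isLittleO_rpow_exp_atTop (θ - 1)).comp_tendsto
      tendsto_natCast_atTop_atTop).def (by positivity : 0 < 1 / (2 * θ + 2 * B))
    filter_upwards [hD, h] with n h1 h2
    have hn0 : (0 : ℝ) ≤ n := Nat.cast_nonneg n
    simp only [Function.comp] at h2
    rw [Real.norm_eq_abs, Real.norm_eq_abs, abs_of_nonneg (by positivity),
      abs_of_pos (Real.exp_pos _), div_mul_eq_mul_div, one_mul, le_div_iff₀ hK0] at h2
    have h3 : Real.exp n ≤ Real.exp (2 * n) := Real.exp_le_exp.2 (by linarith)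
    linarith
  · refine ⟨Real.log (2 * C) / m, ?_⟩
    filter_upwards [hpow, eventually_ge_atTop 1, hα.eventually_ge_atTop 1] with n h1 h2 h3
    have hn0 : (0 : ℝ) < n := by exact_mod_cast h2
    have hα0 : 0 < α n := by linarith
    have h4 := Real.log_le_log (by positivity) h1
    rw [Real.log_rpow hn0, Real.log_mul (by positivity) (by positivity), Real.log_rpow hα0,
      hθg] at h4
    have hm0 : 0 < m := by linarith
    have h5 : g * Real.log n * m ≤ (Real.log (2 * C) / m + Real.log (α n)) * m := by
      rw [add_mul, div_mul_cancel₀ _ hm0.ne']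
      linarith
    linarith [le_of_mul_le_mul_right h5 hm0]

/-- Sequences at bounded distance tending to infinity have logarithms at bounded distance. -/
lemma eventually_abs_log_sub_log_le {α w : ℕ → ℝ} {B : ℝ} (hw : Tendsto w atTop atTop)
    (h : ∀ᶠ n in atTop, |α n - w n| ≤ B) :
    ∀ᶠ n in atTop, |Real.log (α n) - Real.log (w n)| ≤ Real.log 2 := by
  filter_upwards [h, hw.eventually_ge_atTop (2 * B), hw.eventually_gt_atTop 0] with n h1 h2 h3
  obtain ⟨h4, h5⟩ := abs_le.1 h1
  have h6 : Real.log (α n) ≤ Real.log (2 * w n) := Real.log_le_log (by linarith) (by linarith)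
  have h7 : Real.log (w n) ≤ Real.log (2 * α n) := Real.log_le_log (by linarith) (by linarith)
  rw [Real.log_mul two_ne_zero (by linarith)] at h6 h7
  rw [abs_le]
  constructor <;> linarith

/-! ### The normalizing functions -/

lemma mul_log_le {c : ℝ} (hc : c ∈ Set.Ioo (0 : ℝ) 1) :
    ∀ᶠ x in atTop, ∀ y, c * x ≤ y → c * Real.log x ≤ Real.log y := by
  have h := (Real.tendsto_log_atTop.const_mul_atTop (sub_pos.2 hc.2)).eventually_ge_atTop
    (-Real.log c)
  filter_upwards [h, eventually_gt_atTop 0] with x h1 h2 y hy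
  have h3 := Real.log_le_log (mul_pos hc.1 h2) hy
  rw [Real.log_mul hc.1.ne' h2.ne'] at h3
  linarith

lemma isNormalizer_log {d : ℝ} (hd : 0 < d) : IsNormalizer fun x => d * Real.log x where
  tendsto_atTop := Real.tendsto_log_atTop.const_mul_atTop hd
  tendsto_div := by
    have h := (Real.isLittleO_log_id_atTop.tendsto_div_nhds_zero).const_mul d
    simpa [mul_div_assoc] using h
  mul_le c hc := by
    filter_upwards [mul_log_le hc] with x hx y hy
    rw [mul_left_comm]
    exact mul_le_mul_of_nonneg_left (hx y hy) hd.le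

lemma isNormalizer_log_log {d : ℝ} (hd : 0 < d) :
    IsNormalizer fun x => d * Real.log (Real.log x) where
  tendsto_atTop :=
    (Real.tendsto_log_atTop.comp Real.tendsto_log_atTop).const_mul_atTop hd
  tendsto_div := by
    have h1 : (fun x => Real.log (Real.log x)) =o[atTop] fun x : ℝ => Real.log x :=
      Real.isLittleO_log_id_atTop.comp_tendsto Real.tendsto_log_atTop
    have h := ((h1.trans Real.isLittleO_log_id_atTop).tendsto_div_nhds_zero).const_mul d
    simpa [mul_div_assoc] using h
  mul_le c hc := by
    filter_upwards [mul_log_le hc, Real.tendsto_log_atTop.eventually (mul_log_le hc)]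
      with x hx hx' y hy
    rw [mul_left_comm]
    exact mul_le_mul_of_nonneg_left (hx' _ (hx y hy)) hd.le

end

section

variable {Ω : Type*} [MeasurableSpace Ω] {P : Measure Ω}
  {A : ℕ → ℝ≥0 → Set Ω} {M : ℕ} {Φ : ℕ → ℝ≥0 → Ω → ℕ}

/-! ### Consequences of the growth, partition and block conditions -/

lemma IsLogIndex.exists_le {f a : ℝ≥0 → ℝ} {q ϱ : ℝ} (h : IsLogIndex f a q)
    (ha : Tendsto a atTop atTop) (hϱ : 0 < ϱ) :
    ∃ C, 0 < C ∧ ∀ᶠ t in atTop, f t ≤ C * a t * Real.log (a t) ^ (q + ϱ) := by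
  obtain ⟨-, L, hL, hO, -⟩ := h
  obtain ⟨C, hC, hO⟩ := hO.exists_pos
  obtain ⟨D, hD, hLD⟩ := hL.exists_le_rpow hϱ
  have hla := Real.tendsto_log_atTop.comp ha
  refine ⟨C * D, by positivity, ?_⟩
  filter_upwards [hO.bound, hla.eventually hLD, hla.eventually hL.pos, hla.eventually_gt_atTop 0,
    ha.eventually_gt_atTop 0] with t h1 h2 h3 h4 h5
  simp only [Function.comp] at h2 h3 h4
  set x := Real.log (a t)
  have h6 : 0 ≤ x ^ q := by positivity
  rw [zFun, Real.norm_eq_abs, Real.norm_eq_abs, abs_of_nonneg (mul_nonneg h6 h3.le)] at h1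
  have h7 := (le_abs_self _).trans h1
  rw [div_le_iff₀ h5] at h7
  calc f t ≤ C * (x ^ q * L x) * a t := h7
    _ ≤ C * (x ^ q * (D * x ^ ϱ)) * a t := by gcongr
    _ = C * D * a t * x ^ (q + ϱ) := by
      rw [Real.rpow_add h4]
      ring

/-- The infimum `μ` need not be attained, but each larger exponent is admissible. -/
lemma GrowthCondition.exists_le {f a : ℝ≥0 → ℝ} {q ϱ : ℝ} (h : GrowthCondition f a q)
    (ha : Tendsto a atTop atTop) (hϱ : 0 < ϱ) :
    ∃ C, 0 < C ∧ ∀ᶠ t in atTop, f t ≤ C * a t ^ (growthExponent f a + ϱ) := by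
  have hlt : sInf {m : ℝ | 1 ≤ m ∧ f =O[atTop] fun t => a t ^ m} < growthExponent f a + ϱ := by
    rw [growthExponent]
    linarith
  obtain ⟨m, ⟨-, hO⟩, hm⟩ := exists_lt_of_csInf_lt h.polynomial hlt
  obtain ⟨C, hC, hO⟩ := hO.exists_pos
  refine ⟨C, hC, ?_⟩
  filter_upwards [hO.bound, ha.eventually_ge_atTop 1] with t h1 h2
  have h3 : 0 ≤ a t := by linarith
  rw [Real.norm_eq_abs, Real.norm_eq_abs, abs_of_nonneg (Real.rpow_nonneg h3 m)] at h1
  calc f t ≤ C * a t ^ m := (le_abs_self _).trans h1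
    _ ≤ _ := by gcongr

lemma vLevel_one {q κ ϱ : ℝ} (n : ℕ) :
    vLevel 1 q κ ϱ n = Real.exp ((n : ℝ) ^ ((1 - κ) / (q + ϱ + 1))) := by
  simp [vLevel]

lemma vLevel_of_one_lt {μ q κ ϱ : ℝ} (hμ : 1 < μ) (n : ℕ) :
    vLevel μ q κ ϱ n = (n : ℝ) ^ ((μ + ϱ) * (1 - κ) / (μ + ϱ - 1)) := by
  simp [vLevel, hμ.ne']

lemma wLevel_one {q γ : ℝ} (n : ℕ) :
    wLevel 1 q γ n = Real.exp ((n : ℝ) ^ ((1 + γ) / (q + 1))) := by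
  simp [wLevel]

lemma wLevel_of_one_lt {μ q γ : ℝ} (hμ : 1 < μ) (n : ℕ) :
    wLevel μ q γ n = (n : ℝ) ^ ((1 + γ) / (μ - 1)) := by
  simp [wLevel, hμ.ne']

lemma tendsto_vLevel {μ q κ ϱ : ℝ} (hμ : μ = 1 ∧ 0 ≤ q ∨ 1 < μ) (hϱ : 0 < ϱ) (hκ : κ < 1) :
    Tendsto (vLevel μ q κ ϱ) atTop atTop := by
  rcases hμ with ⟨rfl, hq⟩ | hμ
  · rw [funext (vLevel_one (q := q) (κ := κ) (ϱ := ϱ))]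
    exact Real.tendsto_exp_atTop.comp
      (tendsto_natCast_rpow (div_pos (by linarith) (by linarith)))
  · rw [funext (vLevel_of_one_lt hμ)]
    exact tendsto_natCast_rpow (div_pos (mul_pos (by linarith) (by linarith)) (by linarith))

lemma tendsto_wLevel {μ q γ : ℝ} (hμ : μ = 1 ∧ 0 ≤ q ∨ 1 < μ) (hγ : 0 < γ) :
    Tendsto (wLevel μ q γ) atTop atTop := by
  rcases hμ with ⟨rfl, hq⟩ | hμ
  · rw [funext (wLevel_one (q := q) (γ := γ))]
    exact Real.tendsto_exp_atTop.comp
      (tendsto_natCast_rpow (div_pos (by linarith) (by linarith)))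
  · rw [funext (wLevel_of_one_lt hμ)]
    exact tendsto_natCast_rpow (div_pos (by linarith) (by linarith))

lemma IsNearMinimizer.eventually_mem {a : ℝ≥0 → ℝ} {t s : ℕ → ℝ≥0} (h : IsNearMinimizer a t s) :
    ∀ᶠ n in atTop, s n ∈ Set.Icc (t n) (t (n + 1)) := by
  obtain ⟨a₀, -, h⟩ := h
  exact h.mono fun n hn => hn.1

lemma IsNearMinimizer.tendsto {a : ℝ≥0 → ℝ} {t s : ℕ → ℝ≥0} (h : IsNearMinimizer a t s)
    (ht : Tendsto t atTop atTop) : Tendsto s atTop atTop :=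
  tendsto_atTop_mono' _ (h.eventually_mem.mono fun _ hn => hn.1) ht

lemma eventually_abs_sub_level_le {f g : ℝ≥0 → ℝ}
    (hfg : ∀ s t, s ≤ t → |g t - g s| ≤ f t - f s) (hg : Tendsto g atTop atTop)
    {v : ℕ → ℝ} (hτ : Tendsto (fun n => passage g (v n)) atTop atTop) {B : ℝ} {T : ℝ≥0}
    (hloc : ∀ u > T, (∃ v < u, f u - f v ≤ B) ∧ ∃ v > u, f v - f u ≤ B) :
    ∀ᶠ n in atTop, |g (passage g (v n)) - v n| ≤ B := by
  filter_upwards [hτ.eventually_gt_atTop T] with n hn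
  exact abs_sub_passage_le hfg hg (hloc _ hn)

/-- Both block conditions provide, for each `ς > 0`, eventually disjoint index sets carrying at
least the share `1 - ς` of the variance. -/
lemma exists_blocks {f : ℝ≥0 → ℝ} {q ς : ℝ} (hvar : Tendsto (varCount P A) atTop atTop)
    (h : ApproximateBlocks P A f q ∨ ExactBlocks P A f q) (hς : 0 < ς) :
    ∃ R : ℝ≥0 → Set ℕ, ∃ ε > (0 : ℝ),
      (∀ γ ∈ Set.Ioo 0 ε, EventuallyDisjoint R (tauSeq f (varCount P A) q γ)) ∧
      ∀ᶠ t in atTop, (1 - ς) * varCount P A t ≤ variance (countOn A (R t) t) P := by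
  have key : ∀ (R : ℝ≥0 → Set ℕ) (c : ℝ), VarianceShare P A R c → 1 - ς < c →
      ∀ᶠ t in atTop, (1 - ς) * varCount P A t ≤ variance (countOn A (R t) t) P := by
    intro R c hR hc
    filter_upwards [hR.eventually (lt_mem_nhds hc), hvar.eventually_gt_atTop 0] with t h1 h2
    exact ((lt_div_iff₀ h2).1 h1).le
  rcases h with ⟨R, ε, hε, hR⟩ | ⟨R, ⟨ε, hε, hd⟩, hR⟩
  · have hmin : 0 < min (ς / 2) (ε / 2) := by positivity
    have h1 : min (ς / 2) (ε / 2) ≤ ς / 2 := min_le_left _ _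
    have h2 : min (ς / 2) (ε / 2) ≤ ε / 2 := min_le_right _ _
    obtain ⟨hd, hs⟩ := hR _ ⟨hmin, by linarith⟩
    exact ⟨_, ε, hε, hd, key _ _ hs (by linarith)⟩
  · exact ⟨R, ε, hε, hd, key R 1 hR (by linarith)⟩

/-! ### The upper and lower limits -/

lemma limsup_coe_eq_one {y : ℝ≥0 → ℝ} (hU : ∀ k : ℕ, ∀ᶠ u in atTop, y u ≤ 1 + 4 * (1 / (k + 2)))
    (hL : ∀ k : ℕ, ∃ᶠ u in atTop, 1 - 2 * (1 / (k + 2)) ≤ y u) :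
    limsup (fun u => (y u : EReal)) atTop = 1 := by
  have h0 : Tendsto (fun k : ℕ => 1 / ((k : ℝ) + 2)) atTop (𝓝 0) :=
    tendsto_const_nhds.div_atTop
      (tendsto_atTop_add_const_right _ _ tendsto_natCast_atTop_atTop)
  apply le_antisymm
  · have h1 : Tendsto (fun k : ℕ => ((1 + 4 * (1 / ((k : ℝ) + 2)) : ℝ) : EReal)) atTop
        (𝓝 ((1 : ℝ) : EReal)) := by
      refine (continuous_coe_real_ereal.tendsto _).comp ?_
      simpa using (h0.const_mul 4).const_add 1
    refine ge_of_tendsto' h1 fun k => limsup_le_of_le (h := ?_)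
    filter_upwards [hU k] with u hu
    exact_mod_cast hu
  · have h1 : Tendsto (fun k : ℕ => ((1 - 2 * (1 / ((k : ℝ) + 2)) : ℝ) : EReal)) atTop
        (𝓝 ((1 : ℝ) : EReal)) := by
      refine (continuous_coe_real_ereal.tendsto _).comp ?_
      simpa using (h0.const_mul 2).const_sub 1
    refine le_of_tendsto' h1 fun k => le_limsup_of_frequently_le' ?_
    exact (hL k).mono fun u hu => by exact_mod_cast hu

lemma satisfiesLIL_of_bounds {r : ℝ≥0 → ℝ} (hr : ∀ᶠ t in atTop, 0 < r t)
    (hU : ∀ δ ∈ Set.Ioo (0 : ℝ) 1, ∀ᵐ ω ∂P, ∀ᶠ u in atTop,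
      |centredCount P A u ω| ≤ (1 + 4 * δ) * √(r u))
    (hL : ∀ δ ∈ Set.Ioo (0 : ℝ) 1, ∀ e : ℝ, |e| = 1 → ∀ᵐ ω ∂P, ∃ᶠ u in atTop,
      (1 - 2 * δ) * √(r u) ≤ e * centredCount P A u ω) :
    SatisfiesLIL P A r := by
  have hδ : ∀ k : ℕ, 1 / ((k : ℝ) + 2) ∈ Set.Ioo (0 : ℝ) 1 := fun k => by
    have hk : (0 : ℝ) ≤ k := Nat.cast_nonneg k
    refine ⟨by positivity, ?_⟩
    rw [div_lt_one (by linarith)]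
    linarith
  have key : ∀ e : ℝ, |e| = 1 → ∀ᵐ ω ∂P, limsup (fun t : ℝ≥0 =>
      ((e * centredCount P A t ω / √(r t) : ℝ) : EReal)) atTop = 1 := by
    intro e he
    filter_upwards [ae_all_iff.2 fun k : ℕ => hU _ (hδ k),
      ae_all_iff.2 fun k : ℕ => hL _ (hδ k) e he] with ω hω1 hω2
    refine limsup_coe_eq_one (fun k => ?_) fun k => ?_
    · filter_upwards [hω1 k, hr] with u h1 h2
      rw [div_le_iff₀ (Real.sqrt_pos.2 h2)]
      refine (le_abs_self _).trans ?_
      rwa [abs_mul, he, one_mul]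
    · refine ((hω2 k).and_eventually hr).mono fun u hu => ?_
      rw [le_div_iff₀ (Real.sqrt_pos.2 hu.2)]
      exact hu.1
  refine ⟨?_, ?_⟩
  · filter_upwards [key 1 (by simp)] with ω hω
    simpa [centredCount] using hω
  · filter_upwards [key (-1) (by simp)] with ω hω
    have h := EReal.limsup_neg (f := (atTop : Filter ℝ≥0))
      (v := fun t => (((count A t ω - meanCount P A t) / √(r t) : ℝ) : EReal))
    have e : (-fun t : ℝ≥0 => (((count A t ω - meanCount P A t) / √(r t) : ℝ) : EReal)) =
        fun t => ((-1 * centredCount P A t ω / √(r t) : ℝ) : EReal) := by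
      funext t
      rw [Pi.neg_apply, ← EReal.coe_neg, centredCount]
      congr 1
      ring
    rw [e, hω] at h
    rw [← neg_neg (liminf _ _), ← h]

variable [IsProbabilityMeasure P]

/-! ### The upper bound along the levels of the mean majorant -/

lemma ae_eventually_abs_le_of_one {q : ℝ} (hA : IsIndepEvents P A)
    (hvar : Tendsto (varCount P A) atTop atTop) (hΦ : IsMajorant P A M Φ)
    (hμ : growthExponent (meanMajorant P Φ) (varCount P A) = 1)
    (hindex : IsLogIndex (meanMajorant P Φ) (varCount P A) q)
    (hlocal : LocalCondition (meanMajorant P Φ) (varCount P A) q) {δ : ℝ}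
    (hδ : δ ∈ Set.Ioo (0 : ℝ) 1) :
    ∀ᵐ ω ∂P, ∀ᶠ u in atTop, |centredCount P A u ω| ≤ (1 + 4 * δ) *
      √(2 * varCount P A u * ((q + 1) * Real.log (Real.log (varCount P A u)))) := by
  obtain ⟨hδ0, hδ1⟩ := hδ
  have hq := hindex.1
  have haf := varCount_le_meanMajorant hA hΦ
  have hmono := meanMajorant_mono hA hΦ
  have hf : Tendsto (meanMajorant P Φ) atTop atTop := tendsto_atTop_mono haf hvar
  -- small enough for `(q + 1)(1 - κ)/(q + ϱ + 1) ≥ 1 - δ/8`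
  set ϱ := δ / 16 with hϱ
  have hϱ0 : 0 < ϱ := by positivity
  obtain ⟨κ₀, hκ₀, hlocal⟩ := hlocal ϱ ⟨hϱ0, by linarith⟩
  set κ := min (κ₀ / 2) (δ / 16) with hκ
  have hκ0 : 0 < κ := by positivity
  have hκδ : κ ≤ δ / 16 := min_le_right _ _
  obtain ⟨s, hmin, hpart⟩ := hlocal κ ⟨hκ0, (min_le_left _ _).trans_lt (by linarith)⟩
  have ht : Tendsto (tSeq (meanMajorant P Φ) (varCount P A) q κ ϱ) atTop atTop :=
    (tendsto_passage hmono (fun _ => le_rfl) hf).comp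
      (tendsto_vLevel (Or.inl ⟨hμ, hq⟩) hϱ0 (by linarith))
  obtain ⟨B, T, -, hloc⟩ := hpart.exists_local_increment hmono ht
  have hF := eventually_abs_sub_level_le
    (fun s t hst => (abs_of_nonneg (sub_nonneg.2 (hmono hst))).le) hf ht hloc
  have hs := hmin.tendsto ht
  obtain ⟨C, hC, hle⟩ := hindex.exists_le hvar hϱ0
  have hF' : ∀ᶠ n : ℕ in atTop,
      |meanMajorant P Φ (tSeq (meanMajorant P Φ) (varCount P A) q κ ϱ n) -
        Real.exp ((n : ℝ) ^ ((1 - κ) / (q + ϱ + 1)))| ≤ B := by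
    simpa only [tSeq, hμ, vLevel_one] using hF
  obtain ⟨h1, h2, K, h3⟩ := exponential_levels (G := fun n => meanMajorant P Φ (s n))
    (α := fun n => varCount P A (s n)) hq hϱ0 hκ0 (by linarith) hC hF'
    (hmin.eventually_mem.mono fun n hn => ⟨hmono hn.1, hmono hn.2⟩) (hvar.comp hs)
    (fun n => haf _) (hs.eventually hle)
  refine ae_eventually_abs_le hA hΦ (isNormalizer_log_log (by linarith)) hvar hδ0 hδ1.le hmin
    hpart ht (half_pos hκ0) h1 h2 ?_
  have hexp : 1 - δ / 4 < (q + 1) * ((1 - κ) / (q + ϱ + 1)) := by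
    rw [← mul_div_assoc, lt_div_iff₀ (by linarith)]
    nlinarith [mul_nonneg hq hδ0.le, mul_le_mul_of_nonneg_left hκδ hq]
  filter_upwards [h3, eventually_mul_log_add_le hexp ((q + 1) * K)] with n h4 h5
  have h6 := mul_le_mul_of_nonneg_left h4 (by linarith : 0 ≤ q + 1)
  linarith

lemma ae_eventually_abs_le_of_one_lt {q : ℝ} (hA : IsIndepEvents P A)
    (hvar : Tendsto (varCount P A) atTop atTop) (hΦ : IsMajorant P A M Φ)
    (hμ : 1 < growthExponent (meanMajorant P Φ) (varCount P A))
    (hgrowth : GrowthCondition (meanMajorant P Φ) (varCount P A) q)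
    (hlocal : LocalCondition (meanMajorant P Φ) (varCount P A) q) {δ : ℝ}
    (hδ : δ ∈ Set.Ioo (0 : ℝ) 1) :
    ∀ᵐ ω ∂P, ∀ᶠ u in atTop, |centredCount P A u ω| ≤ (1 + 4 * δ) *
      √(2 * varCount P A u * ((growthExponent (meanMajorant P Φ) (varCount P A) - 1) *
        Real.log (varCount P A u))) := by
  obtain ⟨hδ0, hδ1⟩ := hδ
  have haf := varCount_le_meanMajorant hA hΦ
  have hmono := meanMajorant_mono hA hΦ
  have hf : Tendsto (meanMajorant P Φ) atTop atTop := tendsto_atTop_mono haf hvar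
  set μ := growthExponent (meanMajorant P Φ) (varCount P A) with hμdef
  have hμ1 : 0 < μ - 1 := by linarith
  -- small enough for `(μ - 1)(1 - κ)/(μ + ϱ - 1) ≥ 1 - δ/8`
  set ϱ := min (1 / 2) ((μ - 1) * δ / 16) with hϱ
  have hϱ0 : 0 < ϱ := by positivity
  have hϱ1 : ϱ ≤ 1 / 2 := min_le_left _ _
  have hϱδ : ϱ ≤ (μ - 1) * δ / 16 := min_le_right _ _
  obtain ⟨κ₀, hκ₀, hlocal⟩ := hlocal ϱ ⟨hϱ0, by linarith⟩
  set κ := min (κ₀ / 2) (min (δ / 16) (1 / (μ + ϱ))) with hκ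
  have hκ0 : 0 < κ := by positivity
  have hκδ : κ ≤ δ / 16 := (min_le_right _ _).trans (min_le_left _ _)
  have hκm : κ * (μ + ϱ) ≤ 1 :=
    (le_div_iff₀ (by linarith)).1 ((min_le_right _ _).trans (min_le_right _ _))
  obtain ⟨s, hmin, hpart⟩ := hlocal κ ⟨hκ0, (min_le_left _ _).trans_lt (by linarith)⟩
  have ht : Tendsto (tSeq (meanMajorant P Φ) (varCount P A) q κ ϱ) atTop atTop :=
    (tendsto_passage hmono (fun _ => le_rfl) hf).comp
      (tendsto_vLevel (Or.inr hμ) hϱ0 (by linarith))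
  obtain ⟨B, T, -, hloc⟩ := hpart.exists_local_increment hmono ht
  have hF := eventually_abs_sub_level_le
    (fun s t hst => (abs_of_nonneg (sub_nonneg.2 (hmono hst))).le) hf ht hloc
  have hs := hmin.tendsto ht
  obtain ⟨C, hC, hle⟩ := hgrowth.exists_le hvar hϱ0
  have hF' : ∀ᶠ n : ℕ in atTop,
      |meanMajorant P Φ (tSeq (meanMajorant P Φ) (varCount P A) q κ ϱ n) -
        (n : ℝ) ^ ((μ + ϱ) * (1 - κ) / (μ + ϱ - 1))| ≤ B := by
    simpa only [tSeq, ← hμdef, vLevel_of_one_lt hμ] using hF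
  obtain ⟨h1, h2, K, h3⟩ := polynomial_levels (G := fun n => meanMajorant P Φ (s n))
    (α := fun n => varCount P A (s n)) (by linarith) hκ0 (by linarith) hκm hC hF'
    (hmin.eventually_mem.mono fun n hn => hmono hn.1) (hvar.comp hs) (hs.eventually hle)
  refine ae_eventually_abs_le hA hΦ (isNormalizer_log hμ1) hvar hδ0 hδ1.le hmin
    hpart ht (half_pos hκ0) h1 h2 ?_
  have hexp : 1 - δ / 4 < (μ - 1) * ((1 - κ) / (μ + ϱ - 1)) := by
    rw [← mul_div_assoc, lt_div_iff₀ (by linarith)]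
    nlinarith [mul_pos hμ1 hδ0, mul_le_mul_of_nonneg_left hκδ hμ1.le, mul_pos hϱ0 hδ0]
  filter_upwards [h3, eventually_mul_log_add_le hexp ((μ - 1) * K)] with n h4 h5
  have h6 := mul_le_mul_of_nonneg_left h4 hμ1.le
  linarith

/-! ### The lower bound along the levels of the variance -/

lemma exists_abs_varCount_tauSeq_sub_le {q : ℝ} (hA : IsIndepEvents P A)
    (hvar : Tendsto (varCount P A) atTop atTop) (hΦ : IsMajorant P A M Φ)
    (hμ : growthExponent (meanMajorant P Φ) (varCount P A) = 1 ∧ 0 ≤ q ∨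
      1 < growthExponent (meanMajorant P Φ) (varCount P A))
    (hlocal : LocalCondition (meanMajorant P Φ) (varCount P A) q) :
    ∃ B, ∀ γ > 0, Tendsto (tauSeq (meanMajorant P Φ) (varCount P A) q γ) atTop atTop ∧
      ∀ᶠ n in atTop, |varCount P A (tauSeq (meanMajorant P Φ) (varCount P A) q γ n) -
        wLevel (growthExponent (meanMajorant P Φ) (varCount P A)) q γ n| ≤ B := by
  have haf := varCount_le_meanMajorant hA hΦ
  have hmono := meanMajorant_mono hA hΦ
  have hf : Tendsto (meanMajorant P Φ) atTop atTop := tendsto_atTop_mono haf hvar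
  obtain ⟨κ₀, hκ₀, hlocal⟩ := hlocal (1 / 2) ⟨by norm_num, by norm_num⟩
  have hκ0 : 0 < min (κ₀ / 2) (1 / 2) := by positivity
  have hκ1 : min (κ₀ / 2) (1 / 2) < 1 := (min_le_right _ _).trans_lt (by norm_num)
  obtain ⟨s, -, hpart⟩ := hlocal _ ⟨hκ0, (min_le_left _ _).trans_lt (by linarith)⟩
  obtain ⟨B, T, -, hloc⟩ := hpart.exists_local_increment hmono
    ((tendsto_passage hmono (fun _ => le_rfl) hf).comp
      (tendsto_vLevel hμ (by norm_num : (0 : ℝ) < 1 / 2) hκ1))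
  refine ⟨B, fun γ hγ => ?_⟩
  have hτ : Tendsto (tauSeq (meanMajorant P Φ) (varCount P A) q γ) atTop atTop :=
    (tendsto_passage hmono haf hvar).comp (tendsto_wLevel hμ hγ)
  exact ⟨hτ, eventually_abs_sub_level_le (fun s t hst => abs_varCount_sub_le hA hΦ hst) hvar hτ
    hloc⟩

/-- The lower bound along `τ_n(γ)`, for a normalizer with
`Ψ(a(τ_n(γ))) = (1 + γ) log n + O(1)`. -/
lemma ae_frequently_le_of_levels {q : ℝ} (hA : IsIndepEvents P A)
    (hvar : Tendsto (varCount P A) atTop atTop) {Ψ : ℝ → ℝ} (hΨ : IsNormalizer Ψ)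
    {f : ℝ≥0 → ℝ} (hτ : ∀ γ > 0, Tendsto (tauSeq f (varCount P A) q γ) atTop atTop)
    (hlev : ∀ γ > 0, ∃ K, ∀ᶠ n : ℕ in atTop,
      |Ψ (varCount P A (tauSeq f (varCount P A) q γ n)) - (1 + γ) * Real.log n| ≤ K)
    (hblocks : ApproximateBlocks P A f q ∨ ExactBlocks P A f q)
    {δ : ℝ} (hδ : δ ∈ Set.Ioo (0 : ℝ) 1) {e : ℝ} (he : |e| = 1) :
    ∀ᵐ ω ∂P, ∃ᶠ u in atTop,
      (1 - 2 * δ) * √(2 * varCount P A u * Ψ (varCount P A u)) ≤ e * centredCount P A u ω := by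
  obtain ⟨hδ0, hδ1⟩ := hδ
  obtain ⟨R, ε, hε, hdisj, hshare⟩ :=
    exists_blocks hvar hblocks (by positivity : 0 < δ ^ 2 / 16)
  set γ := min (ε / 2) (δ / 16) with hγ
  have hγ0 : 0 < γ := by positivity
  have hγδ : γ ≤ δ / 16 := min_le_right _ _
  have hγε : γ < ε := (min_le_left _ _).trans_lt (by linarith)
  obtain ⟨K, hK⟩ := hlev γ hγ0
  have h := ae_frequently_le hA hΨ (hvar.comp (hτ γ hγ0)) (hdisj γ ⟨hγ0, hγε⟩) hδ0 hδ1
    (by positivity : 0 < δ ^ 2 / 16) le_rfl ((hτ γ hγ0).eventually hshare)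
    (by
      filter_upwards [hK, eventually_mul_log_add_le (by linarith : 1 / 2 < 1 + γ) K] with n h1 h2
      linarith [(abs_le.1 h1).1])
    (by
      filter_upwards [hK, eventually_mul_log_add_le (by linarith : 1 + γ < 1 + δ / 8) K]
        with n h1 h2
      linarith [(abs_le.1 h1).2]) he
  filter_upwards [h] with ω hω
  exact (hτ γ hγ0).frequently hω

lemma exists_abs_log_log_sub_le {q γ B : ℝ} {α : ℕ → ℝ} (hq : 0 ≤ q) (hγ : 0 < γ)
    (hα : ∀ᶠ n : ℕ in atTop, |α n - Real.exp ((n : ℝ) ^ ((1 + γ) / (q + 1)))| ≤ B) :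
    ∃ K, ∀ᶠ n : ℕ in atTop,
      |(q + 1) * Real.log (Real.log (α n)) - (1 + γ) * Real.log n| ≤ K := by
  have hg : 0 < (1 + γ) / (q + 1) := by positivity
  have h1 := eventually_abs_log_sub_log_le
    (Real.tendsto_exp_atTop.comp (tendsto_natCast_rpow hg)) hα
  simp only [Function.comp, Real.log_exp] at h1
  have h2 := eventually_abs_log_sub_log_le (tendsto_natCast_rpow hg) h1
  refine ⟨(q + 1) * Real.log 2, ?_⟩
  filter_upwards [h2, eventually_ge_atTop 1] with n h3 h4
  have hn0 : (0 : ℝ) < n := by exact_mod_cast h4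
  rw [Real.log_rpow hn0] at h3
  have e : (q + 1) * Real.log (Real.log (α n)) - (1 + γ) * Real.log n =
      (q + 1) * (Real.log (Real.log (α n)) - (1 + γ) / (q + 1) * Real.log n) := by
    field_simp
  rw [e, abs_mul, abs_of_pos (by positivity : 0 < q + 1)]
  gcongr

lemma exists_abs_log_sub_le {μ γ B : ℝ} {α : ℕ → ℝ} (hμ : 1 < μ) (hγ : 0 < γ)
    (hα : ∀ᶠ n : ℕ in atTop, |α n - (n : ℝ) ^ ((1 + γ) / (μ - 1))| ≤ B) :
    ∃ K, ∀ᶠ n : ℕ in atTop, |(μ - 1) * Real.log (α n) - (1 + γ) * Real.log n| ≤ K := by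
  have hμ1 : 0 < μ - 1 := by linarith
  have hg : 0 < (1 + γ) / (μ - 1) := by positivity
  have h2 := eventually_abs_log_sub_log_le (tendsto_natCast_rpow hg) hα
  refine ⟨(μ - 1) * Real.log 2, ?_⟩
  filter_upwards [h2, eventually_ge_atTop 1] with n h3 h4
  have hn0 : (0 : ℝ) < n := by exact_mod_cast h4
  rw [Real.log_rpow hn0] at h3
  have e : (μ - 1) * Real.log (α n) - (1 + γ) * Real.log n =
      (μ - 1) * (Real.log (α n) - (1 + γ) / (μ - 1) * Real.log n) := by
    field_simp
  rw [e, abs_mul, abs_of_pos hμ1]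
  gcongr

end

end IndicatorLIL

theorem theorem2p1 {Ω : Type*} [MeasurableSpace Ω] (P : MeasureTheory.Measure Ω)
    [MeasureTheory.IsProbabilityMeasure P]
    (A : ℕ → ℝ≥0 → Set Ω) (M : ℕ) (Φ : ℕ → ℝ≥0 → Ω → ℕ) (q : ℝ)
    (hA : IndicatorLIL.IsIndepEvents P A)
    (hvar : Tendsto (IndicatorLIL.varCount P A) atTop atTop)
    (hΦ : IndicatorLIL.IsMajorant P A M Φ)
    (hgrowth : IndicatorLIL.GrowthCondition
      (IndicatorLIL.meanMajorant P Φ) (IndicatorLIL.varCount P A) q)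
    (hlocal : IndicatorLIL.LocalCondition
      (IndicatorLIL.meanMajorant P Φ) (IndicatorLIL.varCount P A) q)
    (hreg : IndicatorLIL.VarianceRegular
      (IndicatorLIL.growthExponent (IndicatorLIL.meanMajorant P Φ) (IndicatorLIL.varCount P A))
      (IndicatorLIL.varCount P A))
    (hblocks : IndicatorLIL.ApproximateBlocks P A (IndicatorLIL.meanMajorant P Φ) q ∨
      IndicatorLIL.ExactBlocks P A (IndicatorLIL.meanMajorant P Φ) q) :
    (IndicatorLIL.growthExponent
        (IndicatorLIL.meanMajorant P Φ) (IndicatorLIL.varCount P A) = 1 →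
      IndicatorLIL.SatisfiesLIL P A fun t =>
        2 * (q + 1) * IndicatorLIL.varCount P A t *
          Real.log (Real.log (IndicatorLIL.varCount P A t))) ∧
    (1 < IndicatorLIL.growthExponent
        (IndicatorLIL.meanMajorant P Φ) (IndicatorLIL.varCount P A) →
      IndicatorLIL.SatisfiesLIL P A fun t =>
        2 * (IndicatorLIL.growthExponent
            (IndicatorLIL.meanMajorant P Φ) (IndicatorLIL.varCount P A) - 1) *
          IndicatorLIL.varCount P A t * Real.log (IndicatorLIL.varCount P A t)) := by
  open IndicatorLIL in
  refine ⟨fun hμ => ?_, fun hμ => ?_⟩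
  · have hindex := hgrowth.logIndex hμ
    have hq := hindex.1
    have hr : (fun t => 2 * (q + 1) * varCount P A t * Real.log (Real.log (varCount P A t))) =
        fun t => 2 * varCount P A t * ((q + 1) * Real.log (Real.log (varCount P A t))) := by
      funext t
      ring
    obtain ⟨B, hB⟩ := exists_abs_varCount_tauSeq_sub_le hA hvar hΦ (Or.inl ⟨hμ, hq⟩) hlocal
    have hlog := Real.tendsto_log_atTop.comp (Real.tendsto_log_atTop.comp hvar)
    rw [hr]
    refine satisfiesLIL_of_bounds ?_
      (fun δ hδ => ae_eventually_abs_le_of_one hA hvar hΦ hμ hindex hlocal hδ)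
      (fun δ hδ e he => ae_frequently_le_of_levels hA hvar
        (isNormalizer_log_log (by linarith : 0 < q + 1)) (fun γ hγ => (hB γ hγ).1)
        (fun γ hγ => exists_abs_log_log_sub_le hq hγ
          (by simpa only [hμ, wLevel_one] using (hB γ hγ).2)) hblocks hδ he)
    filter_upwards [hvar.eventually_gt_atTop 0, hlog.eventually_gt_atTop 0] with t h1 h2
    have h3 : 0 < Real.log (Real.log (varCount P A t)) := h2
    positivity
  · have hμ1 := sub_pos.2 hμ
    have hr : (fun t => 2 * (growthExponent (meanMajorant P Φ) (varCount P A) - 1) *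
          varCount P A t * Real.log (varCount P A t)) =
        fun t => 2 * varCount P A t * ((growthExponent (meanMajorant P Φ) (varCount P A) - 1) *
          Real.log (varCount P A t)) := by
      funext t
      ring
    obtain ⟨B, hB⟩ := exists_abs_varCount_tauSeq_sub_le hA hvar hΦ (Or.inr hμ) hlocal
    have hlog := Real.tendsto_log_atTop.comp hvar
    rw [hr]
    refine satisfiesLIL_of_bounds ?_
      (fun δ hδ => ae_eventually_abs_le_of_one_lt hA hvar hΦ hμ hgrowth hlocal hδ)
      (fun δ hδ e he => ae_frequently_le_of_levels hA hvar
        (isNormalizer_log hμ1) (fun γ hγ => (hB γ hγ).1)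
        (fun γ hγ => exists_abs_log_sub_le hμ hγ
          (by simpa only [wLevel_of_one_lt hμ] using (hB γ hγ).2)) hblocks hδ he)
    filter_upwards [hvar.eventually_gt_atTop 0, hlog.eventually_gt_atTop 0] with t h1 h2
    have h3 : 0 < Real.log (varCount P A t) := h2
    positivity
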